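/- Let $\Gamma$ be a simple graph (finite or infinite) with vertex set $V$. For $v\in V$ let $(A_v,\varphi_v)$ and $(B_v,\psi_v)$ be unital C*-algebras with states whose GNS representations are faithful, and let $\theta_v:A_v\to B_v$ be unital completely positive maps with $\psi_v\circ\theta_v=\varphi_v$. A word $v_1\cdots v_n$ in $V$ is reduced if it is not equivalent to a shorter word under the equivalence relation generated by deleting two equal consecutive letters and interchanging two consecutive letters that share an edge. Let $(H_v,\pi_v,\xi_v)$ be the GNS triple of $\varphi_v$ and $\mathring H_v=\xi_v^\perp$. The Fock space is $\mathcal F=\bigoplus_{w}\mathring H_{w}$, summed over the equivalence classes $w$ of words, where $\mathring H_w=\mathring H_{v_1}\otimes\cdots\otimes\mathring H_{v_n}$ for a reduced word $v_1\cdots v_n$ in the class $w$ (different reduced words of the same class being identified by shuffling the tensor legs), and $\mathring H_e=\mathbb C\Omega$. For $v\in V$ let $\mathcal H^L(v)$ be the sum of those $\mathring H_w$ with $w$ represented by a reduced word $v_1\cdots v_n$ such that $vv_1\cdots v_n$ is reduced; let $U_v:H_v\otimes\mathcal H^L(v)\to\mathcal F$ be the unitary with $U_v(\xi_v\otimes\eta)=\eta$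 and $U_v(\eta_0\otimes\eta)=\eta_0\otimes\eta$ for $\eta_0\in\mathring H_v$; and put $\lambda_v(a)=U_v(\pi_v(a)\otimes 1)U_v^*$ for $a\in A_v$. For a reduced word $v_1\cdots v_n$ and $a_i\in\ker\varphi_{v_i}$ put $\lambda(a_1\otimes\cdots\otimes a_n)=\lambda_{v_1}(a_1)\cdots\lambda_{v_n}(a_n)$, which is $1$ for $n=0$. The linear span of these operators is denoted $\lambda(\mathbf A)$. The reduced graph product $(\mathcal A,\varphi)=*_{v,\Gamma}(A_v,\varphi_v)$ is the C*-algebra of operators on $\mathcal F$ generated by $\lambda(\mathbf A)$, with the state $\varphi(x)=\langle x\Omega,\Omega\rangle$. Let $(\mathcal B,\psi)=*_{v,\Gamma}(B_v,\psi_v)$ and $\lambda(\mathbf B)$ be defined in the same way from $(B_v,\psi_v)$. Then $\mathcal A$ and $\mathcal B$ are the norm closures of $\lambda(\mathbf A)$ and $\lambda(\mathbf B)$, and the algebraic graph product map $\theta=*_{v,\Gamma}\theta_v$ is well defined and extends to a state-preserving unital completely positive map $\mathcal A\to\mathcal B$: there is a unital completely positive map $\Theta:\mathcal A\to\mathcal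 B$ with $\psi\circ\Theta=\varphi$ and $$\Theta\bigl(\lambda(a_1\otimes\cdots\otimes a_n)\bigr)=\lambda\bigl(\theta_{v_1}(a_1)\otimes\cdots\otimes\theta_{v_n}(a_n)\bigr)$$ for every reduced word $v_1\cdots v_n$ ($n\ge 0$) and all $a_i\in\ker\varphi_{v_i}$. -/

import Mathlib

open scoped InnerProductSpace TensorProduct ComplexOrder CStarAlgebra

noncomputable section

namespace GraphProduct

/-! ### Words with letters in the vertex set of a simple graph -/

section Words

variable {V : Type*} (Γ : SimpleGraph V)

/-- The elementary moves on words: two consecutive equal letters may be deleted, and two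
consecutive letters that share an edge may be interchanged. -/
inductive WordStep : List V → List V → Prop
  | cancel (l r : List V) (v : V) : WordStep (l ++ v :: v :: r) (l ++ r)
  | swap (l r : List V) (v w : V) (h : Γ.Adj v w) :
      WordStep (l ++ v :: w :: r) (l ++ w :: v :: r)

/-- The equivalence relation on words generated by the elementary moves. Its classes are the
elements of the right-angled Coxeter group `W` of the graph. -/
def WordEquiv : List V → List V → Prop := Relation.EqvGen (WordStep Γ)

/-- A word is reduced if it is not equivalent to a strictly shorter word. -/
def IsReduced (l : List V) : Prop := ∀ l', WordEquiv Γ l l' → l.length ≤ l'.length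

variable {Γ}

theorem WordEquiv.refl (l : List V) : WordEquiv Γ l l := Relation.EqvGen.refl l

theorem WordEquiv.symm {l m : List V} (h : WordEquiv Γ l m) : WordEquiv Γ m l :=
  Relation.EqvGen.symm _ _ h

theorem WordEquiv.trans {l m n : List V} (h : WordEquiv Γ l m) (h' : WordEquiv Γ m n) :
    WordEquiv Γ l n := Relation.EqvGen.trans _ _ _ h h'

theorem WordEquiv.cons (v : V) {l m : List V} (h : WordEquiv Γ l m) :
    WordEquiv Γ (v :: l) (v :: m) := by
  induction h with
  | rel x y h =>
    refine Relation.EqvGen.rel _ _ ?_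
    cases h with
    | cancel l r u => exact WordStep.cancel (v :: l) r u
    | swap l r u w h => exact WordStep.swap (v :: l) r u w h
  | refl x => exact WordEquiv.refl _
  | symm x y _ ih => exact ih.symm
  | trans x y z _ _ ih ih' => exact ih.trans ih'

theorem WordEquiv.cons_cons (v : V) (l : List V) : WordEquiv Γ (v :: v :: l) l :=
  Relation.EqvGen.rel _ _ (WordStep.cancel [] l v)

theorem WordEquiv.cons_iff (v : V) {l m : List V} :
    WordEquiv Γ (v :: l) (v :: m) ↔ WordEquiv Γ l m :=
  ⟨fun h => ((WordEquiv.cons_cons v l).symm.trans (h.cons v)).trans (WordEquiv.cons_cons v m),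
    fun h => h.cons v⟩

theorem IsReduced.nil : IsReduced Γ ([] : List V) := fun _ _ => Nat.zero_le _

theorem IsReduced.length_eq {l m : List V} (hl : IsReduced Γ l) (hm : IsReduced Γ m)
    (h : WordEquiv Γ l m) : l.length = m.length :=
  le_antisymm (hl _ h) (hm _ h.symm)

theorem IsReduced.of_cons {v : V} {l : List V} (h : IsReduced Γ (v :: l)) : IsReduced Γ l := by
  intro m hm
  have := h _ (hm.cons v)
  simpa using this

/-- If `v l` and `v m` are reduced then `v l` is not equivalent to `m`. -/
theorem not_wordEquiv_cons {v : V} {l m : List V} (hl : IsReduced Γ (v :: l))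
    (hm : IsReduced Γ (v :: m)) : ¬ WordEquiv Γ (v :: l) m := by
  intro h
  have h1 := hl.length_eq hm.of_cons h
  have h2 := hl.of_cons.length_eq hm ((WordEquiv.cons_cons v l).symm.trans (h.cons v))
  simp only [List.length_cons] at h1 h2
  omega

end Words

/-! ### Hilbert space preliminaries -/

section Hilbert

/-- Two families with the same Gram matrix, the first one total: the isometry that maps the
first family to the second one. -/
theorem exists_isometry {ι E F : Type*} [NormedAddCommGroup E] [InnerProductSpace ℂ E]
    [NormedAddCommGroup F] [InnerProductSpace ℂ F] [CompleteSpace F] (e : ι → E) (f : ι → F)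
    (he : (Submodule.span ℂ (Set.range e)).topologicalClosure = ⊤)
    (h : ∀ i j, ⟪f i, f j⟫_ℂ = ⟪e i, e j⟫_ℂ) :
    ∃! U : E →ₗᵢ[ℂ] F, ∀ i, U (e i) = f i := by
  let e' := Finsupp.linearCombination ℂ e
  let f' := Finsupp.linearCombination ℂ f
  have hd : DenseRange e' := by
    rw [DenseRange, ← LinearMap.coe_range, Finsupp.range_linearCombination]
    exact Submodule.dense_iff_topologicalClosure_eq_top.2 he
  have hin : ∀ c d : ι →₀ ℂ, ⟪f' c, f' d⟫_ℂ = ⟪e' c, e' d⟫_ℂ := by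
    intro c d
    simp only [e', f', Finsupp.linearCombination_apply, Finsupp.sum_inner, Finsupp.inner_sum,
      inner_smul_left, inner_smul_right, h]
  have hn : ∀ c, ‖f' c‖ = ‖e' c‖ := by
    intro c
    rw [@norm_eq_sqrt_re_inner ℂ, @norm_eq_sqrt_re_inner ℂ, hin]
  have hb : ∃ C, ∀ c, ‖f' c‖ ≤ C * ‖e' c‖ := ⟨1, fun c => by rw [one_mul, hn]⟩
  let T := f'.extendOfNorm e'
  have hT : ∀ c, T (e' c) = f' c := fun c => LinearMap.extendOfNorm_eq hd hb c
  have hTn : ∀ z, ‖T z‖ = ‖z‖ := by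
    intro z
    refine hd.induction_on (p := fun z => ‖T z‖ = ‖z‖) z
      (isClosed_eq (by fun_prop) (by fun_prop)) fun c => ?_
    rw [hT, hn]
  refine ⟨⟨T.toLinearMap, hTn⟩, fun i => ?_, fun U hU => ?_⟩
  · have := hT (Finsupp.single i 1)
    simpa [e', f'] using this
  · ext z
    refine congrFun (hd.equalizer U.continuous T.continuous (funext fun c => ?_)) z
    simp only [Function.comp_apply, hT]
    simp only [e', f', Finsupp.linearCombination_apply, Finsupp.sum, map_sum, map_smul, hU]

variable {E F : Type*} [NormedAddCommGroup E] [InnerProductSpace ℂ E]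
  [NormedAddCommGroup F] [InnerProductSpace ℂ F]

variable (E F) in
/-- The Hilbert space tensor product: the completion of the algebraic tensor product. -/
def HilbertTensor := UniformSpace.Completion (E ⊗[ℂ] F)

instance : NormedAddCommGroup (HilbertTensor E F) :=
  inferInstanceAs (NormedAddCommGroup (UniformSpace.Completion (E ⊗[ℂ] F)))

instance : InnerProductSpace ℂ (HilbertTensor E F) :=
  inferInstanceAs (InnerProductSpace ℂ (UniformSpace.Completion (E ⊗[ℂ] F)))

instance : CompleteSpace (HilbertTensor E F) :=
  inferInstanceAs (CompleteSpace (UniformSpace.Completion (E ⊗[ℂ] F)))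

variable (E F) in
/-- The dense isometric inclusion of the algebraic tensor product. -/
def algTensor : E ⊗[ℂ] F →ₗᵢ[ℂ] HilbertTensor E F :=
  (UniformSpace.Completion.toComplₗᵢ : E ⊗[ℂ] F →ₗᵢ[ℂ] UniformSpace.Completion (E ⊗[ℂ] F))

theorem denseRange_algTensor : DenseRange (algTensor E F) :=
  UniformSpace.Completion.denseRange_coe

/-- The elementary tensor `h ⊗ y`. -/
def htmul (h : E) (y : F) : HilbertTensor E F := algTensor E F (h ⊗ₜ y)

theorem inner_htmul (h k : E) (y z : F) : ⟪htmul h y, htmul k z⟫_ℂ = ⟪h, k⟫_ℂ * ⟪y, z⟫_ℂ := by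
  rw [htmul, htmul, LinearIsometry.inner_map_map, TensorProduct.inner_tmul]

variable (F) in
/-- The operator `a ⊗ 1`. -/
def ampL (a : E →L[ℂ] E) : HilbertTensor E F →L[ℂ] HilbertTensor E F :=
  (TensorProduct.mapL a (ContinuousLinearMap.id ℂ F)).completion

theorem ampL_htmul (a : E →L[ℂ] E) (h : E) (y : F) :
    ampL F a (htmul h y) = htmul (a h) y :=
  ContinuousLinearMap.completion_apply_coe _ _

theorem htmul_total {ι : Type*} (f : ι → F)
    (hf : (Submodule.span ℂ (Set.range f)).topologicalClosure = ⊤) :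
    (Submodule.span ℂ (Set.range fun i : E × ι => htmul i.1 (f i.2))).topologicalClosure = ⊤ := by
  set S := (Submodule.span ℂ (Set.range fun i : E × ι => htmul i.1 (f i.2))).topologicalClosure
    with hS
  have hSc : IsClosed (S : Set (HilbertTensor E F)) := Submodule.isClosed_topologicalClosure _
  have h1 : ∀ (h : E) (y : F), htmul h y ∈ S := by
    intro h y
    let T : F →L[ℂ] HilbertTensor E F :=
      (algTensor E F).toContinuousLinearMap ∘L TensorProduct.mkL ℂ E F h
    have hdense := Submodule.dense_iff_topologicalClosure_eq_top.2 hf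
    refine hdense.induction (P := fun y => T y ∈ S) ?_ (hSc.preimage T.continuous) y
    intro y hy
    induction hy using Submodule.span_induction with
    | mem y hy =>
      obtain ⟨x, rfl⟩ := hy
      exact Submodule.le_topologicalClosure _ (Submodule.subset_span ⟨(h, x), rfl⟩)
    | zero => simp
    | add a b _ _ ha hb => rw [map_add]; exact S.add_mem ha hb
    | smul c a _ ha => rw [map_smul]; exact S.smul_mem c ha
  rw [eq_top_iff]
  intro z _
  refine denseRange_algTensor.induction_on (p := fun z => z ∈ S) z hSc fun t => ?_
  induction t using TensorProduct.induction_on with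
  | zero => rw [map_zero]; exact S.zero_mem
  | tmul h y => exact h1 h y
  | add a b ha hb => rw [map_add]; exact S.add_mem ha hb

end Hilbert

/-! ### The Fock space of a graph product of pointed Hilbert spaces -/

section Fock

/-- The scalar `⟪a₁, b₁⟫ ⋯ ⟪aₙ, bₙ⟫` for two lists of vectors of the same length (and `0` for
lists of different lengths). -/
def listInner {E : Type*} [NormedAddCommGroup E] [InnerProductSpace ℂ E] : List E → List E → ℂ
  | [], [] => 1
  | a :: l, b :: m => ⟪a, b⟫_ℂ * listInner l m
  | [], _ :: _ => 0
  | _ :: _, [] => 0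

variable {V : Type*} (Γ : SimpleGraph V) {H : V → Type*} [∀ v, NormedAddCommGroup (H v)]
  [∀ v, InnerProductSpace ℂ (H v)] (ξ : ∀ v, H v)

/-- A tensor leg: a letter `v` together with a vector of the orthogonal complement `H̊ᵥ` of the
distinguished vector `ξᵥ`. -/
abbrev Leg := Σ v, ((ℂ ∙ ξ v)ᗮ : Submodule ℂ (H v))

/-- Elementary tensors `η₁ ⊗ ⋯ ⊗ ηₙ` with `ηᵢ ∈ H̊_{vᵢ}` for a reduced word `v₁ ⋯ vₙ`. The empty
list is the vacuum vector `Ω`. -/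
def ElemTensor := {x : List (Leg ξ) // IsReduced Γ (x.map Sigma.fst)}

open Classical in
/-- The legs of `x` that carry the letter `v`, in order. -/
def legs (v : V) (x : List (Leg ξ)) : List ((ℂ ∙ ξ v)ᗮ : Submodule ℂ (H v)) :=
  x.filterMap fun p => if h : p.1 = v then some (h ▸ p.2) else none

open Classical in
/-- The inner product of two elementary tensors `x = η₁ ⊗ ⋯ ⊗ ηₙ` and `y = ζ₁ ⊗ ⋯ ⊗ ζₙ`.
Tensors whose words represent different elements of the Coxeter group are orthogonal. If the
reduced words `v₁ ⋯ vₙ` and `w₁ ⋯ wₙ` of `x` and `y` represent the same element, there is a unique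
permutation `σ` with `vᵢ = w_{σ(i)}` that keeps equal letters in order, and the inner product is
`∏ᵢ ⟪ηᵢ, ζ_{σ(i)}⟫`; the product is arranged by letters. -/
def elemInner (x y : ElemTensor Γ ξ) : ℂ :=
  if WordEquiv Γ (x.1.map Sigma.fst) (y.1.map Sigma.fst) then
    ∏ᶠ v, listInner (legs ξ v x.1) (legs ξ v y.1)
  else 0

variable {Γ ξ}

theorem posSemidef_of_local {X : Type*} {M : Matrix X X ℂ}
    (h : ∀ S : Finset X, ∃ N : Matrix X X ℂ, N.PosSemidef ∧ ∀ x ∈ S, ∀ y ∈ S, M x y = N x y) :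
    M.PosSemidef := by
  classical
  refine ⟨?_, fun c => ?_⟩
  · ext x y
    obtain ⟨N, hN, hMN⟩ := h {x, y}
    rw [Matrix.conjTranspose_apply, hMN _ (by simp) _ (by simp), hMN _ (by simp) _ (by simp)]
    exact hN.1.apply _ _
  · obtain ⟨N, hN, hMN⟩ := h c.support
    have := hN.2 c
    refine this.trans_eq (Finsupp.sum_congr fun i hi => Finsupp.sum_congr fun j hj => ?_)
    rw [hMN i hi j hj]

theorem posSemidef_of_eq {X : Type*} {M N : Matrix X X ℂ} (hN : N.PosSemidef)
    (h : ∀ x y, M x y = N x y) : M.PosSemidef := by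
  have : M = N := Matrix.ext h
  rwa [this]

theorem posSemidef_inner {X E : Type*} [NormedAddCommGroup E] [InnerProductSpace ℂ E]
    (v : X → E) : (Matrix.of fun x y => ⟪v x, v y⟫_ℂ).PosSemidef := by
  refine ⟨?_, fun c => ?_⟩
  · ext x y
    simp
  · have h : (c.sum fun i xi => c.sum fun j xj => star xi *
        (Matrix.of fun x y => ⟪v x, v y⟫_ℂ) i j * xj) =
        ⟪c.sum fun i a => a • v i, c.sum fun i a => a • v i⟫_ℂ := by
      simp only [Finsupp.sum, sum_inner, inner_sum, Matrix.of_apply]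
      rw [Finset.sum_comm]
      refine Finset.sum_congr rfl fun i _ => Finset.sum_congr rfl fun j _ => ?_
      rw [inner_smul_left, inner_smul_right, RCLike.star_def]
      ring
    rw [h, inner_self_eq_norm_sq_to_K, ← RCLike.ofReal_pow]
    exact RCLike.ofReal_nonneg.2 (sq_nonneg _)

theorem posSemidef_listInner {X E : Type*} [NormedAddCommGroup E] [InnerProductSpace ℂ E]
    (f : X → List E) : (Matrix.of fun x y => listInner (f x) (f y)).PosSemidef := by
  classical
  have hone : ∀ f : X → List E, (Matrix.of fun x y =>
      (if (f x).length = 0 then (1 : ℂ) else 0) *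
        (if (f y).length = 0 then 1 else 0)).PosSemidef := by
    intro f
    refine posSemidef_of_eq (posSemidef_inner fun x => if (f x).length = 0 then (1 : ℂ) else 0)
      fun x y => ?_
    simp only [Matrix.of_apply, RCLike.inner_apply]
    split_ifs <;> simp
  have key : ∀ n : ℕ, ∀ f : X → List E, (Matrix.of fun x y =>
      if (f x).length ≤ n ∧ (f y).length ≤ n then listInner (f x) (f y) else 0).PosSemidef := by
    intro n
    induction n with
    | zero =>
      intro f
      refine posSemidef_of_eq (hone f) fun x y => ?_
      rcases hx : f x with _ | ⟨a, l⟩ <;> rcases hy : f y with _ | ⟨b, m⟩ <;>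
        simp [hx, hy, listInner]
    | succ n ih =>
      intro f
      refine posSemidef_of_eq ((hone f).add ((posSemidef_inner fun x => (f x).headD 0).hadamard
        (ih fun x => (f x).tail))) fun x y => ?_
      rcases hx : f x with _ | ⟨a, l⟩ <;> rcases hy : f y with _ | ⟨b, m⟩ <;>
        simp [hx, hy, listInner]
  refine posSemidef_of_local fun S => ⟨_, key (S.sup fun x => (f x).length) f, ?_⟩
  intro x hx y hy
  have h1 := Finset.le_sup (f := fun x => (f x).length) hx
  have h2 := Finset.le_sup (f := fun x => (f x).length) hy
  simp only [Matrix.of_apply]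
  rw [if_pos ⟨h1, h2⟩]

theorem posSemidef_prod {X ι : Type*} (s : Finset ι) (M : ι → Matrix X X ℂ)
    (h : ∀ i ∈ s, (M i).PosSemidef) :
    (Matrix.of fun x y => ∏ i ∈ s, M i x y).PosSemidef := by
  classical
  induction s using Finset.induction_on with
  | empty =>
    refine posSemidef_of_eq (posSemidef_inner fun _ : X => (1 : ℂ)) fun x y => ?_
    simp
  | insert i s hi ih =>
    refine posSemidef_of_eq ((h i (by simp)).hadamard (ih fun j hj => h j (by simp [hj])))
      fun x y => ?_
    simp [Finset.prod_insert hi]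

theorem legs_nil (v : V) : legs ξ v [] = [] := rfl

theorem legs_cons_same (v : V) (η : ((ℂ ∙ ξ v)ᗮ : Submodule ℂ (H v))) (x : List (Leg ξ)) :
    legs ξ v (⟨v, η⟩ :: x) = η :: legs ξ v x := by
  simp [legs]

theorem legs_cons_ne {u v : V} (h : v ≠ u) (η : ((ℂ ∙ ξ v)ᗮ : Submodule ℂ (H v)))
    (x : List (Leg ξ)) : legs ξ u (⟨v, η⟩ :: x) = legs ξ u x := by
  simp [legs, h]

theorem legs_eq_nil {v : V} {x : List (Leg ξ)} (h : v ∉ x.map Sigma.fst) : legs ξ v x = [] := by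
  induction x with
  | nil => rfl
  | cons p x ih =>
    obtain ⟨u, η⟩ := p
    simp only [List.map_cons, List.mem_cons, not_or] at h
    rw [legs_cons_ne (Ne.symm h.1), ih h.2]

theorem listInner_legs_eq_one {v : V} {x y : List (Leg ξ)} (hx : v ∉ x.map Sigma.fst)
    (hy : v ∉ y.map Sigma.fst) : listInner (legs ξ v x) (legs ξ v y) = 1 := by
  rw [legs_eq_nil hx, legs_eq_nil hy, listInner]

theorem posSemidef_elemInner : (Matrix.of (elemInner Γ ξ)).PosSemidef := by
  classical
  let q : ElemTensor Γ ξ → Quot (WordStep Γ) := fun x => Quot.mk _ (x.1.map Sigma.fst)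
  have hq : ∀ x y : ElemTensor Γ ξ,
      WordEquiv Γ (x.1.map Sigma.fst) (y.1.map Sigma.fst) ↔ q x = q y := fun x y =>
    Quot.eq.symm
  have hind : (Matrix.of fun x y => if q x = q y then (1 : ℂ) else 0).PosSemidef := by
    convert (Matrix.PosSemidef.one (n := Quot (WordStep Γ)) (R := ℂ)).submatrix q using 1
    ext x y
    simp [Matrix.one_apply]
  refine posSemidef_of_local fun S => ?_
  let L : Finset V := S.biUnion fun x => (x.1.map Sigma.fst).toFinset
  refine ⟨_, hind.hadamard (posSemidef_prod L
    (fun v => Matrix.of fun x y : ElemTensor Γ ξ => listInner (legs ξ v x.1) (legs ξ v y.1))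
    fun v _ => posSemidef_listInner fun x : ElemTensor Γ ξ => legs ξ v x.1), ?_⟩
  intro x hx y hy
  have hxL : ∀ v, v ∉ L → v ∉ x.1.map Sigma.fst := fun v hv hv' =>
    hv (Finset.mem_biUnion.2 ⟨x, hx, by simpa using hv'⟩)
  have hyL : ∀ v, v ∉ L → v ∉ y.1.map Sigma.fst := fun v hv hv' =>
    hv (Finset.mem_biUnion.2 ⟨y, hy, by simpa using hv'⟩)
  simp only [Matrix.of_apply, Matrix.hadamard_apply, elemInner, hq]
  rw [finprod_eq_prod_of_mulSupport_subset (s := L)]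
  · simp
  · intro v hv
    by_contra hvL
    exact hv (listInner_legs_eq_one (hxL v hvL) (hyL v hvL))

variable (Γ ξ) in
/-- The space of formal finite linear combinations of elementary tensors. -/
def PreFock := ElemTensor Γ ξ →₀ ℂ

instance : AddCommGroup (PreFock Γ ξ) := inferInstanceAs (AddCommGroup (ElemTensor Γ ξ →₀ ℂ))

instance : Module ℂ (PreFock Γ ξ) := inferInstanceAs (Module ℂ (ElemTensor Γ ξ →₀ ℂ))

variable (Γ ξ) in
/-- The sesquilinear form on finite linear combinations of elementary tensors that extends
`elemInner`. -/
def formInner (f g : ElemTensor Γ ξ →₀ ℂ) : ℂ :=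
  f.sum fun x a => g.sum fun y b => star a * elemInner Γ ξ x y * b

theorem formInner_symm (f g : ElemTensor Γ ξ →₀ ℂ) :
    (starRingEnd ℂ) (formInner Γ ξ g f) = formInner Γ ξ f g := by
  unfold formInner
  rw [Finsupp.sum_comm]
  simp only [map_finsuppSum, map_mul]
  refine Finsupp.sum_congr fun x _ => Finsupp.sum_congr fun y _ => ?_
  have := (posSemidef_elemInner (Γ := Γ) (ξ := ξ)).1.apply x y
  simp only [Matrix.of_apply, RCLike.star_def] at this
  rw [this]
  simp only [RCLike.star_def, RCLike.conj_conj]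
  ring

/-- The positive semidefinite inner product on `PreFock` that extends `elemInner`. -/
@[reducible]
def preFockCore : PreInnerProductSpace.Core ℂ (PreFock Γ ξ) where
  inner f g := formInner Γ ξ f g
  conj_inner_symm f g := formInner_symm f g
  re_inner_nonneg f := (Complex.nonneg_iff.1 (posSemidef_elemInner.2 f)).1
  add_left f g h := by
    refine Finsupp.sum_add_index' (fun x => ?_) fun x a b => ?_
    · simp [Finsupp.sum]
    · simp [Finsupp.sum, ← Finset.sum_add_distrib, add_mul]
  smul_left f g r := by
    refine (Finsupp.sum_smul_index fun x => by simp [Finsupp.sum]).trans ?_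
    simp [formInner, Finsupp.sum, Finset.mul_sum, mul_assoc]

instance : SeminormedAddCommGroup (PreFock Γ ξ) :=
  InnerProductSpace.Core.toSeminormedAddCommGroup (c := preFockCore)

instance : InnerProductSpace ℂ (PreFock Γ ξ) := InnerProductSpace.ofCore preFockCore

theorem preFock_inner_def (f g : PreFock Γ ξ) : ⟪f, g⟫_ℂ = formInner Γ ξ f g := rfl

variable (Γ ξ) in
/-- The Fock space `F = ⨁_{w ∈ W} H̊_w` with `H̊_w = H̊_{w₁} ⊗ ⋯ ⊗ H̊_{wₙ}` for a reduced expression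
`w = w₁ ⋯ wₙ`, where the tensor products belonging to the different reduced expressions of `w`
are identified by shuffling the legs: the Hilbert space spanned by the elementary tensors over
reduced words, with the inner product `elemInner`. -/
def Fock := UniformSpace.Completion (PreFock Γ ξ)

instance : NormedAddCommGroup (Fock Γ ξ) :=
  inferInstanceAs (NormedAddCommGroup (UniformSpace.Completion (PreFock Γ ξ)))

instance : InnerProductSpace ℂ (Fock Γ ξ) :=
  inferInstanceAs (InnerProductSpace ℂ (UniformSpace.Completion (PreFock Γ ξ)))

instance : CompleteSpace (Fock Γ ξ) :=
  inferInstanceAs (CompleteSpace (UniformSpace.Completion (PreFock Γ ξ)))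

/-- An elementary tensor as a formal linear combination. -/
def preTens (x : ElemTensor Γ ξ) : PreFock Γ ξ := Finsupp.single x (1 : ℂ)

/-- An elementary tensor as a vector of the Fock space. -/
def tens (x : ElemTensor Γ ξ) : Fock Γ ξ := UniformSpace.Completion.coe' (preTens x)

variable (Γ ξ) in
/-- The vacuum vector. -/
def vacuum : Fock Γ ξ := tens ⟨[], IsReduced.nil⟩

theorem formInner_single (x y : ElemTensor Γ ξ) :
    formInner Γ ξ (Finsupp.single x 1) (Finsupp.single y 1) = elemInner Γ ξ x y := by
  unfold formInner
  rw [Finsupp.sum_single_index (by simp), Finsupp.sum_single_index (by simp)]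
  simp

theorem inner_tens (x y : ElemTensor Γ ξ) : ⟪tens x, tens y⟫_ℂ = elemInner Γ ξ x y :=
  (UniformSpace.Completion.inner_coe (𝕜 := ℂ) (preTens x) (preTens y)).trans
    (formInner_single x y)

/-- Prefixing an elementary tensor with a leg. -/
def ElemTensor.cons (v : V) (η : ((ℂ ∙ ξ v)ᗮ : Submodule ℂ (H v))) (x : ElemTensor Γ ξ)
    (h : IsReduced Γ (v :: x.1.map Sigma.fst)) : ElemTensor Γ ξ :=
  ⟨⟨v, η⟩ :: x.1, h⟩

theorem elemInner_cons_cons (v : V) (η ζ : ((ℂ ∙ ξ v)ᗮ : Submodule ℂ (H v)))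
    (x y : ElemTensor Γ ξ) (hx : IsReduced Γ (v :: x.1.map Sigma.fst))
    (hy : IsReduced Γ (v :: y.1.map Sigma.fst)) :
    elemInner Γ ξ (x.cons v η hx) (y.cons v ζ hy) = ⟪η, ζ⟫_ℂ * elemInner Γ ξ x y := by
  classical
  have hfin : ∀ x y : List (Leg ξ),
      (Function.mulSupport fun u => listInner (legs ξ u x) (legs ξ u y)).Finite := by
    intro x y
    refine ((x.map Sigma.fst).toFinset ∪ (y.map Sigma.fst).toFinset).finite_toSet.subset ?_
    intro u hu
    by_contra h
    simp only [Finset.coe_union, Set.mem_union, Finset.mem_coe, List.mem_toFinset, not_or] at h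
    exact hu (listInner_legs_eq_one h.1 h.2)
  simp only [elemInner, ElemTensor.cons, List.map_cons, WordEquiv.cons_iff]
  split_ifs
  · have h1 : (fun u => listInner (legs ξ u (⟨v, η⟩ :: x.1)) (legs ξ u (⟨v, ζ⟩ :: y.1))) =
        fun u => (if u = v then ⟪η, ζ⟫_ℂ else 1) * listInner (legs ξ u x.1) (legs ξ u y.1) := by
      funext u
      by_cases hu : u = v
      · subst hu
        simp [legs_cons_same, listInner]
      · rw [legs_cons_ne (Ne.symm hu), legs_cons_ne (Ne.symm hu)]
        simp [hu]
    rw [h1, finprod_mul_distrib _ (hfin _ _), finprod_eq_single _ v]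
    · simp
    · intro u hu
      simp [hu]
    · refine (Set.finite_singleton v).subset fun u hu => ?_
      by_contra h
      exact hu (by simp [show u ≠ v from h])
  · simp

theorem elemInner_cons_left (v : V) (η : ((ℂ ∙ ξ v)ᗮ : Submodule ℂ (H v)))
    (x y : ElemTensor Γ ξ) (hx : IsReduced Γ (v :: x.1.map Sigma.fst))
    (hy : IsReduced Γ (v :: y.1.map Sigma.fst)) : elemInner Γ ξ (x.cons v η hx) y = 0 :=
  if_neg (not_wordEquiv_cons hx hy)

theorem elemInner_cons_right (v : V) (η : ((ℂ ∙ ξ v)ᗮ : Submodule ℂ (H v)))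
    (x y : ElemTensor Γ ξ) (hx : IsReduced Γ (v :: x.1.map Sigma.fst))
    (hy : IsReduced Γ (v :: y.1.map Sigma.fst)) : elemInner Γ ξ x (y.cons v η hy) = 0 :=
  if_neg fun h => not_wordEquiv_cons hy hx h.symm

/-! ### The operators `λᵥ(a)` -/

variable (Γ ξ) in
/-- The elementary tensors over reduced words `w` for which `v w` is reduced. -/
def ElemTensorL (v : V) := {x : ElemTensor Γ ξ // IsReduced Γ (v :: x.1.map Sigma.fst)}

variable (Γ ξ) in
/-- The closed subspace `H^L(v) = ⨁_w H̊_w` of the Fock space, with the sum over all `w ∈ W` such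
that `v w` is reduced. -/
def fockL (v : V) : Submodule ℂ (Fock Γ ξ) :=
  (Submodule.span ℂ (Set.range fun x : ElemTensorL Γ ξ v => tens x.1)).topologicalClosure

/-- The elementary tensor `x`, as a vector of `H^L(v)`. -/
def tensL (v : V) (x : ElemTensorL Γ ξ v) : fockL Γ ξ v :=
  ⟨tens x.1, Submodule.le_topologicalClosure _ (Submodule.subset_span ⟨x, rfl⟩)⟩

/-- The part `h - ⟪ξᵥ, h⟫ ξᵥ` of `h` in the orthogonal complement of the unit vector `ξᵥ`. -/
def centre {v : V} (hξ : ‖ξ v‖ = 1) (h : H v) : ((ℂ ∙ ξ v)ᗮ : Submodule ℂ (H v)) :=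
  ⟨h - ⟪ξ v, h⟫_ℂ • ξ v, by
    rw [Submodule.mem_orthogonal_singleton_iff_inner_right, inner_sub_right, inner_smul_right,
      inner_self_eq_norm_sq_to_K, hξ]
    simp⟩

theorem inner_eq_centre {v : V} (hξ : ‖ξ v‖ = 1) (h k : H v) :
    ⟪h, k⟫_ℂ = ⟪⟪ξ v, h⟫_ℂ, ⟪ξ v, k⟫_ℂ⟫_ℂ + ⟪centre hξ h, centre hξ k⟫_ℂ := by
  simp only [centre, Submodule.coe_inner, inner_sub_left, inner_sub_right, inner_smul_left,
    inner_smul_right, inner_self_eq_norm_sq_to_K, hξ, RCLike.inner_apply]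
  rw [← inner_conj_symm h (ξ v)]
  simp only [RCLike.ofReal_one, one_pow, mul_one]
  ring

theorem tensL_total (v : V) :
    (Submodule.span ℂ (Set.range (tensL (Γ := Γ) (ξ := ξ) v))).topologicalClosure = ⊤ := by
  rw [← Submodule.dense_iff_topologicalClosure_eq_top, Subtype.dense_iff]
  intro z hz
  have hz' : z ∈ closure ((Submodule.span ℂ
      (Set.range fun x : ElemTensorL Γ ξ v => tens x.1) : Submodule ℂ (Fock Γ ξ)) :
        Set (Fock Γ ξ)) := hz
  refine closure_mono ?_ hz'
  have : Submodule.span ℂ (Set.range fun x : ElemTensorL Γ ξ v => tens x.1) =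
      (Submodule.span ℂ (Set.range (tensL (Γ := Γ) (ξ := ξ) v))).map
        (fockL Γ ξ v).subtype := by
    rw [Submodule.map_span, ← Set.range_comp]
    rfl
  rw [this]
  rintro _ ⟨y, hy, rfl⟩
  exact ⟨y, hy, rfl⟩

theorem exists_unitary (hξ : ∀ v, ‖ξ v‖ = 1) (v : V) :
    ∃! U : HilbertTensor (H v) (fockL Γ ξ v) →ₗᵢ[ℂ] Fock Γ ξ, ∀ (i : H v × ElemTensorL Γ ξ v),
      U (htmul i.1 (tensL v i.2)) =
        ⟪ξ v, i.1⟫_ℂ • tens i.2.1 + tens (i.2.1.cons v (centre (hξ v) i.1) i.2.2) := by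
  refine exists_isometry
    (fun i : H v × ElemTensorL Γ ξ v => htmul i.1 (tensL v i.2))
    (fun i => ⟪ξ v, i.1⟫_ℂ • tens i.2.1 + tens (i.2.1.cons v (centre (hξ v) i.1) i.2.2)) ?_ ?_
  · exact htmul_total _ (tensL_total v)
  · rintro ⟨h, x⟩ ⟨k, y⟩
    simp only [inner_htmul, tensL,
      Submodule.coe_inner, inner_add_left, inner_add_right, inner_smul_left, inner_smul_right,
      inner_tens, elemInner_cons_cons, elemInner_cons_left _ _ _ _ x.2 y.2,
      elemInner_cons_right _ _ _ _ x.2 y.2]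
    rw [inner_eq_centre (hξ v) h k, RCLike.inner_apply, Submodule.coe_inner]
    ring

/-- The unitary `Uᵥ : Hᵥ ⊗ H^L(v) → F` that maps `ξᵥ ⊗ x` to `x` and `η ⊗ x`, for `η ∈ H̊ᵥ`, to the
elementary tensor with the legs of `x` preceded by `η`. -/
def unitaryL (hξ : ∀ v, ‖ξ v‖ = 1) (v : V) : HilbertTensor (H v) (fockL Γ ξ v) →ₗᵢ[ℂ] Fock Γ ξ :=
  (exists_unitary (Γ := Γ) hξ v).choose

theorem unitaryL_apply (hξ : ∀ v, ‖ξ v‖ = 1) (v : V) (h : H v) (x : ElemTensorL Γ ξ v) :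
    unitaryL hξ v (htmul h (tensL v x)) =
      ⟪ξ v, h⟫_ℂ • tens x.1 + tens (x.1.cons v (centre (hξ v) h) x.2) :=
  (exists_unitary (Γ := Γ) hξ v).choose_spec.1 (h, x)

variable (Γ) in
/-- The operator `λᵥ(a) = Uᵥ (a ⊗ 1) Uᵥ*` on the Fock space, for a bounded operator `a` on `Hᵥ`. -/
def lam (hξ : ∀ v, ‖ξ v‖ = 1) (v : V) (a : H v →L[ℂ] H v) : Fock Γ ξ →L[ℂ] Fock Γ ξ :=
  (unitaryL hξ v).toContinuousLinearMap ∘L ampL (fockL Γ ξ v) a ∘L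
    ContinuousLinearMap.adjoint (unitaryL hξ v).toContinuousLinearMap

end Fock

/-- A closed star subalgebra of a C*-algebra is star-ordered by the inherited order. -/
instance instStarOrderedRing {A : Type*} [CStarAlgebra A] [PartialOrder A] [StarOrderedRing A]
    (S : StarSubalgebra ℂ A) [hS : IsClosed (S : Set A)] : StarOrderedRing S := by
  refine StarOrderedRing.of_nonneg_iff' (fun {x y} h z => ?_) fun x => ⟨fun h => ?_, ?_⟩
  · exact add_le_add_right (α := A) h (z : A)
  · have h' : (0 : A) ≤ (x : A) := h
    have hsa : IsSelfAdjoint x := Subtype.ext (IsSelfAdjoint.of_nonneg h')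
    have hq : QuasispectrumRestricts x ContinuousMap.realToNNReal := by
      rw [quasispectrumRestricts_iff_spectrumRestricts, SpectrumRestricts.nnreal_iff]
      intro r hr
      refine spectrum_nonneg_of_nonneg h' ?_
      have : (r : ℂ) ∈ spectrum ℂ x := spectrum.algebraMap_mem ℂ hr
      rw [StarSubalgebra.spectrum_eq] at this
      exact spectrum.of_algebraMap_mem ℂ this
    obtain ⟨s, hs₁, _, hs₂⟩ := CFC.exists_sqrt_of_isSelfAdjoint_of_quasispectrumRestricts hsa hq
    exact ⟨s, by rw [hs₁.star_eq, hs₂]⟩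
  · rintro ⟨s, rfl⟩
    exact star_mul_self_nonneg (s : A)

/-! ### The reduced graph product of C*-algebras with states -/

section Reduced

variable {V : Type*} (Γ : SimpleGraph V) {A : V → Type*} [∀ v, CStarAlgebra (A v)]
  [∀ v, PartialOrder (A v)] [∀ v, StarOrderedRing (A v)] (φ : ∀ v, A v →ₚ[ℂ] ℂ)

/-- The GNS representation of the positive functional `φ` is faithful. -/
def GNSFaithful {A : Type*} [CStarAlgebra A] [PartialOrder A] [StarOrderedRing A]
    (φ : A →ₚ[ℂ] ℂ) : Prop := Function.Injective φ.gnsStarAlgHom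

/-- The cyclic vector of the GNS representation of `φ v`. -/
def gnsVector (v : V) : (φ v).GNS := ((φ v).toPreGNS 1 : (φ v).PreGNS)

theorem norm_gnsVector (hφ : ∀ v, φ v 1 = 1) (v : V) : ‖gnsVector φ v‖ = 1 := by
  rw [gnsVector, UniformSpace.Completion.norm_coe, PositiveLinearMap.preGNS_norm_def]
  simp [hφ v]

variable {φ}

variable (φ) in
/-- A list of pairs `(v₁, a₁), …, (vₙ, aₙ)` such that `v₁ ⋯ vₙ` is a reduced word and
`aᵢ ∈ ker φ_{vᵢ}` for all `i`, standing for an elementary tensor `a₁ ⊗ ⋯ ⊗ aₙ`. -/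
def IsReducedTensor (l : List (Σ v, A v)) : Prop :=
  IsReduced Γ (l.map Sigma.fst) ∧ ∀ p ∈ l, φ p.1 p.2 = 0

/-- The operator `λ(a₁ ⊗ ⋯ ⊗ aₙ) = λ_{v₁}(a₁) ⋯ λ_{vₙ}(aₙ)` on the Fock space of the GNS
representations (the identity for `n = 0`). -/
def lamTensor (hφ : ∀ v, φ v 1 = 1) (l : List (Σ v, A v)) :
    Fock Γ (gnsVector φ) →L[ℂ] Fock Γ (gnsVector φ) :=
  (l.map fun p => lam Γ (norm_gnsVector φ hφ) p.1 ((φ p.1).gnsStarAlgHom p.2)).prod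

/-- The linear span of the operators `λ(a₁ ⊗ ⋯ ⊗ aₙ)` for reduced words `v₁ ⋯ vₙ` and
`aᵢ ∈ ker φ_{vᵢ}`. -/
def algebraicGraphProduct (hφ : ∀ v, φ v 1 = 1) :
    Submodule ℂ (Fock Γ (gnsVector φ) →L[ℂ] Fock Γ (gnsVector φ)) :=
  Submodule.span ℂ {T | ∃ l, IsReducedTensor Γ φ l ∧ T = lamTensor Γ hφ l}

variable (hφ : ∀ v, φ v 1 = 1)

/-- The C*-algebra of operators on the Fock space generated by the algebraic graph product. -/
def graphProductSubalgebra :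
    StarSubalgebra ℂ (Fock Γ (gnsVector φ) →L[ℂ] Fock Γ (gnsVector φ)) :=
  (StarAlgebra.adjoin ℂ (algebraicGraphProduct Γ hφ :
    Set (Fock Γ (gnsVector φ) →L[ℂ] Fock Γ (gnsVector φ)))).topologicalClosure

instance : IsClosed (graphProductSubalgebra Γ hφ :
    Set (Fock Γ (gnsVector φ) →L[ℂ] Fock Γ (gnsVector φ))) :=
  StarSubalgebra.isClosed_topologicalClosure _

/-- The reduced graph product, as a unital C*-algebra (with the order inherited from the order of
operators on the Fock space). -/
abbrev ReducedGraphProduct : Type _ := ↥(graphProductSubalgebra Γ hφ)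

/-- The inclusion of the reduced graph product into the bounded operators on the Fock space. -/
def inclusion : ReducedGraphProduct Γ hφ →⋆ₐ[ℂ]
    (Fock Γ (gnsVector φ) →L[ℂ] Fock Γ (gnsVector φ)) :=
  (graphProductSubalgebra Γ hφ).subtype

/-- The vacuum state `x ↦ ⟪Ω, x Ω⟫` of the reduced graph product. -/
def vacuumState : ReducedGraphProduct Γ hφ →ₗ[ℂ] ℂ :=
  (innerSL ℂ (vacuum Γ (gnsVector φ))).toLinearMap ∘ₗ
    (ContinuousLinearMap.apply ℂ (Fock Γ (gnsVector φ)) (vacuum Γ (gnsVector φ))).toLinearMap ∘ₗ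
      (inclusion Γ hφ).toAlgHom.toLinearMap

theorem vacuumState_apply (x : ReducedGraphProduct Γ hφ) : vacuumState Γ hφ x =
    ⟪vacuum Γ (gnsVector φ), inclusion Γ hφ x (vacuum Γ (gnsVector φ))⟫_ℂ := rfl

/-- The element `λ(a₁ ⊗ ⋯ ⊗ aₙ)` of the reduced graph product. -/
def tensorElem (l : List (Σ v, A v)) (hl : IsReducedTensor Γ φ l) : ReducedGraphProduct Γ hφ :=
  ⟨lamTensor Γ hφ l, StarSubalgebra.le_topologicalClosure _
    (StarAlgebra.subset_adjoin ℂ _ (Submodule.subset_span ⟨l, hl, rfl⟩))⟩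

end Reduced

end GraphProduct

end

/-!
The assertion on the closures is algebraic. A word of operators is rewritten from the right: if a
letter can be moved by a shuffle next to an earlier equal one, the two entries are multiplied, and
`a = (a - φ(a) 1) + φ(a) 1` then produces reduced words (`mul_mem_reducedSpan`). Hence the span of
the reduced words is a star algebra (`graphProductSubalgebra_eq_closure`). This needs the solution
of the word problem (`isReduced_cons_iff`): a word is reduced unless shuffles can make two equal
letters adjacent, and equivalent reduced words are shuffles of each other (`WordEquiv.shuffle`).

The map `Θ` is a compression of a representation. Let `πᵥ` be the GNS representation of `ψᵥ`, with
cyclic vector `ηᵥ`. Stinespring's theorem (`exists_stinespring`) represents `πᵥ ∘ θᵥ` as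
`a ↦ Wᵥ* σᵥ(a) Wᵥ` with an isometry `Wᵥ` and a representation `σᵥ` of `Aᵥ`. Since `ψᵥ ∘ θᵥ = φᵥ`,
the vector `ζᵥ = Wᵥ ηᵥ` induces the state `φᵥ` of `Aᵥ`. The isometries act on each leg of an
elementary tensor and give an isometry `T` from the Fock space of the `ηᵥ` to that of the `ζᵥ`
(`exists_fockIsometry`). If `F` is the representation of the reduced graph product on the latter
space, then `Θ(x) = T* F(x) T` is completely positive (`compressionCP`), and it sends
`λ(a₁ ⊗ ⋯ ⊗ aₙ)` to `λ(θ(a₁) ⊗ ⋯ ⊗ θ(aₙ))` (`adjoint_repTensor_vec`): a letter of a reduced word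
acts on `ζᵥ` or on a leg untouched by the letters to its right, which lies in the range of `Wᵥ`.

The main point is that `F` exists (`exists_fockRep`), although `ζᵥ` need not be cyclic for `σᵥ`.
It amounts to the inequality `‖X₂‖ ≤ ‖X₁‖` for the operators `X₁` and `X₂` by which a combination
`X` of reduced words acts on the Fock space of the GNS representations and on that of the `σᵥ`
(`norm_snd_le_norm_fst`). The vectors `z` with `‖X₂ z‖ ≤ ‖z‖ ‖X₁‖` for all `X` form a closed
invariant subspace, because any bound `‖X₂ z‖ ≤ C ‖X₁‖` improves to the one with `C = ‖z‖`
(`norm_apply_le_of_exists_bound`). It suffices to find a bound for elementary tensors whose legs at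
`v` are of the form `σᵥ(a) ζᵥ` with `φᵥ(a) = 0`, or orthogonal to the cyclic subspace of `ζᵥ`
(`vec_mem_dominated`). An initial leg of the first kind is created by an element of the algebra,
and can be removed by invariance. If all initial legs are of the second kind, then a word cannot
annihilate any leg, and the vector functional of `z` is, up to a factor, the composition of the
conditional expectation onto the tensor product of the `Aᵥ` over a clique and a product functional
(`exists_inner_repTensor_vec_eq`). Such a functional is bounded with respect to the norm of the
reduced graph product (`norm_sum_cliqueFunctional_le`); here the GNS representations of the `φᵥ`
have to be faithful.
-/


open scoped InnerProductSpace TensorProduct ComplexOrder CStarAlgebra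

noncomputable section

set_option linter.unusedSectionVars false

namespace GraphProduct

/-! ### Shuffles and reduced words -/

section Shuffles

variable {V X : Type*} (Γ : SimpleGraph V) (f : X → V)

/-- Two lists of objects labelled by vertices agree up to a shuffle if one is obtained from the
other by interchanging consecutive objects whose labels share an edge. -/
inductive Shuffle : List X → List X → Prop
  | refl (l : List X) : Shuffle l l
  | cons (p : X) {l m : List X} : Shuffle l m → Shuffle (p :: l) (p :: m)
  | swap (p q : X) (l : List X) : Γ.Adj (f p) (f q) → Shuffle (p :: q :: l) (q :: p :: l)
  | trans {l m n : List X} : Shuffle l m → Shuffle m n → Shuffle l n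

open Classical in
/-- Extraction of a letter: if the first object of `l` with label `v` can be moved to the front by
a shuffle, this object together with the list of the remaining ones. -/
def extract (v : V) : List X → Option (X × List X)
  | [] => none
  | p :: l =>
    if f p = v then some (p, l)
    else if Γ.Adj (f p) v then (extract v l).map (Prod.map id (p :: ·)) else none

variable {Γ f}

theorem Shuffle.symm {l m : List X} (h : Shuffle Γ f l m) : Shuffle Γ f m l := by
  induction h with
  | refl l => exact .refl l
  | cons p _ ih => exact .cons p ih
  | swap p q l h => exact .swap q p l h.symm
  | trans _ _ ih ih' => exact .trans ih' ih

theorem Shuffle.perm {l m : List X} (h : Shuffle Γ f l m) : l.Perm m := by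
  induction h with
  | refl l => exact .refl l
  | cons p _ ih => exact .cons p ih
  | swap p q l h => exact .swap q p l
  | trans _ _ ih ih' => exact .trans ih ih'

theorem Shuffle.map {l m : List X} (h : Shuffle Γ f l m) :
    Shuffle Γ id (l.map f) (m.map f) := by
  induction h with
  | refl l => exact .refl _
  | cons p _ ih => exact .cons _ ih
  | swap p q l h => exact .swap _ _ _ h
  | trans _ _ ih ih' => exact .trans ih ih'

theorem Shuffle.append_left (k : List X) {l m : List X} (h : Shuffle Γ f l m) :
    Shuffle Γ f (k ++ l) (k ++ m) := by
  induction k with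
  | nil => exact h
  | cons p k ih => exact .cons p ih

theorem Shuffle.middle {p : X} {k : List X} (h : ∀ q ∈ k, Γ.Adj (f q) (f p)) (l : List X) :
    Shuffle Γ f (k ++ p :: l) (p :: (k ++ l)) := by
  induction k with
  | nil => exact .refl _
  | cons q k ih =>
    exact (Shuffle.cons q (ih fun r hr => h r (by simp [hr]))).trans
      (.swap q p _ (h q (by simp)))

theorem Shuffle.wordEquiv {l m : List V} (h : Shuffle Γ id l m) : WordEquiv Γ l m := by
  induction h with
  | refl l => exact .refl _
  | cons p _ ih => exact ih.cons p
  | swap p q l h => exact Relation.EqvGen.rel _ _ (WordStep.swap [] l p q h)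
  | trans _ _ ih ih' => exact ih.trans ih'

theorem extract_cons_self {v : V} {p : X} (h : f p = v) (l : List X) :
    extract Γ f v (p :: l) = some (p, l) := by
  simp [extract, h]

theorem extract_cons_adj {v : V} {p : X} (h : Γ.Adj (f p) v) (l : List X) :
    extract Γ f v (p :: l) = (extract Γ f v l).map (Prod.map id (p :: ·)) := by
  simp [extract, h, h.ne]

theorem extract_cons_none {v : V} {p : X} (h : f p ≠ v) (h' : ¬ Γ.Adj (f p) v) (l : List X) :
    extract Γ f v (p :: l) = none := by
  simp [extract, h, h']

theorem extract_append_of_adj {v : V} {k : List X} (h : ∀ q ∈ k, Γ.Adj (f q) v) (l : List X) :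
    extract Γ f v (k ++ l) = (extract Γ f v l).map (Prod.map id (k ++ ·)) := by
  induction k with
  | nil => exact Option.map_id.symm ▸ rfl
  | cons q k ih =>
    rw [List.cons_append, extract_cons_adj (h q (by simp)), ih fun r hr => h r (by simp [hr]),
      Option.map_map]
    rfl

theorem label_extract {v : V} {l m : List X} {p : X} (h : extract Γ f v l = some (p, m)) :
    f p = v := by
  induction l generalizing m with
  | nil => simp [extract] at h
  | cons q l ih =>
    by_cases h1 : f q = v
    · rw [extract_cons_self h1] at h
      simp only [Option.some.injEq, Prod.mk.injEq] at h
      rw [← h.1, h1]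
    · by_cases h2 : Γ.Adj (f q) v
      · rw [extract_cons_adj h2, Option.map_eq_some_iff] at h
        obtain ⟨⟨p', m'⟩, hm, he⟩ := h
        simp only [Prod.map_apply, id, Prod.mk.injEq] at he
        exact ih (he.1 ▸ hm)
      · simp [extract_cons_none h1 h2] at h

theorem shuffle_of_extract {v : V} {l m : List X} {p : X} (h : extract Γ f v l = some (p, m)) :
    Shuffle Γ f l (p :: m) := by
  induction l generalizing m with
  | nil => simp [extract] at h
  | cons q l ih =>
    by_cases h1 : f q = v
    · rw [extract_cons_self h1] at h
      simp only [Option.some.injEq, Prod.mk.injEq] at h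
      rw [← h.1, ← h.2]
      exact .refl _
    · by_cases h2 : Γ.Adj (f q) v
      · rw [extract_cons_adj h2, Option.map_eq_some_iff] at h
        obtain ⟨⟨p', m'⟩, hm, he⟩ := h
        simp only [Prod.map_apply, id, Prod.mk.injEq] at he
        obtain ⟨rfl, rfl⟩ := he
        exact (Shuffle.cons q (ih hm)).trans (.swap q p' m' (label_extract hm ▸ h2))
      · simp [extract_cons_none h1 h2] at h

/-- Extraction is compatible with shuffles. -/
theorem Shuffle.extract {l l' : List X} (h : Shuffle Γ f l l') (v : V) :
    Option.Rel (fun a b => a.1 = b.1 ∧ Shuffle Γ f a.2 b.2)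
      (extract Γ f v l) (extract Γ f v l') := by
  have hrefl : ∀ o : Option (X × List X),
      Option.Rel (fun a b => a.1 = b.1 ∧ Shuffle Γ f a.2 b.2) o o := by
    rintro (_ | a)
    · exact .none
    · exact .some ⟨rfl, .refl _⟩
  induction h with
  | refl l => exact hrefl _
  | @cons p l m h ih =>
    by_cases h1 : f p = v
    · rw [extract_cons_self h1, extract_cons_self h1]
      exact .some ⟨rfl, h⟩
    · by_cases h2 : Γ.Adj (f p) v
      · rw [extract_cons_adj h2, extract_cons_adj h2]
        generalize GraphProduct.extract Γ f v l = a at ih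
        generalize GraphProduct.extract Γ f v m = b at ih
        cases ih with
        | none => exact .none
        | some h => exact .some ⟨h.1, .cons p h.2⟩
      · rw [extract_cons_none h1 h2, extract_cons_none h1 h2]
        exact .none
  | swap p q l h =>
    by_cases hp : f p = v
    · have hq : Γ.Adj (f q) v := hp ▸ h.symm
      rw [extract_cons_self hp, extract_cons_adj hq, extract_cons_self hp]
      exact .some ⟨rfl, .refl _⟩
    · by_cases hq : f q = v
      · have hp' : Γ.Adj (f p) v := hq ▸ h
        rw [extract_cons_self hq, extract_cons_adj hp', extract_cons_self hq]
        exact .some ⟨rfl, .refl _⟩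
      · by_cases hp' : Γ.Adj (f p) v
        · by_cases hq' : Γ.Adj (f q) v
          · rw [extract_cons_adj hp', extract_cons_adj hq', extract_cons_adj hq',
              extract_cons_adj hp', Option.map_map, Option.map_map]
            cases GraphProduct.extract Γ f v l with
            | none => exact .none
            | some a => exact .some ⟨rfl, .swap p q _ h⟩
          · rw [extract_cons_adj hp', extract_cons_none hq hq', extract_cons_none hq hq']
            exact .none
        · by_cases hq' : Γ.Adj (f q) v
          · rw [extract_cons_adj hq', extract_cons_none hp hp', extract_cons_none hp hp']
            exact .none
          · rw [extract_cons_none hp hp', extract_cons_none hq hq']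
            exact .none
  | @trans l m n _ _ ih ih' =>
    generalize GraphProduct.extract Γ f v l = a at ih
    generalize GraphProduct.extract Γ f v m = b at ih ih'
    generalize GraphProduct.extract Γ f v n = c at ih'
    cases ih with
    | none => cases ih' with
      | none => exact .none
    | some h => cases ih' with
      | some h' => exact .some ⟨h.1.trans h'.1, h.2.trans h'.2⟩

theorem Shuffle.extract_eq_none {l l' : List X} (h : Shuffle Γ f l l') {v : V}
    (hl : GraphProduct.extract Γ f v l = none) : GraphProduct.extract Γ f v l' = none := by
  have := h.extract v
  rw [hl] at this
  generalize GraphProduct.extract Γ f v l' = b at this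
  cases this
  rfl

theorem Shuffle.extract_eq_some {l l' : List X} (h : Shuffle Γ f l l') {v : V} {p : X}
    {m : List X} (hl : GraphProduct.extract Γ f v l = some (p, m)) :
    ∃ m', GraphProduct.extract Γ f v l' = some (p, m') ∧ Shuffle Γ f m m' := by
  have := h.extract v
  rw [hl] at this
  generalize GraphProduct.extract Γ f v l' = b at this
  cases this with
  | @some _ b h =>
    obtain ⟨q, m'⟩ := b
    obtain ⟨rfl, h⟩ := h
    exact ⟨m', rfl, h⟩

theorem extract_map (v : V) (l : List X) :
    extract Γ id v (l.map f) = (extract Γ f v l).map (Prod.map f (List.map f)) := by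
  induction l with
  | nil => rfl
  | cons p l ih =>
    rw [List.map_cons]
    by_cases h1 : f p = v
    · rw [extract_cons_self h1, extract_cons_self (f := id) h1]
      rfl
    · by_cases h2 : Γ.Adj (f p) v
      · rw [extract_cons_adj h2, extract_cons_adj (f := id) h2, ih, Option.map_map, Option.map_map]
        rfl
      · rw [extract_cons_none h1 h2, extract_cons_none (f := id) h1 h2]
        rfl

theorem extract_map_eq_none {v : V} {l : List X} :
    extract Γ id v (l.map f) = none ↔ extract Γ f v l = none := by
  rw [extract_map, Option.map_eq_none_iff]

end Shuffles

section Normal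

variable {V : Type*} (Γ : SimpleGraph V)

/-- Left multiplication by the letter `v` on words without cancellations. -/
def letterMul (v : V) (l : List V) : List V :=
  match extract Γ id v l with
  | some a => a.2
  | none => v :: l

/-- A word has no cancellations if no letter can be moved next to an earlier equal one by a
shuffle. -/
def NoCancel : List V → Prop
  | [] => True
  | v :: l => NoCancel l ∧ extract Γ id v l = none

/-- The normal form of a word, obtained by multiplying its letters from the right to the left. -/
def normalForm (l : List V) : List V := l.foldr (letterMul Γ) []

variable {Γ}

theorem letterMul_none {v : V} {l : List V} (h : extract Γ id v l = none) :
    letterMul Γ v l = v :: l := by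
  rw [letterMul, h]

theorem letterMul_some {v u : V} {l m : List V} (h : extract Γ id v l = some (u, m)) :
    letterMul Γ v l = m := by
  rw [letterMul, h]

theorem shuffle_of_extract_word {v u : V} {l m : List V} (h : extract Γ id v l = some (u, m)) :
    Shuffle Γ id l (v :: m) := by
  have h1 := shuffle_of_extract h
  have h2 : u = v := label_extract h
  rwa [h2] at h1

theorem Shuffle.noCancel {l m : List V} (h : Shuffle Γ id l m) : NoCancel Γ l → NoCancel Γ m := by
  induction h with
  | refl l => exact id
  | cons p h ih => exact fun hl => ⟨ih hl.1, h.extract_eq_none hl.2⟩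
  | swap p q l h =>
    rw [id, id] at h
    rintro ⟨⟨h1, h2⟩, h3⟩
    rw [extract_cons_adj (f := id) h.symm, Option.map_eq_none_iff] at h3
    exact ⟨⟨h1, h3⟩, by rw [extract_cons_adj (f := id) h, h2]; rfl⟩
  | trans _ _ ih ih' => exact fun h => ih' (ih h)

theorem NoCancel.letterMul {l : List V} (h : NoCancel Γ l) (v : V) :
    NoCancel Γ (letterMul Γ v l) := by
  cases he : extract Γ id v l with
  | none =>
    rw [letterMul_none he]
    exact ⟨h, he⟩
  | some a =>
    rw [letterMul_some (u := a.1) (m := a.2) he]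
    exact ((shuffle_of_extract_word (u := a.1) (m := a.2) he).noCancel h).1

theorem Shuffle.letterMul {l m : List V} (h : Shuffle Γ id l m) (v : V) :
    Shuffle Γ id (letterMul Γ v l) (letterMul Γ v m) := by
  cases he : GraphProduct.extract Γ id v l with
  | none =>
    rw [letterMul_none he, letterMul_none (h.extract_eq_none he)]
    exact .cons v h
  | some a =>
    obtain ⟨m', hm, hs⟩ := h.extract_eq_some (p := a.1) (m := a.2) he
    rw [letterMul_some (u := a.1) (m := a.2) he, letterMul_some hm]
    exact hs

theorem letterMul_letterMul_self {l : List V} (h : NoCancel Γ l) (v : V) :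
    Shuffle Γ id (letterMul Γ v (letterMul Γ v l)) l := by
  cases he : extract Γ id v l with
  | none =>
    rw [letterMul_none he,
      letterMul_some (u := v) (m := l) (extract_cons_self (f := id) (v := v) (p := v) rfl l)]
    exact .refl _
  | some a =>
    have hs := shuffle_of_extract_word (u := a.1) (m := a.2) he
    rw [letterMul_some (u := a.1) (m := a.2) he, letterMul_none (hs.noCancel h).2]
    exact hs.symm

theorem letterMul_comm {u v : V} (h : Γ.Adj u v) (l : List V) :
    Shuffle Γ id (letterMul Γ u (letterMul Γ v l)) (letterMul Γ v (letterMul Γ u l)) := by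
  have key : ∀ {u v : V} {m : List V}, Γ.Adj u v → extract Γ id v l = some (v, m) →
      extract Γ id u l = none →
      Shuffle Γ id (letterMul Γ u (letterMul Γ v l)) (letterMul Γ v (letterMul Γ u l)) := by
    intro u v m h hv hu
    have hm : extract Γ id u m = none := by
      have := (shuffle_of_extract_word hv).extract_eq_none hu
      rwa [extract_cons_adj h.symm, Option.map_eq_none_iff] at this
    rw [letterMul_some hv, letterMul_none hu, letterMul_none hm,
      letterMul_some (u := v) (m := u :: m)
        (by rw [extract_cons_adj (f := id) h, hv]; rfl)]
    exact .refl _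
  cases hv : extract Γ id v l with
  | none =>
    cases hu : extract Γ id u l with
    | none =>
      rw [letterMul_none hu, letterMul_none hv,
        letterMul_none (by rw [extract_cons_adj h.symm, hu]; rfl),
        letterMul_none (by rw [extract_cons_adj h, hv]; rfl)]
      exact .swap _ _ _ h
    | some a =>
      obtain ⟨w, m⟩ := a
      obtain rfl : w = u := label_extract hu
      exact (key h.symm hu hv).symm
  | some a =>
    obtain ⟨w, m⟩ := a
    obtain rfl : w = v := label_extract hv
    cases hu : extract Γ id u l with
    | none => exact key h hv hu
    | some b =>
      obtain ⟨w', n⟩ := b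
      obtain rfl : w' = u := label_extract hu
      rw [letterMul_some hu, letterMul_some hv]
      obtain ⟨k', hk, hs⟩ := (shuffle_of_extract_word hv).extract_eq_some hu
      rw [extract_cons_adj (f := id) h.symm, Option.map_eq_some_iff] at hk
      obtain ⟨⟨x, k⟩, hk, he⟩ := hk
      simp only [Prod.map_apply, id, Prod.mk.injEq] at he
      obtain ⟨rfl, rfl⟩ := he
      rw [letterMul_some hk]
      obtain ⟨j, hj, hs'⟩ := hs.symm.extract_eq_some (extract_cons_self (Γ := Γ) (f := id) rfl k)
      rw [show GraphProduct.letterMul Γ w n = j from letterMul_some hj]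
      exact hs'

theorem noCancel_normalForm (l : List V) : NoCancel Γ (normalForm Γ l) := by
  induction l with
  | nil => trivial
  | cons v l ih => exact ih.letterMul v

theorem normalForm_append (l m : List V) :
    normalForm Γ (l ++ m) = l.foldr (letterMul Γ) (normalForm Γ m) := by
  rw [normalForm, List.foldr_append, ← normalForm]

theorem Shuffle.foldr_letterMul (k : List V) {l m : List V} (h : Shuffle Γ id l m) :
    Shuffle Γ id (k.foldr (GraphProduct.letterMul Γ) l)
      (k.foldr (GraphProduct.letterMul Γ) m) := by
  induction k with
  | nil => exact h
  | cons v k ih => exact ih.letterMul v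

/-- Equivalent words have the same normal form, up to a shuffle. -/
theorem WordEquiv.shuffle_normalForm {l m : List V} (h : WordEquiv Γ l m) :
    Shuffle Γ id (normalForm Γ l) (normalForm Γ m) := by
  induction h with
  | rel l m h =>
    cases h with
    | cancel l r v =>
      rw [normalForm_append, normalForm_append]
      exact (letterMul_letterMul_self (noCancel_normalForm r) v).foldr_letterMul l
    | swap l r v w h =>
      rw [normalForm_append, normalForm_append]
      exact (letterMul_comm h (normalForm Γ r)).foldr_letterMul l
  | refl l => exact .refl _
  | symm _ _ _ ih => exact ih.symm
  | trans _ _ _ _ _ ih ih' => exact ih.trans ih'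

theorem length_normalForm_le (l : List V) : (normalForm Γ l).length ≤ l.length := by
  induction l with
  | nil => exact le_rfl
  | cons v l ih =>
    change (GraphProduct.letterMul Γ v (normalForm Γ l)).length ≤ _
    cases he : extract Γ id v (normalForm Γ l) with
    | none =>
      rw [letterMul_none he]
      simpa using ih
    | some a =>
      rw [letterMul_some (u := a.1) (m := a.2) he]
      have := (shuffle_of_extract (p := a.1) (m := a.2) he).perm.length_eq
      simp only [List.length_cons] at this ⊢
      omega

theorem NoCancel.normalForm_eq {l : List V} (h : NoCancel Γ l) : normalForm Γ l = l := by
  induction l with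
  | nil => rfl
  | cons v l ih =>
    change GraphProduct.letterMul Γ v (normalForm Γ l) = _
    rw [ih h.1, letterMul_none h.2]

/-- A word without cancellations is its own normal form, and normal forms have minimal length. -/
theorem NoCancel.isReduced {l : List V} (h : NoCancel Γ l) : IsReduced Γ l := by
  intro m hm
  have := hm.shuffle_normalForm.perm.length_eq
  rw [h.normalForm_eq] at this
  exact this.trans_le (length_normalForm_le m)

theorem IsReduced.noCancel {l : List V} (h : IsReduced Γ l) : NoCancel Γ l := by
  induction l with
  | nil => trivial
  | cons v l ih =>
    refine ⟨ih h.of_cons, ?_⟩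
    cases he : extract Γ id v l with
    | none => rfl
    | some a =>
      have hs := shuffle_of_extract_word (u := a.1) (m := a.2) he
      have h1 := h _ ((hs.wordEquiv.cons v).trans (WordEquiv.cons_cons v a.2))
      have h2 := hs.perm.length_eq
      simp only [List.length_cons] at h1 h2
      omega

/-- The solution of the word problem: a word is reduced unless a letter can be moved next to an
earlier equal one by a shuffle. -/
theorem isReduced_cons_iff {v : V} {l : List V} :
    IsReduced Γ (v :: l) ↔ IsReduced Γ l ∧ extract Γ id v l = none :=
  ⟨fun h => ⟨h.of_cons, h.noCancel.2⟩, fun h => NoCancel.isReduced ⟨h.1.noCancel, h.2⟩⟩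

theorem Shuffle.isReduced {l m : List V} (h : Shuffle Γ id l m) (hl : IsReduced Γ l) :
    IsReduced Γ m := (h.noCancel hl.noCancel).isReduced

/-- Equivalent reduced words are shuffles of each other. -/
theorem WordEquiv.shuffle {l m : List V} (h : WordEquiv Γ l m) (hl : IsReduced Γ l)
    (hm : IsReduced Γ m) : Shuffle Γ id l m := by
  have := h.shuffle_normalForm
  rwa [hl.noCancel.normalForm_eq, hm.noCancel.normalForm_eq] at this

theorem IsReduced.of_append_left {l m : List V} (h : IsReduced Γ (l ++ m)) : IsReduced Γ l := by
  refine NoCancel.isReduced ?_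
  have h' := h.noCancel
  clear h
  induction l with
  | nil => trivial
  | cons v l ih =>
    refine ⟨ih h'.1, ?_⟩
    have h2 := h'.2
    clear ih h'
    change extract Γ id v (l ++ m) = none at h2
    induction l with
    | nil => rfl
    | cons u l ih =>
      rw [List.cons_append] at h2
      by_cases h1 : u = v
      · rw [extract_cons_self (f := id) h1] at h2
        simp at h2
      · by_cases h3 : Γ.Adj u v
        · rw [extract_cons_adj (f := id) h3, Option.map_eq_none_iff] at h2 ⊢
          exact ih h2
        · exact extract_cons_none (f := id) h1 h3 l

theorem IsReduced.of_append_right {l m : List V} (h : IsReduced Γ (l ++ m)) :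
    IsReduced Γ m := by
  induction l with
  | nil => exact h
  | cons v l ih => exact ih h.of_cons

theorem WordEquiv.reverse {l m : List V} (h : WordEquiv Γ l m) :
    WordEquiv Γ l.reverse m.reverse := by
  induction h with
  | rel l m h =>
    cases h with
    | cancel l r v =>
      refine Relation.EqvGen.rel _ _ ?_
      simpa using WordStep.cancel (Γ := Γ) r.reverse l.reverse v
    | swap l r v w h =>
      refine Relation.EqvGen.rel _ _ ?_
      simpa using WordStep.swap (Γ := Γ) r.reverse l.reverse w v h.symm
  | refl l => exact .refl _
  | symm _ _ _ ih => exact ih.symm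
  | trans _ _ _ _ _ ih ih' => exact ih.trans ih'

theorem IsReduced.reverse {l : List V} (h : IsReduced Γ l) : IsReduced Γ l.reverse := by
  intro m hm
  have h1 := hm.reverse
  rw [List.reverse_reverse] at h1
  simpa using h _ h1

/-- If `v` cannot be extracted from `k`, but from `k ++ l`, then `v` commutes with all letters of
`k` and is extracted from `l`. -/
theorem extract_append_eq_some {X : Type*} {f : X → V} {v : V} {k l : List X} {p : X}
    {m : List X} (hk : extract Γ f v k = none) (h : extract Γ f v (k ++ l) = some (p, m)) :
    (∀ q ∈ k, Γ.Adj (f q) v) ∧ ∃ m', extract Γ f v l = some (p, m') ∧ m = k ++ m' := by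
  induction k generalizing m with
  | nil => exact ⟨by simp, m, h, rfl⟩
  | cons q k ih =>
    rw [List.cons_append] at h
    by_cases h1 : f q = v
    · simp [extract_cons_self h1] at hk
    · by_cases h2 : Γ.Adj (f q) v
      · rw [extract_cons_adj h2, Option.map_eq_none_iff] at hk
        rw [extract_cons_adj h2, Option.map_eq_some_iff] at h
        obtain ⟨⟨p', m'⟩, hm, he⟩ := h
        simp only [Prod.map_apply, id, Prod.mk.injEq] at he
        obtain ⟨rfl, rfl⟩ := he
        obtain ⟨h3, m'', h4, rfl⟩ := ih hk hm
        exact ⟨by simpa [h2] using h3, m'', h4, rfl⟩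
      · simp [extract_cons_none h1 h2] at h

end Normal

/-! ### Elementary tensors in the Fock space -/

section Tensors

variable {V : Type*} {Γ : SimpleGraph V} {H : V → Type*} [∀ v, NormedAddCommGroup (H v)]
  [∀ v, InnerProductSpace ℂ (H v)] {ξ : ∀ v, H v}

/-- The word of a list of tensor legs. -/
abbrev word (x : List (Leg ξ)) : List V := x.map Sigma.fst

/-- A list of tensor legs over a reduced word, as an elementary tensor. -/
def elemOf (x : List (Leg ξ)) (h : IsReduced Γ (word x)) : ElemTensor Γ ξ := ⟨x, h⟩

open Classical in
variable (Γ) in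
/-- The vector of the Fock space given by a list of tensor legs, and `0` if its word is not
reduced. -/
def vec (x : List (Leg ξ)) : Fock Γ ξ := if h : IsReduced Γ (word x) then tens (elemOf x h) else 0

theorem vec_of_isReduced {x : List (Leg ξ)} (h : IsReduced Γ (word x)) :
    vec Γ x = tens (elemOf x h) := dif_pos h

theorem vec_nil : vec Γ ([] : List (Leg ξ)) = vacuum Γ ξ := vec_of_isReduced _

theorem vec_of_not_isReduced {x : List (Leg ξ)} (h : ¬ IsReduced Γ (word x)) :
    vec Γ x = 0 := dif_neg h

theorem extract_eq_none_of_isReduced {v : V} {x : List (Leg ξ)}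
    (hx : IsReduced Γ (v :: word x)) : extract Γ Sigma.fst v x = none :=
  extract_map_eq_none.1 (isReduced_cons_iff.1 hx).2

theorem Shuffle.isReduced_word {x y : List (Leg ξ)} (h : Shuffle Γ Sigma.fst x y) :
    IsReduced Γ (word x) ↔ IsReduced Γ (word y) :=
  ⟨h.map.isReduced, h.symm.map.isReduced⟩

theorem Shuffle.legs {x y : List (Leg ξ)} (h : Shuffle Γ Sigma.fst x y) (v : V) :
    GraphProduct.legs ξ v x = GraphProduct.legs ξ v y := by
  induction h with
  | refl l => rfl
  | cons p _ ih =>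
    obtain ⟨u, η⟩ := p
    by_cases hu : u = v
    · subst hu
      rw [legs_cons_same, legs_cons_same, ih]
    · rw [legs_cons_ne hu, legs_cons_ne hu, ih]
  | swap p q l h =>
    obtain ⟨u, η⟩ := p
    obtain ⟨w, ζ⟩ := q
    have huw : u ≠ w := h.ne
    by_cases hu : u = v
    · subst hu
      rw [legs_cons_same, legs_cons_ne huw.symm, legs_cons_ne huw.symm, legs_cons_same]
    · by_cases hw : w = v
      · subst hw
        rw [legs_cons_same, legs_cons_ne huw, legs_cons_same, legs_cons_ne huw]
      · rw [legs_cons_ne hu, legs_cons_ne hw, legs_cons_ne hw, legs_cons_ne hu]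
  | trans _ _ ih ih' => exact ih.trans ih'

theorem inner_vec_eq_zero {x y : List (Leg ξ)} (h : ¬ Shuffle Γ id (word x) (word y)) :
    ⟪vec Γ x, vec Γ y⟫_ℂ = 0 := by
  by_cases hx : IsReduced Γ (word x)
  · by_cases hy : IsReduced Γ (word y)
    · rw [vec_of_isReduced hx, vec_of_isReduced hy, inner_tens]
      exact if_neg fun h' => h (h'.shuffle hx hy)
    · rw [vec_of_not_isReduced hy, inner_zero_right]
  · rw [vec_of_not_isReduced hx, inner_zero_left]

theorem inner_vec_eq_zero_of_not_perm {x y : List (Leg ξ)} (h : ¬ (word x).Perm (word y)) :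
    ⟪vec Γ x, vec Γ y⟫_ℂ = 0 :=
  inner_vec_eq_zero fun h' => h h'.perm

theorem elemInner_shuffle {x y : ElemTensor Γ ξ} (h : Shuffle Γ Sigma.fst x.1 y.1)
    (z : ElemTensor Γ ξ) : elemInner Γ ξ x z = elemInner Γ ξ y z := by
  have hw := h.map.wordEquiv
  simp only [elemInner, h.legs]
  congr 1
  exact propext ⟨fun h' => hw.symm.trans h', fun h' => hw.trans h'⟩

theorem Shuffle.vec_eq {x y : List (Leg ξ)} (h : Shuffle Γ Sigma.fst x y) :
    vec Γ x = vec Γ y := by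
  by_cases hx : IsReduced Γ (word x)
  · have hy := h.isReduced_word.1 hx
    rw [vec_of_isReduced hx, vec_of_isReduced hy, ← sub_eq_zero, ← inner_self_eq_zero (𝕜 := ℂ),
      inner_sub_left, sub_eq_zero]
    have key := elemInner_shuffle (x := elemOf x hx) (y := elemOf y hy) h
    rw [inner_sub_right, inner_sub_right, inner_tens, inner_tens, inner_tens, inner_tens, key, key]
  · rw [vec_of_not_isReduced hx, vec_of_not_isReduced fun hy => hx (h.isReduced_word.2 hy)]

variable (Γ ξ) in
/-- The dense isometric inclusion of the formal linear combinations of elementary tensors. -/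
def toFock : PreFock Γ ξ →ₗᵢ[ℂ] Fock Γ ξ :=
  (UniformSpace.Completion.toComplₗᵢ : PreFock Γ ξ →ₗᵢ[ℂ] UniformSpace.Completion (PreFock Γ ξ))

theorem denseRange_toFock : DenseRange (toFock Γ ξ) :=
  UniformSpace.Completion.denseRange_coe

theorem toFock_mem_span (c : PreFock Γ ξ) :
    toFock Γ ξ c ∈ Submodule.span ℂ (Set.range fun x : List (Leg ξ) => vec Γ x) := by
  have hc : ∀ c : ElemTensor Γ ξ →₀ ℂ,
      c ∈ (Submodule.span ℂ (Set.range fun x : List (Leg ξ) => vec Γ x)).comap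
        (toFock Γ ξ).toLinearMap := by
    intro c
    induction c using Finsupp.induction_linear with
    | zero => exact Submodule.zero_mem _
    | add c d hc hd => exact Submodule.add_mem _ hc hd
    | single x a =>
      have h1 : (Finsupp.single x a : ElemTensor Γ ξ →₀ ℂ) = a • Finsupp.single x (1 : ℂ) := by
        simp
      rw [h1]
      refine Submodule.smul_mem _ a (Submodule.subset_span ⟨x.1, ?_⟩)
      exact vec_of_isReduced x.2
  exact hc c

/-- The elementary tensors span a dense subspace of the Fock space. -/
theorem vec_total :
    (Submodule.span ℂ (Set.range fun x : List (Leg ξ) => vec Γ x)).topologicalClosure = ⊤ := by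
  rw [eq_top_iff]
  intro z _
  exact denseRange_toFock.induction_on
    (p := fun z : Fock Γ ξ => z ∈ (Submodule.span ℂ
      (Set.range fun x : List (Leg ξ) => vec Γ x)).topologicalClosure) z
    (Submodule.isClosed_topologicalClosure _)
    fun c => Submodule.le_topologicalClosure _ (toFock_mem_span c)

/-- Bounded operators on the Fock space are determined by their values on elementary tensors. -/
theorem clm_ext_vec {G : Type*} [NormedAddCommGroup G] [NormedSpace ℂ G]
    {S T : Fock Γ ξ →L[ℂ] G} (h : ∀ x, IsReduced Γ (word x) → S (vec Γ x) = T (vec Γ x)) :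
    S = T := by
  refine ContinuousLinearMap.ext_on (s := Set.range fun x : List (Leg ξ) => vec Γ x)
    (Submodule.dense_iff_topologicalClosure_eq_top.2 vec_total) ?_
  rintro _ ⟨x, rfl⟩
  by_cases hx : IsReduced Γ (word x)
  · exact h x hx
  · simp only [vec_of_not_isReduced hx, map_zero]

theorem norm_vacuum : ‖vacuum Γ ξ‖ = 1 := by
  have h : ⟪vacuum Γ ξ, vacuum Γ ξ⟫_ℂ = 1 := by
    rw [← vec_nil, vec_of_isReduced IsReduced.nil, inner_tens, elemInner,
      if_pos (WordEquiv.refl _)]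
    simp [elemOf, legs_nil, listInner]
  rw [@norm_eq_sqrt_re_inner ℂ, h]
  simp

end Tensors

/-! ### The representation of the bounded operators on `Hᵥ` -/

section Ampliation

variable {E F : Type*} [NormedAddCommGroup E] [InnerProductSpace ℂ E]
  [NormedAddCommGroup F] [InnerProductSpace ℂ F]

theorem hilbertTensor_ext {G : Type*} [NormedAddCommGroup G] [NormedSpace ℂ G]
    {S T : HilbertTensor E F →L[ℂ] G} (h : ∀ x y, S (htmul x y) = T (htmul x y)) : S = T := by
  refine ContinuousLinearMap.ext fun z => ?_
  refine denseRange_algTensor.induction_on (p := fun z => S z = T z) z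
    (isClosed_eq S.continuous T.continuous) fun t => ?_
  induction t using TensorProduct.induction_on with
  | zero => simp
  | tmul x y => exact h x y
  | add a b ha hb => simp only [map_add, ha, hb]

theorem htmul_add_left (h k : E) (y : F) : htmul (h + k) y = htmul h y + htmul k y := by
  simp only [htmul, TensorProduct.add_tmul, map_add]

theorem htmul_smul_left (c : ℂ) (h : E) (y : F) : htmul (c • h) y = c • htmul h y := by
  rw [htmul, htmul, ← TensorProduct.smul_tmul', map_smul]

theorem ampL_mul (a b : E →L[ℂ] E) : ampL F (a * b) = ampL F a * ampL F b :=
  hilbertTensor_ext fun x y => by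
    rw [mul_apply_eq_comp, ampL_htmul, ampL_htmul, ampL_htmul]; rfl

theorem ampL_one : ampL F (1 : E →L[ℂ] E) = 1 :=
  hilbertTensor_ext fun x y => by rw [ampL_htmul]; rfl

theorem ampL_add (a b : E →L[ℂ] E) : ampL F (a + b) = ampL F a + ampL F b :=
  hilbertTensor_ext fun x y => by
    rw [add_apply, ampL_htmul, ampL_htmul, ampL_htmul,
      add_apply, htmul_add_left]

theorem ampL_smul (c : ℂ) (a : E →L[ℂ] E) : ampL F (c • a) = c • ampL F a :=
  hilbertTensor_ext fun x y => by
    rw [smul_apply, ampL_htmul, ampL_htmul,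
      smul_apply, htmul_smul_left]

theorem adjoint_ampL [CompleteSpace E] (a : E →L[ℂ] E) :
    ContinuousLinearMap.adjoint (ampL F a) = ampL F (ContinuousLinearMap.adjoint a) := by
  symm
  rw [ContinuousLinearMap.eq_adjoint_iff]
  intro x y
  refine denseRange_algTensor.induction_on₂
    (p := fun x y => ⟪ampL F (ContinuousLinearMap.adjoint a) x, y⟫_ℂ = ⟪x, ampL F a y⟫_ℂ)
    (isClosed_eq (by fun_prop) (by fun_prop)) (fun s t => ?_) x y
  induction s using TensorProduct.induction_on with
  | zero => simp
  | add s s' hs hs' => simp only [map_add, inner_add_left, hs, hs']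
  | tmul h k =>
    induction t using TensorProduct.induction_on with
    | zero => simp
    | add s s' hs hs' => simp only [map_add, inner_add_right, hs, hs']
    | tmul h' k' =>
      change ⟪ampL F _ (htmul h k), htmul h' k'⟫_ℂ = ⟪htmul h k, ampL F a (htmul h' k')⟫_ℂ
      rw [ampL_htmul, ampL_htmul, inner_htmul, inner_htmul,
        ContinuousLinearMap.adjoint_inner_left]

end Ampliation

section Lam

variable {V : Type*} {Γ : SimpleGraph V} {H : V → Type*} [∀ v, NormedAddCommGroup (H v)]
  [∀ v, InnerProductSpace ℂ (H v)] {ξ : ∀ v, H v} (hξ : ∀ v, ‖ξ v‖ = 1)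

theorem centre_self (v : V) : centre (hξ v) (ξ v) = 0 := by
  ext
  simp [centre, inner_self_eq_norm_sq_to_K, hξ]

theorem inner_leg (v : V) (η : ((ℂ ∙ ξ v)ᗮ : Submodule ℂ (H v))) :
    ⟪ξ v, (η : H v)⟫_ℂ = 0 :=
  Submodule.mem_orthogonal_singleton_iff_inner_right.1 η.2

theorem centre_of_inner_eq_zero {v : V} {h : H v} (h0 : ⟪ξ v, h⟫_ℂ = 0) :
    (centre (hξ v) h : H v) = h := by
  simp [centre, h0]

theorem centre_leg (v : V) (η : ((ℂ ∙ ξ v)ᗮ : Submodule ℂ (H v))) :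
    centre (hξ v) (η : H v) = η :=
  Subtype.ext (centre_of_inner_eq_zero hξ (inner_leg v η))

/-- A list of legs over a word `w` such that `v w` is reduced, as an elementary tensor. -/
def elemOfL {v : V} (x : List (Leg ξ)) (h : IsReduced Γ (v :: word x)) : ElemTensorL Γ ξ v :=
  ⟨elemOf x h.of_cons, h⟩

variable (Γ) in
/-- The vector `Uᵥ (h ⊗ x)` for an elementary tensor `x` such that `v x` is reduced. -/
def prefixVec (v : V) (h : H v) (x : List (Leg ξ)) : Fock Γ ξ :=
  ⟪ξ v, h⟫_ℂ • vec Γ x + vec Γ (⟨v, centre (hξ v) h⟩ :: x)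

theorem prefixVec_eq {v : V} {x : List (Leg ξ)} (hx : IsReduced Γ (v :: word x)) (h : H v) :
    prefixVec Γ hξ v h x =
      unitaryL hξ v (htmul h (tensL v (elemOfL x hx))) := by
  rw [unitaryL_apply, prefixVec, vec_of_isReduced hx.of_cons, vec_of_isReduced hx]
  rfl

theorem vec_cons_zero (v : V) (x : List (Leg ξ)) :
    vec Γ ((⟨v, 0⟩ : Leg ξ) :: x) = 0 := by
  by_cases hx : IsReduced Γ (v :: word x)
  · rw [vec_of_isReduced hx, ← inner_self_eq_zero (𝕜 := ℂ), inner_tens]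
    refine (elemInner_cons_cons v 0 0 (elemOf x hx.of_cons) (elemOf x hx.of_cons) hx hx).trans ?_
    rw [inner_zero_left, zero_mul]
  · exact vec_of_not_isReduced hx

theorem prefixVec_self (v : V) (x : List (Leg ξ)) :
    prefixVec Γ hξ v (ξ v) x = vec Γ x := by
  rw [prefixVec, centre_self, vec_cons_zero, inner_self_eq_norm_sq_to_K, hξ]
  simp

theorem prefixVec_leg (v : V) (η : ((ℂ ∙ ξ v)ᗮ : Submodule ℂ (H v))) (x : List (Leg ξ)) :
    prefixVec Γ hξ v (η : H v) x = vec Γ (⟨v, η⟩ :: x) := by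
  rw [prefixVec, centre_leg, inner_leg, zero_smul, zero_add]

theorem Shuffle.prefixVec_eq {x y : List (Leg ξ)} (h : Shuffle Γ Sigma.fst x y) (v : V)
    (k : H v) : prefixVec Γ hξ v k x = prefixVec Γ hξ v k y := by
  rw [prefixVec, prefixVec, h.vec_eq, (Shuffle.cons _ h).vec_eq]

/-- Every elementary tensor is of the form `Uᵥ (h ⊗ x)`. -/
theorem exists_prefixVec (v : V) {x : List (Leg ξ)} (hx : IsReduced Γ (word x)) :
    ∃ (h : H v) (y : List (Leg ξ)), IsReduced Γ (v :: word y) ∧ (∀ p ∈ y, p ∈ x) ∧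
      vec Γ x = prefixVec Γ hξ v h y := by
  cases he : extract Γ Sigma.fst v x with
  | none =>
    exact ⟨ξ v, x, isReduced_cons_iff.2 ⟨hx, extract_map_eq_none.2 he⟩, fun _ h => h,
      (prefixVec_self hξ v x).symm⟩
  | some a =>
    obtain ⟨⟨u, η⟩, y⟩ := a
    obtain rfl : u = v := label_extract he
    have hs := shuffle_of_extract he
    exact ⟨η, y, hs.isReduced_word.1 hx, fun p hp => hs.symm.perm.subset (by simp [hp]),
      by rw [hs.vec_eq, prefixVec_leg]⟩

/-- The range of `Uᵥ` contains all elementary tensors `x`: if no leg at `v` can be moved to the front,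
then `x` lies in `ℋᴸ(v)` and is the image of `ξᵥ ⊗ x`. -/
theorem unitaryL_surjective (v : V) : Function.Surjective (unitaryL (Γ := Γ) hξ v) := by
  have hclosed : IsClosed (LinearMap.range (unitaryL (Γ := Γ) hξ v).toLinearMap : Set (Fock Γ ξ)) :=
    (unitaryL (Γ := Γ) hξ v).isometry.isClosedEmbedding.isClosed_range
  have hle : (Submodule.span ℂ (Set.range fun x : List (Leg ξ) => vec Γ x)).topologicalClosure ≤
      LinearMap.range (unitaryL (Γ := Γ) hξ v).toLinearMap := by
    refine Submodule.topologicalClosure_minimal _ (Submodule.span_le.2 ?_) hclosed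
    rintro _ ⟨x, rfl⟩
    by_cases hx : IsReduced Γ (word x)
    · obtain ⟨h, y, hy, -, he⟩ := exists_prefixVec hξ v hx
      exact ⟨_, by rw [prefixVec_eq hξ hy] at he; exact he.symm⟩
    · simp only [vec_of_not_isReduced hx]
      exact Submodule.zero_mem _
  rw [vec_total] at hle
  intro z
  exact hle (Submodule.mem_top (x := z))

theorem adjoint_unitaryL (v : V) (z : HilbertTensor (H v) (fockL Γ ξ v)) :
    ContinuousLinearMap.adjoint (unitaryL (Γ := Γ) hξ v).toContinuousLinearMap
      (unitaryL hξ v z) = z := by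
  refine ext_inner_left ℂ fun y => ?_
  rw [ContinuousLinearMap.adjoint_inner_right]
  exact (unitaryL hξ v).inner_map_map _ _

theorem lam_unitaryL (v : V) (a : H v →L[ℂ] H v) (z : HilbertTensor (H v) (fockL Γ ξ v)) :
    lam Γ hξ v a (unitaryL hξ v z) = unitaryL hξ v (ampL _ a z) := by
  change unitaryL hξ v (ampL _ a (ContinuousLinearMap.adjoint _ (unitaryL hξ v z))) = _
  rw [adjoint_unitaryL]

theorem lam_ext {v : V} {S T : Fock Γ ξ →L[ℂ] Fock Γ ξ}
    (h : ∀ z, S (unitaryL hξ v z) = T (unitaryL hξ v z)) : S = T :=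
  ContinuousLinearMap.ext fun y => by
    obtain ⟨z, rfl⟩ := unitaryL_surjective hξ v y
    exact h z

variable [∀ v, CompleteSpace (H v)]

variable (Γ) in
/-- The operators `λᵥ(a)` form a representation of the bounded operators on `Hᵥ`. -/
def lamHom (v : V) : (H v →L[ℂ] H v) →⋆ₐ[ℂ] (Fock Γ ξ →L[ℂ] Fock Γ ξ) where
  toFun := lam Γ hξ v
  map_one' := lam_ext (v := v) hξ fun z => by rw [lam_unitaryL, ampL_one]; rfl
  map_mul' a b := lam_ext (v := v) hξ fun z => by
    rw [mul_apply_eq_comp, lam_unitaryL, lam_unitaryL, lam_unitaryL, ampL_mul]; rfl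
  map_zero' := lam_ext (v := v) hξ fun z => by
    rw [lam_unitaryL, ← zero_smul ℂ (0 : H v →L[ℂ] H v), ampL_smul]; simp
  map_add' a b := lam_ext (v := v) hξ fun z => by
    rw [add_apply, lam_unitaryL, lam_unitaryL, lam_unitaryL, ampL_add,
      add_apply, map_add]
  commutes' c := lam_ext (v := v) hξ fun z => by
    rw [Algebra.algebraMap_eq_smul_one, Algebra.algebraMap_eq_smul_one, lam_unitaryL, ampL_smul,
      ampL_one, smul_apply, smul_apply, map_smul]; rfl
  map_star' a := by
    rw [ContinuousLinearMap.star_eq_adjoint, ContinuousLinearMap.star_eq_adjoint, lam, lam,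
      ContinuousLinearMap.adjoint_comp, ContinuousLinearMap.adjoint_comp, adjoint_ampL,
      ContinuousLinearMap.adjoint_adjoint]
    rfl

theorem lamHom_apply (v : V) (a : H v →L[ℂ] H v) : lamHom Γ hξ v a = lam Γ hξ v a := rfl

theorem lamHom_prefixVec {v : V} {x : List (Leg ξ)} (hx : IsReduced Γ (v :: word x))
    (a : H v →L[ℂ] H v) (h : H v) :
    lamHom Γ hξ v a (prefixVec Γ hξ v h x) = prefixVec Γ hξ v (a h) x := by
  rw [lamHom_apply, prefixVec_eq hξ hx, prefixVec_eq hξ hx, lam_unitaryL, ampL_htmul]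

theorem lamHom_vec {v : V} {x : List (Leg ξ)} (hx : IsReduced Γ (v :: word x))
    (a : H v →L[ℂ] H v) : lamHom Γ hξ v a (vec Γ x) = prefixVec Γ hξ v (a (ξ v)) x := by
  rw [← prefixVec_self hξ v x, lamHom_prefixVec hξ hx]

theorem lamHom_vec_cons {v : V} {x : List (Leg ξ)} (hx : IsReduced Γ (v :: word x))
    (η : ((ℂ ∙ ξ v)ᗮ : Submodule ℂ (H v))) (a : H v →L[ℂ] H v) :
    lamHom Γ hξ v a (vec Γ (⟨v, η⟩ :: x)) = prefixVec Γ hξ v (a η) x := by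
  rw [← prefixVec_leg hξ v η x, lamHom_prefixVec hξ hx]

/-- A creation operator: the rank one operator `h ↦ ⟪ξᵥ, h⟫ η` puts the leg `η` in front. -/
theorem lamHom_rankOne_vec {v : V} {x : List (Leg ξ)} (hx : IsReduced Γ (v :: word x))
    (k : H v) : lamHom Γ hξ v (InnerProductSpace.rankOne ℂ k (ξ v)) (vec Γ x) =
      prefixVec Γ hξ v k x := by
  rw [lamHom_vec hξ hx, InnerProductSpace.rankOne_apply, inner_self_eq_norm_sq_to_K, hξ]
  simp

/-- Operators of adjacent vertices commute. -/
theorem lamHom_commute {u v : V} (huv : Γ.Adj u v) (a : H u →L[ℂ] H u) (b : H v →L[ℂ] H v) :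
    Commute (lamHom Γ hξ u a) (lamHom Γ hξ v b) := by
  -- the doubly prefixed vectors `U_u (k ⊗ U_v (h ⊗ y))`
  let Z : H u → H v → List (Leg ξ) → Fock Γ ξ := fun k h y =>
    ⟪ξ u, k⟫_ℂ • prefixVec Γ hξ v h y + prefixVec Γ hξ v h (⟨u, centre (hξ u) k⟩ :: y)
  have hZ : ∀ k h y, Z k h y =
      ⟪ξ v, h⟫_ℂ • prefixVec Γ hξ u k y + prefixVec Γ hξ u k (⟨v, centre (hξ v) h⟩ :: y) := by
    intro k h y
    have hs : vec Γ ((⟨v, centre (hξ v) h⟩ : Leg ξ) :: ⟨u, centre (hξ u) k⟩ :: y) =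
        vec Γ (⟨u, centre (hξ u) k⟩ :: ⟨v, centre (hξ v) h⟩ :: y) :=
      (Shuffle.swap _ _ _ huv.symm).vec_eq
    simp only [Z, prefixVec, hs, smul_add, smul_smul, mul_comm ⟪ξ u, k⟫_ℂ]
    abel
  have hred : ∀ {u v : V} {y : List (Leg ξ)} (η : ((ℂ ∙ ξ u)ᗮ : Submodule ℂ (H u))), Γ.Adj u v →
      IsReduced Γ (u :: word y) → IsReduced Γ (v :: word y) →
      IsReduced Γ (v :: word ((⟨u, η⟩ : Leg ξ) :: y)) := by
    intro u v y η huv hu hv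
    refine isReduced_cons_iff.2 ⟨hu, ?_⟩
    rw [extract_map_eq_none, extract_cons_adj (by exact huv), extract_eq_none_of_isReduced hv]
    rfl
  have hZv : ∀ k h y, IsReduced Γ (u :: word y) → IsReduced Γ (v :: word y) →
      lamHom Γ hξ v b (Z k h y) = Z k (b h) y := by
    intro k h y hu hv
    simp only [Z]
    rw [map_add, map_smul, lamHom_prefixVec hξ hv, lamHom_prefixVec hξ (hred _ huv hu hv)]
  have hZu : ∀ k h y, IsReduced Γ (u :: word y) → IsReduced Γ (v :: word y) →
      lamHom Γ hξ u a (Z k h y) = Z (a k) h y := by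
    intro k h y hu hv
    rw [hZ, hZ, map_add, map_smul, lamHom_prefixVec hξ hu,
      lamHom_prefixVec hξ (hred _ huv.symm hv hu)]
  refine clm_ext_vec fun x hx => ?_
  suffices ∃ k h y, IsReduced Γ (u :: word y) ∧ IsReduced Γ (v :: word y) ∧
      vec Γ x = Z k h y by
    obtain ⟨k, h, y, hu, hv, he⟩ := this
    rw [he, mul_apply_eq_comp, mul_apply_eq_comp, hZv _ _ _ hu hv,
      hZu _ _ _ hu hv, hZu _ _ _ hu hv, hZv _ _ _ hu hv]
  obtain ⟨h, m, hm, -, he⟩ := exists_prefixVec hξ v hx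
  cases hum : extract Γ Sigma.fst u m with
  | none =>
    refine ⟨ξ u, h, m, isReduced_cons_iff.2 ⟨hm.of_cons, extract_map_eq_none.2 hum⟩, hm, ?_⟩
    rw [hZ, prefixVec_self, prefixVec_self, he, prefixVec]
  | some p =>
    obtain ⟨⟨w, κ⟩, y⟩ := p
    obtain rfl : w = u := label_extract hum
    have hs := shuffle_of_extract hum
    have hred' : IsReduced Γ (w :: word y) := hs.isReduced_word.1 hm.of_cons
    have hv : extract Γ Sigma.fst v y = none := by
      have := hs.extract_eq_none (extract_eq_none_of_isReduced hm)
      rwa [extract_cons_adj (by exact huv), Option.map_eq_none_iff] at this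
    refine ⟨κ, h, y, hred', isReduced_cons_iff.2 ⟨hred'.of_cons, extract_map_eq_none.2 hv⟩, ?_⟩
    simp only [Z]
    rw [inner_leg, centre_leg, zero_smul, zero_add, he, hs.prefixVec_eq]

theorem norm_lamHom_le (v : V) (a : H v →L[ℂ] H v) : ‖lamHom Γ hξ v a‖ ≤ ‖a‖ :=
  NonUnitalStarAlgHom.norm_apply_le _ a

end Lam

/-! ### The span of reduced words in a graph product of star algebras -/

section Span

variable {V : Type*} {Γ : SimpleGraph V} {A : V → Type*} [∀ v, CStarAlgebra (A v)] {D : Type*}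
  [Ring D] [StarRing D] [Algebra ℂ D]

/-- The product `j_{v₁}(a₁) ⋯ j_{vₙ}(aₙ)` of a list of pairs `(vᵢ, aᵢ)`. -/
def repTensor (j : ∀ v, A v →⋆ₐ[ℂ] D) (l : List (Σ v, A v)) : D := (l.map fun p => j p.1 p.2).prod

theorem repTensor_nil (j : ∀ v, A v →⋆ₐ[ℂ] D) : repTensor j [] = 1 := rfl

theorem repTensor_cons (j : ∀ v, A v →⋆ₐ[ℂ] D) (p : Σ v, A v) (l : List (Σ v, A v)) :
    repTensor j (p :: l) = j p.1 p.2 * repTensor j l := by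
  rw [repTensor, List.map_cons, List.prod_cons, repTensor]

variable [∀ v, PartialOrder (A v)] [∀ v, StarOrderedRing (A v)] {φ : ∀ v, A v →ₚ[ℂ] ℂ}
  {j : ∀ v, A v →⋆ₐ[ℂ] D}

variable (Γ φ j) in
/-- The linear span of the products `j_{v₁}(a₁) ⋯ j_{vₙ}(aₙ)` for reduced words `v₁ ⋯ vₙ` and
`aᵢ ∈ ker φ_{vᵢ}`. -/
def reducedSpan : Submodule ℂ D :=
  Submodule.span ℂ {T | ∃ l, IsReducedTensor Γ φ l ∧ T = repTensor j l}

theorem repTensor_mem {l : List (Σ v, A v)} (hl : IsReducedTensor Γ φ l) :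
    repTensor j l ∈ reducedSpan Γ φ j := Submodule.subset_span ⟨l, hl, rfl⟩

theorem isReducedTensor_nil : IsReducedTensor Γ φ [] := ⟨IsReduced.nil, by simp⟩

theorem IsReducedTensor.of_cons {p : Σ v, A v} {l : List (Σ v, A v)}
    (h : IsReducedTensor Γ φ (p :: l)) : IsReducedTensor Γ φ l :=
  ⟨h.1.of_cons, fun q hq => h.2 q (by simp [hq])⟩

theorem Shuffle.isReducedTensor {l m : List (Σ v, A v)} (h : Shuffle Γ Sigma.fst l m)
    (hl : IsReducedTensor Γ φ l) : IsReducedTensor Γ φ m :=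
  ⟨h.map.isReduced hl.1, fun p hp => hl.2 p (h.symm.perm.subset hp)⟩

theorem Shuffle.repTensor_eq
    (hj : ∀ u v, Γ.Adj u v → ∀ a b, Commute (j u a) (j v b)) {l m : List (Σ v, A v)}
    (h : Shuffle Γ Sigma.fst l m) : repTensor j l = repTensor j m := by
  induction h with
  | refl l => rfl
  | cons p _ ih => rw [repTensor_cons, repTensor_cons, ih]
  | swap p q l h =>
    rw [repTensor_cons, repTensor_cons, repTensor_cons, repTensor_cons, ← mul_assoc,
      (hj _ _ h p.2 q.2).eq, mul_assoc]
  | trans _ _ ih ih' => exact ih.trans ih'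

/-- If the letter `v` can be extracted from a reduced word, the two entries are multiplied first;
splitting the entry at `v` as `a = (a - φ(a) 1) + φ(a) 1` then leaves reduced words only. -/
theorem mul_mem_reducedSpan (hφ : ∀ v, φ v 1 = 1)
    (hj : ∀ u v, Γ.Adj u v → ∀ a b, Commute (j u a) (j v b)) (v : V) (a : A v) {T : D}
    (hT : T ∈ reducedSpan Γ φ j) : j v a * T ∈ reducedSpan Γ φ j := by
  have key : ∀ (a : A v) (l : List (Σ v, A v)), IsReducedTensor Γ φ l →
      extract Γ Sigma.fst v l = none → j v a * repTensor j l ∈ reducedSpan Γ φ j := by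
    intro a l hl he
    have h1 : j v a * repTensor j l =
        repTensor j (⟨v, a - φ v a • 1⟩ :: l) + φ v a • repTensor j l := by
      rw [repTensor_cons]
      simp [sub_mul]
    rw [h1]
    refine Submodule.add_mem _ (repTensor_mem ⟨isReduced_cons_iff.2 ⟨hl.1, ?_⟩, ?_⟩)
      (Submodule.smul_mem _ _ (repTensor_mem hl))
    · exact extract_map_eq_none.2 he
    · intro p hp
      rcases List.mem_cons.1 hp with rfl | hp
      · simp [hφ]
      · exact hl.2 p hp
  induction hT using Submodule.span_induction with
  | mem T hT =>
    obtain ⟨l, hl, rfl⟩ := hT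
    cases he : extract Γ Sigma.fst v l with
    | none => exact key a l hl he
    | some x =>
      obtain ⟨⟨u, b⟩, m⟩ := x
      obtain rfl : u = v := label_extract he
      have hs := shuffle_of_extract he
      have hl' := hs.isReducedTensor hl
      rw [hs.repTensor_eq hj, repTensor_cons, ← mul_assoc, ← map_mul]
      exact key _ m hl'.of_cons (extract_map_eq_none.1 (isReduced_cons_iff.1 hl'.1).2)
  | zero => rw [mul_zero]; exact Submodule.zero_mem _
  | add S T _ _ hS hT => rw [mul_add]; exact Submodule.add_mem _ hS hT
  | smul c T _ hT => rw [mul_smul_comm]; exact Submodule.smul_mem _ _ hT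

theorem star_repTensor (l : List (Σ v, A v)) :
    star (repTensor j l) = repTensor j (l.map fun p => ⟨p.1, star p.2⟩).reverse := by
  induction l with
  | nil => simp [repTensor]
  | cons p l ih =>
    rw [repTensor_cons, star_mul, ih, ← map_star]
    simp [repTensor]

variable [StarModule ℂ D]

variable (Γ) in
/-- The span of the reduced words as a star subalgebra. -/
def reducedAlgebra (j : ∀ v, A v →⋆ₐ[ℂ] D) (hφ : ∀ v, φ v 1 = 1)
    (hj : ∀ u v, Γ.Adj u v → ∀ a b, Commute (j u a) (j v b)) : StarSubalgebra ℂ D where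
  carrier := reducedSpan Γ φ j
  add_mem' := Submodule.add_mem _
  algebraMap_mem' c := by
    rw [Algebra.algebraMap_eq_smul_one]
    exact Submodule.smul_mem _ _ (repTensor_mem isReducedTensor_nil)
  mul_mem' := by
    intro S T hS hT
    change S ∈ Submodule.span ℂ _ at hS
    induction hS using Submodule.span_induction with
    | mem S hS =>
      obtain ⟨l, -, rfl⟩ := hS
      induction l with
      | nil => rwa [repTensor_nil, one_mul]
      | cons p l ih =>
        rw [repTensor_cons, mul_assoc]
        exact mul_mem_reducedSpan hφ hj _ _ ih
    | zero => rw [zero_mul]; exact Submodule.zero_mem _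
    | add S S' _ _ hS hS' => rw [add_mul]; exact Submodule.add_mem _ hS hS'
    | smul c S _ hS => rw [smul_mul_assoc]; exact Submodule.smul_mem _ _ hS
  star_mem' := by
    intro S hS
    change S ∈ Submodule.span ℂ _ at hS
    induction hS using Submodule.span_induction with
    | mem S hS =>
      obtain ⟨l, hl, rfl⟩ := hS
      rw [star_repTensor]
      refine repTensor_mem ⟨?_, ?_⟩
      · rw [List.map_reverse, List.map_map]
        exact hl.1.reverse
      · intro p hp
        simp only [List.mem_reverse, List.mem_map] at hp
        obtain ⟨q, hq, rfl⟩ := hp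
        change φ q.1 (star q.2) = 0
        rw [map_star, hl.2 q hq, star_zero]
    | zero => rw [star_zero]; exact Submodule.zero_mem _
    | add S T _ _ hS hT => rw [star_add]; exact Submodule.add_mem _ hS hT
    | smul c S _ hS => rw [star_smul]; exact Submodule.smul_mem _ _ hS

end Span

/-! ### Representations on the Fock space -/

section FockRep

variable {V : Type*} (Γ : SimpleGraph V) {A : V → Type*} [∀ v, CStarAlgebra (A v)]
  {H : V → Type*} [∀ v, NormedAddCommGroup (H v)] [∀ v, InnerProductSpace ℂ (H v)]
  [∀ v, CompleteSpace (H v)] {ξ : ∀ v, H v} (hξ : ∀ v, ‖ξ v‖ = 1)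
  (ρ : ∀ v, A v →⋆ₐ[ℂ] (H v →L[ℂ] H v))

/-- The representation `λᵥ ∘ ρᵥ` of `Aᵥ` on the Fock space, for a representation `ρᵥ` on `Hᵥ`. -/
def fockRep (v : V) : A v →⋆ₐ[ℂ] (Fock Γ ξ →L[ℂ] Fock Γ ξ) := (lamHom Γ hξ v).comp (ρ v)

theorem fockRep_apply (v : V) (a : A v) : fockRep Γ hξ ρ v a = lamHom Γ hξ v (ρ v a) := rfl

variable {Γ} in
theorem fockRep_commute (u v : V) (h : Γ.Adj u v) (a : A u) (b : A v) :
    Commute (fockRep Γ hξ ρ u a) (fockRep Γ hξ ρ v b) := lamHom_commute hξ h _ _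

end FockRep

section Closure

variable {V : Type*} (Γ : SimpleGraph V) {A : V → Type*} [∀ v, CStarAlgebra (A v)]
  [∀ v, PartialOrder (A v)] [∀ v, StarOrderedRing (A v)] {φ : ∀ v, A v →ₚ[ℂ] ℂ}
  (hφ : ∀ v, φ v 1 = 1)

/-- The representation of `A v` on the Fock space of the GNS representations. -/
abbrev gnsFockRep (v : V) :
    A v →⋆ₐ[ℂ] (Fock Γ (gnsVector φ) →L[ℂ] Fock Γ (gnsVector φ)) :=
  fockRep Γ (norm_gnsVector φ hφ) (fun v => (φ v).gnsStarAlgHom) v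

theorem lamTensor_eq (l : List (Σ v, A v)) :
    lamTensor Γ hφ l = repTensor (gnsFockRep Γ hφ) l := rfl

/-- The span of the reduced words is a star algebra already, so that its closure is the reduced
graph product. -/
theorem graphProductSubalgebra_eq_closure :
    (graphProductSubalgebra Γ hφ : Set (Fock Γ (gnsVector φ) →L[ℂ] Fock Γ (gnsVector φ))) =
      closure (algebraicGraphProduct Γ hφ) := by
  have hle : StarAlgebra.adjoin ℂ (algebraicGraphProduct Γ hφ :
      Set (Fock Γ (gnsVector φ) →L[ℂ] Fock Γ (gnsVector φ))) ≤
        reducedAlgebra (φ := φ) Γ (gnsFockRep Γ hφ) hφ (fockRep_commute _ _) :=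
    StarAlgebra.adjoin_le fun T hT => hT
  have h : (StarAlgebra.adjoin ℂ (algebraicGraphProduct Γ hφ :
      Set (Fock Γ (gnsVector φ) →L[ℂ] Fock Γ (gnsVector φ))) :
        Set (Fock Γ (gnsVector φ) →L[ℂ] Fock Γ (gnsVector φ))) = algebraicGraphProduct Γ hφ :=
    subset_antisymm hle (StarAlgebra.subset_adjoin ℂ _)
  rw [graphProductSubalgebra, StarSubalgebra.topologicalClosure_coe, h]

end Closure

/-! ### The action of reduced words on elementary tensors -/

section Action

variable {V : Type*} {Γ : SimpleGraph V} {A : V → Type*} [∀ v, CStarAlgebra (A v)]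
  [∀ v, PartialOrder (A v)] [∀ v, StarOrderedRing (A v)] {φ : ∀ v, A v →ₚ[ℂ] ℂ}
  {H : V → Type*} [∀ v, NormedAddCommGroup (H v)] [∀ v, InnerProductSpace ℂ (H v)]
  [∀ v, CompleteSpace (H v)] {ξ : ∀ v, H v} (hξ : ∀ v, ‖ξ v‖ = 1)
  {ρ : ∀ v, A v →⋆ₐ[ℂ] (H v →L[ℂ] H v)} (hρ : ∀ v a, ⟪ξ v, ρ v a (ξ v)⟫_ℂ = φ v a)

include hρ in
theorem prefixVec_of_state_eq_zero {v : V} {a : A v} (ha : φ v a = 0) (x : List (Leg ξ)) :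
    prefixVec Γ hξ v (ρ v a (ξ v)) x = vec Γ (⟨v, centre (hξ v) (ρ v a (ξ v))⟩ :: x) := by
  rw [prefixVec, hρ, ha, zero_smul, zero_add]

include hρ in
/-- A reduced word maps an elementary tensor `z` to a combination of elementary tensors `y₁ y₂`,
where `y₁` collects the legs that were created or modified and `y₂` the legs of `z` left untouched;
the letters `w` that annihilated a leg of `z` come last in the word, up to a shuffle. -/
theorem repTensor_vec_mem {l : List (Σ v, A v)} (hl : IsReducedTensor Γ φ l)
    {z : List (Leg ξ)} (hz : IsReduced Γ (word z)) :
    repTensor (fockRep Γ hξ ρ) l (vec Γ z) ∈ Submodule.span ℂ {y | ∃ (y₁ y₂ : List (Leg ξ))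
      (w : List V), IsReduced Γ (word (y₁ ++ y₂)) ∧ y₂ ⊆ z ∧ w ⊆ word z ∧
        Shuffle Γ id (l.map Sigma.fst) (word y₁ ++ w) ∧ y = vec Γ (y₁ ++ y₂)} := by
  induction l with
  | nil =>
    exact Submodule.subset_span ⟨[], z, [], hz, fun _ h => h, by simp, .refl _, rfl⟩
  | cons p l ih =>
    have ih := ih hl.of_cons
    obtain ⟨v, a⟩ := p
    rw [repTensor_cons, mul_apply_eq_comp]
    generalize repTensor (fockRep Γ hξ ρ) l (vec Γ z) = y at ih
    induction ih using Submodule.span_induction with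
    | zero => rw [map_zero]; exact Submodule.zero_mem _
    | add x y _ _ hx hy => rw [map_add]; exact Submodule.add_mem _ hx hy
    | smul c x _ hx => rw [map_smul]; exact Submodule.smul_mem _ _ hx
    | mem y hy =>
      obtain ⟨y₁, y₂, w, hr, hyz, hw, hs, rfl⟩ := hy
      have ha : φ v a = 0 := hl.2 ⟨v, a⟩ (by simp)
      have hv1 : IsReduced Γ (v :: word y₁ ++ w) := (Shuffle.cons v hs).isReduced hl.1
      have hv : extract Γ Sigma.fst v y₁ = none :=
        extract_eq_none_of_isReduced hv1.of_append_left
      rw [fockRep_apply]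
      change lamHom Γ hξ v (ρ v a) (vec Γ (y₁ ++ y₂)) ∈ _
      cases he : extract Γ Sigma.fst v (y₁ ++ y₂) with
      | none =>
        have hred : IsReduced Γ (v :: word (y₁ ++ y₂)) :=
          isReduced_cons_iff.2 ⟨hr, extract_map_eq_none.2 he⟩
        rw [lamHom_vec hξ hred, prefixVec_of_state_eq_zero hξ hρ ha]
        exact Submodule.subset_span ⟨⟨v, centre (hξ v) (ρ v a (ξ v))⟩ :: y₁, y₂, w, hred, hyz,
          hw, .cons v hs, rfl⟩
      | some x =>
        obtain ⟨⟨u, η⟩, m⟩ := x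
        obtain rfl : u = v := label_extract he
        obtain ⟨hadj, m', he', rfl⟩ := extract_append_eq_some hv he
        have hs' := shuffle_of_extract he
        have hs'' := shuffle_of_extract he'
        have hred := hs'.isReduced_word.1 hr
        rw [hs'.vec_eq, lamHom_vec_cons hξ hred, prefixVec]
        have hm : m' ⊆ z := fun q hq => hyz (hs''.symm.perm.subset (by simp [hq]))
        refine Submodule.add_mem _ (Submodule.smul_mem _ _ (Submodule.subset_span
          ⟨y₁, m', u :: w, hred.of_cons, hm, ?_, ?_, rfl⟩))
          (Submodule.subset_span ⟨⟨u, centre (hξ u) (ρ u a η)⟩ :: y₁, m', w, hred, hm, hw,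
            .cons u hs, rfl⟩)
        · refine List.cons_subset.2 ⟨?_, hw⟩
          exact List.mem_map.2 ⟨⟨u, η⟩, hyz (hs''.symm.perm.subset (by simp)), rfl⟩
        · refine (Shuffle.cons u hs).trans (Shuffle.middle (f := id) ?_ _).symm
          intro q hq
          obtain ⟨r, hr, rfl⟩ := List.mem_map.1 hq
          exact hadj r hr

include hρ in
/-- A word with a letter outside a set `c` moves elementary tensors over `c` to vectors orthogonal
to all elementary tensors over `c`. -/
theorem inner_repTensor_vec_eq_zero {l : List (Σ v, A v)} (hl : IsReducedTensor Γ φ l)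
    {z z' : List (Leg ξ)} {c : List V} (hz : word z ⊆ c) (hz' : word z' ⊆ c)
    (hlc : ¬ ∀ p ∈ l, p.1 ∈ c) :
    ⟪vec Γ z', repTensor (fockRep Γ hξ ρ) l (vec Γ z)⟫_ℂ = 0 := by
  by_cases hzr : IsReduced Γ (word z)
  · have hmem := repTensor_vec_mem hξ hρ hl hzr
    generalize repTensor (fockRep Γ hξ ρ) l (vec Γ z) = y at hmem
    induction hmem using Submodule.span_induction with
    | zero => rw [inner_zero_right]
    | add x y _ _ hx hy => rw [inner_add_right, hx, hy, add_zero]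
    | smul c x _ hx => rw [inner_smul_right, hx, mul_zero]
    | mem y hy =>
      obtain ⟨y₁, y₂, w, hr, hyz, hw, hs, rfl⟩ := hy
      refine inner_vec_eq_zero_of_not_perm fun hp => hlc fun p hpl => ?_
      rcases List.mem_append.1 (hs.perm.subset (List.mem_map.2 ⟨p, hpl, rfl⟩)) with h | h
      · refine hz' (hp.symm.subset ?_)
        rw [word, List.map_append]
        exact List.mem_append_left _ h
      · exact hz (hw h)
  · rw [vec_of_not_isReduced hzr, map_zero, inner_zero_right]

end Action

/-! ### Clique functionals -/

section Clique

variable {V : Type*} {Γ : SimpleGraph V} {H : V → Type*} [∀ v, NormedAddCommGroup (H v)]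
  [∀ v, InnerProductSpace ℂ (H v)] [∀ v, CompleteSpace (H v)] {ξ : ∀ v, H v}
  (hξ : ∀ v, ‖ξ v‖ = 1)

variable (Γ) in
/-- The operator that puts the vectors `k v`, for `v` in a list `c` of pairwise adjacent vertices,
in front of a vector that has no legs in `c`: the product of the rank one operators
`h ↦ ⟪ξᵥ, h⟫ k v`. -/
def cliqueOp (c : List V) (k : ∀ v, H v) : Fock Γ ξ →L[ℂ] Fock Γ ξ :=
  (c.map fun v => lamHom Γ hξ v (InnerProductSpace.rankOne ℂ (k v) (ξ v))).prod

theorem cliqueOp_nil (k : ∀ v, H v) : cliqueOp Γ hξ [] k = 1 := rfl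

theorem cliqueOp_cons (v : V) (c : List V) (k : ∀ v, H v) :
    cliqueOp Γ hξ (v :: c) k =
      lamHom Γ hξ v (InnerProductSpace.rankOne ℂ (k v) (ξ v)) * cliqueOp Γ hξ c k := by
  rw [cliqueOp, List.map_cons, List.prod_cons, cliqueOp]

theorem cliqueOp_congr {c : List V} {k k' : ∀ v, H v} (h : ∀ v ∈ c, k v = k' v) :
    cliqueOp Γ hξ c k = cliqueOp Γ hξ c k' := by
  rw [cliqueOp, cliqueOp]
  congr 1
  exact List.map_congr_left fun v hv => by rw [h v hv]

theorem commute_cliqueOp {v : V} {c : List V} (h : ∀ u ∈ c, Γ.Adj v u) (a : H v →L[ℂ] H v)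
    (k : ∀ v, H v) : Commute (lamHom Γ hξ v a) (cliqueOp Γ hξ c k) := by
  refine Commute.list_prod_right _ _ fun T hT => ?_
  obtain ⟨u, hu, rfl⟩ := List.mem_map.1 hT
  exact lamHom_commute hξ (h u hu) _ _

open Classical in
/-- An operator at a vertex of the clique acts on the vector put in front there. -/
theorem lamHom_mul_cliqueOp {u : V} {c : List V} (hc : c.Pairwise Γ.Adj) (hu : u ∈ c)
    (a : H u →L[ℂ] H u) (k : ∀ v, H v) :
    lamHom Γ hξ u a * cliqueOp Γ hξ c k =
      cliqueOp Γ hξ c (Function.update k u (a (k u))) := by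
  induction c with
  | nil => simp at hu
  | cons v c ih =>
    obtain ⟨h1, h2⟩ := List.pairwise_cons.1 hc
    rw [cliqueOp_cons, cliqueOp_cons, ← mul_assoc]
    by_cases huv : u = v
    · subst huv
      rw [← map_mul, Function.update_self,
        cliqueOp_congr hξ (k := Function.update k u (a (k u))) (k' := k)
          fun w hw => Function.update_of_ne (h1 w hw).ne' _ _]
      congr 2
      exact InnerProductSpace.comp_rankOne _ _ _
    · have hu' : u ∈ c := (List.mem_cons.1 hu).resolve_left huv
      rw [(lamHom_commute hξ (h1 u hu').symm a _).eq, mul_assoc, ih h2 hu',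
        Function.update_of_ne (Ne.symm huv)]

/-- The legs put in front of vectors `y` and `y'` contribute the factors `⟪h v, k v⟫`, if `y` has no
legs in `c`: the rank one operators at the vertices of `c` commute, and the projection onto `ξᵥ`
fixes `y`. -/
theorem inner_cliqueOp {c : List V} (hc : c.Pairwise Γ.Adj) (h k : ∀ v, H v)
    {y y' : Fock Γ ξ}
    (hy : ∀ v ∈ c, lamHom Γ hξ v (InnerProductSpace.rankOne ℂ (ξ v) (ξ v)) y = y) :
    ⟪cliqueOp Γ hξ c h y', cliqueOp Γ hξ c k y⟫_ℂ =
      (c.map fun v => ⟪h v, k v⟫_ℂ).prod * ⟪y', y⟫_ℂ := by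
  induction c with
  | nil => simp [cliqueOp_nil]
  | cons v c ih =>
    obtain ⟨h1, h2⟩ := List.pairwise_cons.1 hc
    rw [cliqueOp_cons, cliqueOp_cons, mul_apply_eq_comp, mul_apply_eq_comp,
      ← ContinuousLinearMap.adjoint_inner_right, ← ContinuousLinearMap.star_eq_adjoint,
      ← map_star, ContinuousLinearMap.star_eq_adjoint, InnerProductSpace.adjoint_rankOne,
      ← mul_apply_eq_comp (lamHom Γ hξ v _), ← map_mul]
    have h3 : InnerProductSpace.rankOne ℂ (ξ v) (h v) * InnerProductSpace.rankOne ℂ (k v) (ξ v) =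
        ⟪h v, k v⟫_ℂ • InnerProductSpace.rankOne ℂ (ξ v) (ξ v) :=
      InnerProductSpace.rankOne_comp_rankOne _ _ _ _
    rw [h3, map_smul, smul_apply, inner_smul_right, ← mul_apply_eq_comp,
      (commute_cliqueOp hξ h1 _ _).eq, mul_apply_eq_comp, hy v (by simp),
      ih h2 fun u hu => hy u (by simp [hu]), List.map_cons, List.prod_cons, mul_assoc]

theorem lamHom_rankOne_vacuum (v : V) :
    lamHom Γ hξ v (InnerProductSpace.rankOne ℂ (ξ v) (ξ v)) (vacuum Γ ξ) = vacuum Γ ξ := by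
  rw [← vec_nil, lamHom_rankOne_vec hξ (isReduced_cons_iff.2 ⟨IsReduced.nil, rfl⟩),
    prefixVec_self]

theorem norm_cliqueOp_le (c : List V) (k : ∀ v, H v) :
    ‖cliqueOp Γ hξ c k (vacuum Γ ξ)‖ ≤ (c.map fun v => ‖k v‖).prod := by
  induction c with
  | nil => simp [cliqueOp_nil, norm_vacuum]
  | cons v c ih =>
    rw [cliqueOp_cons, mul_apply_eq_comp, List.map_cons, List.prod_cons]
    refine (ContinuousLinearMap.le_opNorm _ _).trans (mul_le_mul ?_ ih (norm_nonneg _)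
      (norm_nonneg _))
    refine (norm_lamHom_le hξ v _).trans ?_
    rw [InnerProductSpace.norm_rankOne, hξ, mul_one]

/-- The vectors `k v` need not be orthogonal to `ξᵥ`, so that legs may be missing. -/
theorem cliqueOp_vacuum_mem_span (c : List V) (k : ∀ v, H v) :
    cliqueOp Γ hξ c k (vacuum Γ ξ) ∈
      Submodule.span ℂ {y | ∃ z : List (Leg ξ), word z ⊆ c ∧ y = vec Γ z} := by
  induction c with
  | nil => exact Submodule.subset_span ⟨[], by simp, vec_nil.symm⟩
  | cons v c ih =>
    rw [cliqueOp_cons, mul_apply_eq_comp]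
    generalize cliqueOp Γ hξ c k (vacuum Γ ξ) = y at ih
    induction ih using Submodule.span_induction with
    | zero => rw [map_zero]; exact Submodule.zero_mem _
    | add x y _ _ hx hy => rw [map_add]; exact Submodule.add_mem _ hx hy
    | smul c x _ hx => rw [map_smul]; exact Submodule.smul_mem _ _ hx
    | mem y hy =>
      obtain ⟨z, hz, rfl⟩ := hy
      by_cases hzr : IsReduced Γ (word z)
      · obtain ⟨h, y, hy, hyz, he⟩ := exists_prefixVec hξ v hzr
        rw [he, lamHom_prefixVec hξ hy, prefixVec]
        have hyc : word y ⊆ v :: c := fun u hu =>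
          List.mem_cons_of_mem _ (hz (List.map_subset _ (fun p hp => hyz p hp) hu))
        exact Submodule.add_mem _
          (Submodule.smul_mem _ _ (Submodule.subset_span ⟨y, hyc, rfl⟩))
          (Submodule.subset_span ⟨_ :: y, List.cons_subset.2 ⟨by simp, hyc⟩, rfl⟩)
      · rw [vec_of_not_isReduced hzr, map_zero]
        exact Submodule.zero_mem _

variable {A : V → Type*} [∀ v, CStarAlgebra (A v)]

open Classical in
/-- The product of the entries of `l` with the letter `v`. -/
def coeffAt (v : V) (l : List (Σ v, A v)) : A v :=
  (l.map fun p => if h : p.1 = v then h ▸ p.2 else 1).prod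

theorem coeffAt_cons_same (v : V) (a : A v) (l : List (Σ v, A v)) :
    coeffAt v (⟨v, a⟩ :: l) = a * coeffAt v l := by
  simp [coeffAt]

theorem coeffAt_cons_ne {u v : V} (h : u ≠ v) (a : A u) (l : List (Σ v, A v)) :
    coeffAt v (⟨u, a⟩ :: l) = coeffAt v l := by
  simp [coeffAt, h]

/-- Words over a clique act on the vectors put in front like an elementary tensor of operators. -/
theorem repTensor_mul_cliqueOp {ρ : ∀ v, A v →⋆ₐ[ℂ] (H v →L[ℂ] H v)} {c : List V}
    (hc : c.Pairwise Γ.Adj) {l : List (Σ v, A v)} (hl : ∀ p ∈ l, p.1 ∈ c) (k : ∀ v, H v) :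
    repTensor (fockRep Γ hξ ρ) l * cliqueOp Γ hξ c k =
      cliqueOp Γ hξ c fun v => ρ v (coeffAt v l) (k v) := by
  classical
  induction l with
  | nil => simp [repTensor, coeffAt]
  | cons p l ih =>
    obtain ⟨u, a⟩ := p
    rw [repTensor_cons, mul_assoc, ih fun q hq => hl q (by simp [hq]), fockRep_apply,
      lamHom_mul_cliqueOp hξ hc (hl ⟨u, a⟩ (by simp))]
    congr 1
    funext v
    by_cases h : v = u
    · subst h
      rw [Function.update_self, coeffAt_cons_same, map_mul, mul_apply_eq_comp]
    · rw [Function.update_of_ne h, coeffAt_cons_ne (Ne.symm h)]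

open Classical in
/-- The functional on words that vanishes unless all letters belong to the list `c` of pairwise
adjacent vertices, and then is the product of the values of the functionals `g v` for `v ∈ c`. It
factors through the conditional expectation onto the tensor product of the `Aᵥ` with `v ∈ c`. -/
def cliqueFunctional (c : List V) (g : ∀ v, A v →ₗ[ℂ] ℂ) (l : List (Σ v, A v)) : ℂ :=
  if ∀ p ∈ l, p.1 ∈ c then (c.map fun v => g v (coeffAt v l)).prod else 0

/-- The functional `a ↦ ⟪h, ρ(a) k⟫`. -/
def coeffFunctional {A E : Type*} [CStarAlgebra A] [NormedAddCommGroup E]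
    [InnerProductSpace ℂ E] [CompleteSpace E] (ρ : A →⋆ₐ[ℂ] (E →L[ℂ] E)) (h k : E) :
    A →ₗ[ℂ] ℂ where
  toFun a := ⟪h, ρ a k⟫_ℂ
  map_add' a b := by rw [map_add, add_apply, inner_add_right]
  map_smul' c a := by rw [map_smul, smul_apply, inner_smul_right]; rfl

theorem coeffFunctional_apply {A E : Type*} [CStarAlgebra A] [NormedAddCommGroup E]
    [InnerProductSpace ℂ E] [CompleteSpace E] (ρ : A →⋆ₐ[ℂ] (E →L[ℂ] E)) (h k : E) (a : A) :
    coeffFunctional ρ h k a = ⟪h, ρ a k⟫_ℂ := rfl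

theorem norm_coeffFunctional_le {A E : Type*} [CStarAlgebra A] [NormedAddCommGroup E]
    [InnerProductSpace ℂ E] [CompleteSpace E] (ρ : A →⋆ₐ[ℂ] (E →L[ℂ] E)) (h k : E) (a : A) :
    ‖coeffFunctional ρ h k a‖ ≤ ‖h‖ * ‖k‖ * ‖a‖ := by
  have h1 : ‖ρ a‖ ≤ ‖a‖ := NonUnitalStarAlgHom.norm_apply_le ρ a
  calc ‖⟪h, ρ a k⟫_ℂ‖ ≤ ‖h‖ * ‖ρ a k‖ := norm_inner_le_norm _ _
    _ ≤ ‖h‖ * (‖a‖ * ‖k‖) := by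
      gcongr
      exact (ContinuousLinearMap.le_opNorm _ _).trans (by gcongr)
    _ = ‖h‖ * ‖k‖ * ‖a‖ := by ring

theorem inner_cliqueOp_repTensor {ρ : ∀ v, A v →⋆ₐ[ℂ] (H v →L[ℂ] H v)} {c : List V}
    (hc : c.Pairwise Γ.Adj) {l : List (Σ v, A v)} (hl : ∀ p ∈ l, p.1 ∈ c) (h k : ∀ v, H v)
    {y y' : Fock Γ ξ}
    (hy : ∀ v ∈ c, lamHom Γ hξ v (InnerProductSpace.rankOne ℂ (ξ v) (ξ v)) y = y) :
    ⟪cliqueOp Γ hξ c h y', repTensor (fockRep Γ hξ ρ) l (cliqueOp Γ hξ c k y)⟫_ℂ =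
      cliqueFunctional c (fun v => coeffFunctional (ρ v) (h v) (k v)) l * ⟪y', y⟫_ℂ := by
  rw [← mul_apply_eq_comp, repTensor_mul_cliqueOp hξ hc hl, inner_cliqueOp hξ hc _ _ hy,
    cliqueFunctional, if_pos hl]
  rfl

variable [∀ v, PartialOrder (A v)] [∀ v, StarOrderedRing (A v)] {φ : ∀ v, A v →ₚ[ℂ] ℂ}
  {ρ : ∀ v, A v →⋆ₐ[ℂ] (H v →L[ℂ] H v)} (hρ : ∀ v a, ⟪ξ v, ρ v a (ξ v)⟫_ℂ = φ v a)

include hρ in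
/-- The clique functionals given by vectors of the spaces `Hᵥ` are matrix coefficients of the
representation on the Fock space. -/
theorem inner_cliqueOp_vacuum {c : List V} (hc : c.Pairwise Γ.Adj) {l : List (Σ v, A v)}
    (hl : IsReducedTensor Γ φ l) (h k : ∀ v, H v) :
    ⟪cliqueOp Γ hξ c h (vacuum Γ ξ),
        repTensor (fockRep Γ hξ ρ) l (cliqueOp Γ hξ c k (vacuum Γ ξ))⟫_ℂ =
      cliqueFunctional c (fun v => coeffFunctional (ρ v) (h v) (k v)) l := by
  by_cases hlc : ∀ p ∈ l, p.1 ∈ c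
  · rw [inner_cliqueOp_repTensor hξ hc hlc _ _ fun v _ => lamHom_rankOne_vacuum hξ v,
      inner_self_eq_norm_sq_to_K, norm_vacuum]
    simp
  · rw [cliqueFunctional, if_neg hlc]
    have hk := cliqueOp_vacuum_mem_span (Γ := Γ) hξ c k
    generalize cliqueOp Γ hξ c k (vacuum Γ ξ) = y at hk
    induction hk using Submodule.span_induction with
    | zero => rw [map_zero, inner_zero_right]
    | add x y _ _ hx hy => rw [map_add, inner_add_right, hx, hy, add_zero]
    | smul r x _ hx => rw [map_smul, inner_smul_right, hx, mul_zero]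
    | mem y hy =>
      obtain ⟨z, hz, rfl⟩ := hy
      have hh := cliqueOp_vacuum_mem_span (Γ := Γ) hξ c h
      generalize cliqueOp Γ hξ c h (vacuum Γ ξ) = y at hh
      induction hh using Submodule.span_induction with
      | zero => rw [inner_zero_left]
      | add x y _ _ hx hy => rw [inner_add_left, hx, hy, add_zero]
      | smul r x _ hx => rw [inner_smul_left, hx, mul_zero]
      | mem y hy =>
        obtain ⟨z', hz', rfl⟩ := hy
        exact inner_repTensor_vec_eq_zero hξ hρ hl hz hz' hlc

theorem opNorm_le_of_inner_le {E F : Type*} [NormedAddCommGroup E] [InnerProductSpace ℂ E]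
    [NormedAddCommGroup F] [InnerProductSpace ℂ F] (T : E →L[ℂ] F) {C : ℝ} (hC : 0 ≤ C)
    (h : ∀ x y, ‖⟪y, T x⟫_ℂ‖ ≤ C * (‖y‖ * ‖x‖)) : ‖T‖ ≤ C := by
  refine T.opNorm_le_bound hC fun x => ?_
  by_cases h0 : ‖T x‖ = 0
  · rw [h0]; positivity
  · have h1 := h x (T x)
    rw [inner_self_eq_norm_sq_to_K, norm_pow, RCLike.norm_ofReal, abs_norm] at h1
    have h2 : 0 < ‖T x‖ := lt_of_le_of_ne (norm_nonneg _) (Ne.symm h0)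
    refine le_of_mul_le_mul_left ?_ h2
    linarith [sq ‖T x‖, h1, mul_left_comm ‖T x‖ C ‖x‖]

include hρ in
/-- Clique functionals of bounded functionals are bounded with respect to the norm of operators on
the Fock space, if the representations are isometric. The functionals are replaced one by one by
matrix coefficients `a ↦ ⟪h, ρ(a) k⟫`; the bound for all `h` and `k` gives a bound for the norm of
the slice of the operator. -/
theorem norm_sum_cliqueFunctional_le (hiso : ∀ v a, ‖ρ v a‖ = ‖a‖) {c : List V}
    (hc : c.Pairwise Γ.Adj) (f : List (Σ v, A v) →₀ ℂ)
    (hf : ∀ l ∈ f.support, IsReducedTensor Γ φ l) (g : ∀ v, A v →ₗ[ℂ] ℂ) (M : V → ℝ)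
    (hM : ∀ v, 0 ≤ M v) (hg : ∀ v a, ‖g v a‖ ≤ M v * ‖a‖) :
    ‖f.sum fun l r => r * cliqueFunctional c g l‖ ≤
      (c.map M).prod * ‖f.sum fun l r => r • repTensor (fockRep Γ hξ ρ) l‖ := by
  classical
  set X := f.sum fun l r => r • repTensor (fockRep Γ hξ ρ) l with hX
  have hnodup : c.Nodup := hc.imp fun h => h.ne
  have key : ∀ (s : Finset V) (g : ∀ v, A v →ₗ[ℂ] ℂ) (M : V → ℝ), (∀ v, 0 ≤ M v) →
      (∀ v a, ‖g v a‖ ≤ M v * ‖a‖) →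
      (∀ v ∈ c, v ∉ s → ∃ h k, ‖h‖ * ‖k‖ ≤ M v ∧ g v = coeffFunctional (ρ v) h k) →
      ‖f.sum fun l r => r * cliqueFunctional c g l‖ ≤ (c.map M).prod * ‖X‖ := by
    intro s
    induction s using Finset.induction_on with
    | empty =>
      intro g M hM hg hs
      have hs' : ∀ v, ∃ h k : H v, v ∈ c → ‖h‖ * ‖k‖ ≤ M v ∧ g v = coeffFunctional (ρ v) h k := by
        intro v
        by_cases hv : v ∈ c
        · obtain ⟨h, k, hhk⟩ := hs v hv (by simp)
          exact ⟨h, k, fun _ => hhk⟩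
        · exact ⟨0, 0, fun h => absurd h hv⟩
      choose h k hhk using hs'
      have hg' : ∀ l, cliqueFunctional c g l =
          cliqueFunctional c (fun v => coeffFunctional (ρ v) (h v) (k v)) l := by
        intro l
        rw [cliqueFunctional, cliqueFunctional]
        congr 2
        exact List.map_congr_left fun v hv => by rw [(hhk v hv).2]
      have h1 : (f.sum fun l r => r * cliqueFunctional c g l) =
          ⟪cliqueOp Γ hξ c h (vacuum Γ ξ), X (cliqueOp Γ hξ c k (vacuum Γ ξ))⟫_ℂ := by
        rw [hX, Finsupp.sum, Finsupp.sum, sum_apply, inner_sum]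
        refine Finset.sum_congr rfl fun l hl => ?_
        rw [hg', smul_apply, inner_smul_right, inner_cliqueOp_vacuum hξ hρ hc (hf l hl)]
      rw [h1]
      calc _ ≤ ‖cliqueOp Γ hξ c h (vacuum Γ ξ)‖ * (‖X‖ * ‖cliqueOp Γ hξ c k (vacuum Γ ξ)‖) :=
            (norm_inner_le_norm _ _).trans (by gcongr; exact X.le_opNorm _)
        _ ≤ (c.map fun v => ‖h v‖).prod * (‖X‖ * (c.map fun v => ‖k v‖).prod) := by
            gcongr
            · exact List.prod_nonneg (by simp)
            · exact norm_cliqueOp_le hξ c h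
            · exact norm_cliqueOp_le hξ c k
        _ = (c.map fun v => ‖h v‖ * ‖k v‖).prod * ‖X‖ := by
            rw [List.prod_map_mul]; ring
        _ ≤ _ := by
            gcongr
            exact List.prod_map_le_prod_map₀ _ _ (fun _ _ => by positivity) fun v hv => (hhk v hv).1
    | insert v s hvs ih =>
      intro g M hM hg hs
      by_cases hv : v ∈ c
      · let R : List (Σ v, A v) → ℂ := fun l =>
          if ∀ p ∈ l, p.1 ∈ c then ((c.erase v).map fun u => g u (coeffAt u l)).prod else 0
        have hR : ∀ (g' : A v →ₗ[ℂ] ℂ) (l : List (Σ v, A v)),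
            cliqueFunctional c (Function.update g v g') l = g' (coeffAt v l) * R l := by
          intro g' l
          simp only [cliqueFunctional, R]
          split_ifs
          · rw [← List.prod_map_erase (fun u => (Function.update g v g') u (coeffAt u l)) hv,
              Function.update_self]
            congr 2
            refine List.map_congr_left fun u hu => ?_
            rw [Function.update_of_ne (hnodup.mem_erase_iff.1 hu).1]
          · rw [mul_zero]
        -- the slice of `X` by the functionals `g u` with `u ≠ v`
        let b : A v := f.sum fun l r => (r * R l) • coeffAt v l
        have hb : ∀ g' : A v →ₗ[ℂ] ℂ,
            (f.sum fun l r => r * cliqueFunctional c (Function.update g v g') l) = g' b := by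
          intro g'
          simp only [b, Finsupp.sum, map_sum, map_smul, smul_eq_mul, hR]
          exact Finset.sum_congr rfl fun l _ => by ring
        set P := ((c.erase v).map M).prod with hP
        have hP0 : 0 ≤ P := List.prod_nonneg (by simpa using fun u _ => hM u)
        have hbn : ‖b‖ ≤ P * ‖X‖ := by
          rw [← hiso]
          refine opNorm_le_of_inner_le _ (by positivity) fun k h => ?_
          have h1 := ih (Function.update g v (coeffFunctional (ρ v) h k))
            (Function.update M v (‖h‖ * ‖k‖)) ?_ ?_ ?_
          · rw [hb, ← List.prod_map_erase _ hv, Function.update_self,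
              List.map_congr_left (g := M) fun u hu =>
                Function.update_of_ne (hnodup.mem_erase_iff.1 hu).1 _ _] at h1
            rw [coeffFunctional_apply, ← hP] at h1
            linarith [h1, mul_comm (‖h‖ * ‖k‖ * P) ‖X‖, mul_assoc (‖h‖ * ‖k‖) P ‖X‖,
              mul_comm (P * ‖X‖) (‖h‖ * ‖k‖)]
          · intro u
            by_cases hu : u = v
            · subst hu; rw [Function.update_self]; positivity
            · rw [Function.update_of_ne hu]; exact hM u
          · intro u a
            by_cases hu : u = v
            · subst hu
              rw [Function.update_self, Function.update_self]
              exact norm_coeffFunctional_le _ _ _ _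
            · rw [Function.update_of_ne hu, Function.update_of_ne hu]; exact hg u a
          · intro u huc hus
            by_cases hu : u = v
            · subst hu
              rw [Function.update_self, Function.update_self]
              exact ⟨h, k, le_rfl, rfl⟩
            · rw [Function.update_of_ne hu, Function.update_of_ne hu]
              exact hs u huc (by simp [hu, hus])
        have h2 := hb (g v)
        rw [Function.update_eq_self] at h2
        rw [h2]
        calc ‖g v b‖ ≤ M v * ‖b‖ := hg v b
          _ ≤ M v * (P * ‖X‖) := by gcongr; exact hM v
          _ = (c.map M).prod * ‖X‖ := by rw [← List.prod_map_erase M hv, hP, mul_assoc]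
      · refine ih g M hM hg fun u hu hus => hs u hu ?_
        rw [Finset.mem_insert, not_or]
        exact ⟨fun h => hv (h ▸ hu), hus⟩
  exact key c.toFinset g M hM hg fun v hv hv' => absurd (List.mem_toFinset.2 hv) hv'

end Clique

/-! ### Elementary tensors whose initial legs are orthogonal to the cyclic subspace -/

section Initial

variable {V X : Type*} {Γ : SimpleGraph V} {f : X → V}

theorem extract_eq_none_of_notMem {v : V} {l : List X} (h : v ∉ l.map f) :
    extract Γ f v l = none := by
  cases he : extract Γ f v l with
  | none => rfl
  | some a =>
    obtain ⟨p, m⟩ := a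
    exact absurd (List.mem_map.2 ⟨p, (shuffle_of_extract he).symm.perm.subset (by simp),
      label_extract he⟩) h

/-- Up to a shuffle, every list begins with a list of objects with pairwise adjacent labels that
contains all objects that can be moved to the front. -/
theorem exists_clique_prefix (z : List X) : ∃ C z' : List X, Shuffle Γ f z (C ++ z') ∧
    C.Pairwise (fun p q => Γ.Adj (f p) (f q)) ∧
      ∀ v, extract Γ f v z ≠ none → v ∈ C.map f := by
  have key : ∀ (n : ℕ) (C z' : List X), z'.length = n → Shuffle Γ f z (C ++ z') →
      C.Pairwise (fun p q => Γ.Adj (f p) (f q)) →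
      ∃ C z' : List X, Shuffle Γ f z (C ++ z') ∧
        C.Pairwise (fun p q => Γ.Adj (f p) (f q)) ∧
          ∀ v, extract Γ f v z ≠ none → v ∈ C.map f := by
    intro n
    induction n with
    | zero =>
      intro C z' hn hs hC
      rw [List.length_eq_zero_iff] at hn
      subst hn
      refine ⟨C, [], hs, hC, fun v hv => ?_⟩
      by_contra hvC
      refine hv (hs.symm.extract_eq_none ?_)
      rw [List.append_nil]
      exact extract_eq_none_of_notMem hvC
    | succ n ih =>
      intro C z' hn hs hC
      by_cases hall : ∀ v, extract Γ f v z ≠ none → v ∈ C.map f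
      · exact ⟨C, z', hs, hC, hall⟩
      · push Not at hall
        obtain ⟨v, hv, hvC⟩ := hall
        obtain ⟨⟨p, m⟩, he⟩ := Option.ne_none_iff_exists'.1 hv
        obtain ⟨m', he', -⟩ := hs.extract_eq_some he
        obtain ⟨hadj, m'', he'', -⟩ :=
          extract_append_eq_some (extract_eq_none_of_notMem hvC) he'
        have hs' := shuffle_of_extract he''
        have hp : f p = v := label_extract he''
        refine ih (C ++ [p]) m'' ?_ ?_ ?_
        · have := hs'.perm.length_eq
          rw [List.length_cons] at this
          omega
        · rw [List.append_assoc]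
          exact hs.trans (hs'.append_left C)
        · refine List.pairwise_append.2 ⟨hC, List.pairwise_singleton _ _, fun q hq r hr => ?_⟩
          rw [List.mem_singleton.1 hr, hp]
          exact hadj q hq
  exact key z.length [] z rfl (.refl _) List.Pairwise.nil

end Initial

section Perp

variable {V : Type*} {Γ : SimpleGraph V} {A : V → Type*} [∀ v, CStarAlgebra (A v)]
  [∀ v, PartialOrder (A v)] [∀ v, StarOrderedRing (A v)] {φ : ∀ v, A v →ₚ[ℂ] ℂ}
  {H : V → Type*} [∀ v, NormedAddCommGroup (H v)] [∀ v, InnerProductSpace ℂ (H v)]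
  [∀ v, CompleteSpace (H v)] {ξ : ∀ v, H v} (hξ : ∀ v, ‖ξ v‖ = 1)
  {ρ : ∀ v, A v →⋆ₐ[ℂ] (H v →L[ℂ] H v)} (hρ : ∀ v a, ⟪ξ v, ρ v a (ξ v)⟫_ℂ = φ v a)

include hρ in
/-- If all initial legs of `z` are orthogonal to the cyclic subspaces, then a reduced word cannot
annihilate any leg: it creates the legs `y₁` in front of `z`, except that some letters may modify
initial legs, and the result has the length of `z` only if all letters do so. -/
theorem exists_repTensor_vec_eq {l : List (Σ v, A v)} (hl : IsReducedTensor Γ φ l)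
    {z : List (Leg ξ)} (hz : IsReduced Γ (word z)) {c : List V}
    (hperp : ∀ v p m, extract Γ Sigma.fst v z = some (p, m) →
      v ∈ c ∧ ∀ a, ⟪ξ p.1, ρ p.1 a (p.2 : H p.1)⟫_ℂ = 0) :
    ∃ y₁ y₂ : List (Leg ξ), repTensor (fockRep Γ hξ ρ) l (vec Γ z) = vec Γ (y₁ ++ y₂) ∧
      IsReduced Γ (word (y₁ ++ y₂)) ∧ Shuffle Γ id (l.map Sigma.fst) (word y₁) ∧
      (∀ v p m, (∀ q ∈ y₁, Γ.Adj q.1 v) → extract Γ Sigma.fst v y₂ = some (p, m) →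
        v ∈ c ∧ ∀ a, ⟪ξ p.1, ρ p.1 a (p.2 : H p.1)⟫_ℂ = 0) ∧
      (z.length < (y₁ ++ y₂).length ∨ (z.length = (y₁ ++ y₂).length ∧ ∀ p ∈ l, p.1 ∈ c)) := by
  induction l with
  | nil => exact ⟨[], z, rfl, hz, .refl _, fun v p m _ => hperp v p m, Or.inr ⟨rfl, by simp⟩⟩
  | cons p l ih =>
    obtain ⟨v, a⟩ := p
    obtain ⟨y₁, y₂, he, hr, hs, hy, hlen⟩ := ih hl.of_cons
    have ha : φ v a = 0 := hl.2 ⟨v, a⟩ (by simp)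
    have hv1 : IsReduced Γ (v :: word y₁) := (Shuffle.cons v hs).isReduced hl.1
    have hv : extract Γ Sigma.fst v y₁ = none := extract_eq_none_of_isReduced hv1
    rw [repTensor_cons, mul_apply_eq_comp, he, fockRep_apply]
    change ∃ y₁' y₂', lamHom Γ hξ v (ρ v a) (vec Γ (y₁ ++ y₂)) = _ ∧ _
    cases hex : extract Γ Sigma.fst v (y₁ ++ y₂) with
    | none =>
      have hred : IsReduced Γ (v :: word (y₁ ++ y₂)) :=
        isReduced_cons_iff.2 ⟨hr, extract_map_eq_none.2 hex⟩
      rw [lamHom_vec hξ hred, prefixVec_of_state_eq_zero hξ hρ ha]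
      refine ⟨⟨v, centre (hξ v) (ρ v a (ξ v))⟩ :: y₁, y₂, rfl, hred, .cons v hs,
        fun u p m hu => hy u p m fun q hq => hu q (by simp [hq]), Or.inl ?_⟩
      rw [List.cons_append, List.length_cons]
      omega
    | some x =>
      obtain ⟨⟨u, η⟩, m⟩ := x
      obtain rfl : u = v := label_extract hex
      obtain ⟨hadj, m', hex', rfl⟩ := extract_append_eq_some hv hex
      have hs' := shuffle_of_extract hex
      have hs'' := shuffle_of_extract hex'
      have hred := hs'.isReduced_word.1 hr
      obtain ⟨huc, hη⟩ := hy u _ _ hadj hex'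
      have hη' : ⟪ξ u, ρ u a (η : H u)⟫_ℂ = 0 := hη a
      rw [hs'.vec_eq, lamHom_vec_cons hξ hred, prefixVec, hη', zero_smul, zero_add]
      refine ⟨⟨u, centre (hξ u) (ρ u a η)⟩ :: y₁, m', rfl, hred, .cons u hs, ?_, ?_⟩
      · intro w p m hw hm
        have hwu : Γ.Adj u w := hw ⟨u, centre (hξ u) (ρ u a η)⟩ (by simp)
        obtain ⟨m₂, hm₂, -⟩ := hs''.symm.extract_eq_some (v := w) (p := p) (m := ⟨u, η⟩ :: m)
          (by rw [extract_cons_adj (by exact hwu), hm]; rfl)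
        exact hy w p m₂ (fun q hq => hw q (by simp [hq])) hm₂
      · have h1 := hs'.perm.length_eq
        rw [List.cons_append, List.length_cons]
        rw [List.length_cons] at h1
        rw [h1] at hlen
        exact hlen.imp id fun h => ⟨h.1, fun q hq => by
          rcases List.mem_cons.1 hq with rfl | hq
          · exact huc
          · exact h.2 q hq⟩

theorem exists_legVector {C : List (Leg ξ)} (hC : C.Pairwise fun p q => Γ.Adj p.1 q.1) :
    ∃ e : ∀ v, H v, ∀ p ∈ C, e p.1 = p.2 := by
  classical
  induction C with
  | nil => exact ⟨0, by simp⟩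
  | cons p C ih =>
    obtain ⟨h1, h2⟩ := List.pairwise_cons.1 hC
    obtain ⟨e, he⟩ := ih h2
    refine ⟨Function.update e p.1 p.2, fun q hq => ?_⟩
    rcases List.mem_cons.1 hq with rfl | hq
    · rw [Function.update_self]
    · rw [Function.update_of_ne (h1 q hq).ne', he q hq]

theorem vec_append_eq_cliqueOp {C z : List (Leg ξ)} (h : IsReduced Γ (word (C ++ z)))
    {e : ∀ v, H v} (he : ∀ p ∈ C, e p.1 = p.2) :
    vec Γ (C ++ z) = cliqueOp Γ hξ (word C) e (vec Γ z) := by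
  induction C with
  | nil => rfl
  | cons p C ih =>
    obtain ⟨v, η⟩ := p
    have hη : e v = η := he ⟨v, η⟩ (by simp)
    have h' : IsReduced Γ (v :: word (C ++ z)) := h
    rw [word, List.map_cons, cliqueOp_cons, mul_apply_eq_comp,
      ← ih h.of_cons fun p hp => he p (by simp [hp]), hη]
    exact ((lamHom_rankOne_vec hξ h' _).trans (prefixVec_leg hξ v η _)).symm

include hρ in
/-- If all initial legs of `z` are orthogonal to the cyclic subspaces, then the vector functional
of `z` on reduced words is a multiple of a clique functional. -/
theorem exists_inner_repTensor_vec_eq {z : List (Leg ξ)} (hz : IsReduced Γ (word z))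
    (hperp : ∀ v p m, extract Γ Sigma.fst v z = some (p, m) →
      ∀ a, ⟪ξ p.1, ρ p.1 a (p.2 : H p.1)⟫_ℂ = 0) :
    ∃ (c : List V) (e : ∀ v, H v) (K : ℂ), c.Pairwise Γ.Adj ∧
      ∀ l, IsReducedTensor Γ φ l → ⟪vec Γ z, repTensor (fockRep Γ hξ ρ) l (vec Γ z)⟫_ℂ =
        K * cliqueFunctional c (fun v => coeffFunctional (ρ v) (e v) (e v)) l := by
  obtain ⟨C, z', hs, hC, hmem⟩ := exists_clique_prefix (Γ := Γ) (f := Sigma.fst) z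
  obtain ⟨e, he⟩ := exists_legVector hC
  have hr : IsReduced Γ (word (C ++ z')) := hs.isReduced_word.1 hz
  have hCw : (word C).Pairwise Γ.Adj := List.pairwise_map.2 hC
  have hfix : ∀ v ∈ word C,
      lamHom Γ hξ v (InnerProductSpace.rankOne ℂ (ξ v) (ξ v)) (vec Γ z') = vec Γ z' := by
    intro v hv
    obtain ⟨p, hp, rfl⟩ := List.mem_map.1 hv
    obtain ⟨C₁, C₂, rfl⟩ := List.append_of_mem hp
    obtain ⟨-, h2, -⟩ := List.pairwise_append.1 hC
    have h3 : IsReduced Γ (word (p :: (C₂ ++ z'))) := by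
      rw [List.append_assoc, word, List.map_append] at hr
      exact hr.of_append_right
    have h4 := extract_eq_none_of_isReduced h3
    rw [extract_append_of_adj fun q hq => ((List.pairwise_cons.1 h2).1 q hq).symm,
      Option.map_eq_none_iff] at h4
    rw [lamHom_rankOne_vec hξ, prefixVec_self]
    refine isReduced_cons_iff.2 ⟨?_, extract_map_eq_none.2 h4⟩
    have h5 := h3.of_cons
    rw [List.map_append] at h5
    exact h5.of_append_right
  refine ⟨word C, e, ⟪vec Γ z', vec Γ z'⟫_ℂ, hCw, fun l hl => ?_⟩
  by_cases hlc : ∀ p ∈ l, p.1 ∈ word C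
  · rw [hs.vec_eq, vec_append_eq_cliqueOp hξ hr he,
      inner_cliqueOp_repTensor hξ hCw hlc _ _ hfix, mul_comm]
  · rw [cliqueFunctional, if_neg hlc, mul_zero]
    obtain ⟨y₁, y₂, hy, -, -, -, hlen⟩ := exists_repTensor_vec_eq hξ hρ hl hz (c := word C)
      fun v p m h => ⟨hmem v (by simp [h]), hperp v p m h⟩
    -- a letter outside the clique creates a leg
    rw [hy]
    refine inner_vec_eq_zero_of_not_perm fun hp => ?_
    have := hp.length_eq
    rw [List.length_map, List.length_map] at this
    rcases hlen with h | h
    · omega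
    · exact hlc h.2

/-- The legs of the two kinds that suffice to generate the Fock space: those in the orbit
`ρᵥ(ker φᵥ) ξᵥ`, and those orthogonal to the cyclic subspace of `ξᵥ`. -/
def IsSplitLeg (φ : ∀ v, A v →ₚ[ℂ] ℂ) (ρ : ∀ v, A v →⋆ₐ[ℂ] (H v →L[ℂ] H v)) (p : Leg ξ) : Prop :=
  (∃ a, φ p.1 a = 0 ∧ ρ p.1 a (ξ p.1) = p.2) ∨ ∀ a, ⟪ξ p.1, ρ p.1 a (p.2 : H p.1)⟫_ℂ = 0

include hξ hρ in
/-- A continuous linear map that sends the split legs to a closed subspace sends all legs to it. -/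
theorem map_mem_of_isSplitLeg {G : Type*} [NormedAddCommGroup G] [NormedSpace ℂ G] (v : V)
    (L : H v →L[ℂ] G) (Q : Submodule ℂ G) (hQ : IsClosed (Q : Set G))
    (h : ∀ η : ((ℂ ∙ ξ v)ᗮ : Submodule ℂ (H v)), IsSplitLeg φ ρ ⟨v, η⟩ → L η ∈ Q)
    (η : ((ℂ ∙ ξ v)ᗮ : Submodule ℂ (H v))) : L η ∈ Q := by
  let orbit : A v →ₗ[ℂ] H v :=
    { toFun := fun a => ρ v a (ξ v)
      map_add' := fun a b => by rw [map_add, add_apply]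
      map_smul' := fun c a => by rw [map_smul, smul_apply]; rfl }
  let M : Submodule ℂ (H v) := (LinearMap.range orbit).topologicalClosure
  have hMc : IsClosed (M : Set (H v)) := Submodule.isClosed_topologicalClosure _
  have : CompleteSpace M := hMc.completeSpace_coe
  have horbit : ∀ a, ρ v a (ξ v) ∈ M := fun a => Submodule.le_topologicalClosure _ ⟨a, rfl⟩
  set m : H v := M.starProjection (η : H v) with hm
  have hmM : m ∈ M := Submodule.starProjection_apply_mem _ _
  have hperp : ∀ a, ⟪ξ v, ρ v a ((η : H v) - m)⟫_ℂ = 0 := by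
    intro a
    have h1 : (η : H v) - m ∈ Mᗮ := Submodule.sub_starProjection_mem_orthogonal _
    have h2 := (Submodule.mem_orthogonal _ _).1 h1 _ (horbit (star a))
    rwa [map_star, ContinuousLinearMap.star_eq_adjoint,
      ContinuousLinearMap.adjoint_inner_left] at h2
  have hξe : ⟪ξ v, (η : H v) - m⟫_ℂ = 0 := by simpa using hperp 1
  have hξm : ⟪ξ v, m⟫_ℂ = 0 := by
    rwa [inner_sub_right, inner_leg, zero_sub, neg_eq_zero] at hξe
  -- the part orthogonal to the cyclic subspace
  have he : L ((η : H v) - m) ∈ Q :=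
    h ⟨_, Submodule.mem_orthogonal_singleton_iff_inner_right.2 hξe⟩ (Or.inr hperp)
  -- the part in the cyclic subspace
  let L' : H v →L[ℂ] G := L - (innerSL ℂ (ξ v)).smulRight (L (ξ v))
  have hL' : ∀ k, L' k = L (k - ⟪ξ v, k⟫_ℂ • ξ v) := by
    intro k
    rw [map_sub, map_smul]
    rfl
  have hM : M ≤ Q.comap L'.toLinearMap := by
    refine Submodule.topologicalClosure_minimal _ ?_ (hQ.preimage L'.continuous)
    rintro _ ⟨a, rfl⟩
    change L' (ρ v a (ξ v)) ∈ Q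
    have h1 : ρ v a (ξ v) - ⟪ξ v, ρ v a (ξ v)⟫_ℂ • ξ v = ρ v (a - φ v a • 1) (ξ v) := by
      rw [hρ, map_sub, map_smul, map_one]
      rfl
    have hφ1 : φ v 1 = 1 := by
      rw [← hρ, map_one, one_apply_eq_self, inner_self_eq_norm_sq_to_K, hξ]
      simp
    have h0 : φ v (a - φ v a • 1) = 0 := by
      rw [map_sub, map_smul, hφ1, smul_eq_mul, mul_one, sub_self]
    rw [hL', h1]
    exact h ⟨_, Submodule.mem_orthogonal_singleton_iff_inner_right.2 ((hρ _ _).trans h0)⟩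
      (Or.inl ⟨_, h0, rfl⟩)
  have hm' : L m ∈ Q := by
    have := hM hmM
    change L' m ∈ Q at this
    rwa [hL', hξm, zero_smul, sub_zero] at this
  have : L (η : H v) = L m + L ((η : H v) - m) := by rw [← map_add]; congr 1; abel
  rw [this]
  exact Q.add_mem hm' he

omit [∀ v, CStarAlgebra (A v)] [∀ v, PartialOrder (A v)] [∀ v, StarOrderedRing (A v)] in
theorem norm_lamHom_rankOne_apply_le (v : V) (k : H v) (y : Fock Γ ξ) :
    ‖lamHom Γ hξ v (InnerProductSpace.rankOne ℂ k (ξ v)) y‖ ≤ ‖y‖ * ‖k‖ := by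
  set T := lamHom Γ hξ v (InnerProductSpace.rankOne ℂ k (ξ v)) with hT
  have h : ‖T‖ ≤ ‖k‖ := by
    refine (norm_lamHom_le hξ v _).trans ?_
    rw [InnerProductSpace.norm_rankOne, hξ, mul_one]
  refine (ContinuousLinearMap.le_opNorm T y).trans ?_
  rw [mul_comm]
  gcongr

include hξ hρ in
/-- Elementary tensors are approximated by elementary tensors of split legs. -/
theorem vec_mem_closure_span_isSplitLeg {x : List (Leg ξ)} (hx : IsReduced Γ (word x)) :
    vec Γ x ∈ (Submodule.span ℂ {y | ∃ x' : List (Leg ξ), word x' = word x ∧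
      (∀ p ∈ x', IsSplitLeg φ ρ p) ∧ y = vec Γ x'}).topologicalClosure := by
  induction x with
  | nil => exact Submodule.le_topologicalClosure _ (Submodule.subset_span ⟨[], rfl, by simp, rfl⟩)
  | cons p x ih =>
    obtain ⟨v, η⟩ := p
    set Q := (Submodule.span ℂ {y | ∃ x' : List (Leg ξ), word x' = word (⟨v, η⟩ :: x) ∧
      (∀ p ∈ x', IsSplitLeg φ ρ p) ∧ y = vec Γ x'}).topologicalClosure with hQ
    have hQc : IsClosed (Q : Set (Fock Γ ξ)) := Submodule.isClosed_topologicalClosure _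
    -- creation of the leg `k` in front of `x`, as a function of `k`
    let L : H v →L[ℂ] Fock Γ ξ := LinearMap.mkContinuous
      { toFun := fun k => lamHom Γ hξ v (InnerProductSpace.rankOne ℂ k (ξ v)) (vec Γ x)
        map_add' := fun k k' => by rw [map_add, add_apply, map_add, add_apply]
        map_smul' := fun c k => by
          rw [map_smul, smul_apply, map_smul, smul_apply]; rfl } ‖vec Γ x‖ fun k =>
        norm_lamHom_rankOne_apply_le hξ v k (vec Γ x)
    have hL : ∀ k, L k = lamHom Γ hξ v (InnerProductSpace.rankOne ℂ k (ξ v)) (vec Γ x) :=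
      fun k => rfl
    have hcreate : ∀ (ζ : ((ℂ ∙ ξ v)ᗮ : Submodule ℂ (H v))) (x' : List (Leg ξ)),
        word x' = word x →
        lamHom Γ hξ v (InnerProductSpace.rankOne ℂ (ζ : H v) (ξ v)) (vec Γ x') =
          vec Γ (⟨v, ζ⟩ :: x') := by
      intro ζ x' hx'
      rw [lamHom_rankOne_vec hξ, prefixVec_leg]
      rw [hx']
      exact hx
    rw [← hcreate η x rfl, ← hL]
    refine map_mem_of_isSplitLeg hξ hρ v L Q hQc (fun ζ hζ => ?_) η
    rw [hL]
    set T := lamHom Γ hξ v (InnerProductSpace.rankOne ℂ (ζ : H v) (ξ v))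
    have hle : (Submodule.span ℂ {y | ∃ x' : List (Leg ξ), word x' = word x ∧
        (∀ p ∈ x', IsSplitLeg φ ρ p) ∧ y = vec Γ x'}).topologicalClosure ≤
          Q.comap T.toLinearMap := by
      refine Submodule.topologicalClosure_minimal _ (Submodule.span_le.2 ?_)
        (hQc.preimage T.continuous)
      rintro _ ⟨x', hx', hsplit, rfl⟩
      change T (vec Γ x') ∈ Q
      rw [hcreate ζ x' hx']
      refine Submodule.le_topologicalClosure _ (Submodule.subset_span
        ⟨_, by rw [word, List.map_cons, ← word, hx']; rfl, fun p hp => ?_, rfl⟩)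
      rcases List.mem_cons.1 hp with rfl | hp
      · exact hζ
      · exact hsplit p hp
    exact hle (ih hx.of_cons)

end Perp

/-! ### Comparison of the norms of two representations -/

section Dominated

variable {D G : Type*} [CStarAlgebra D] [NormedAddCommGroup G] [InnerProductSpace ℂ G]
  [CompleteSpace G] (P : StarSubalgebra ℂ (D × (G →L[ℂ] G)))

theorem norm_sq_eq_inner_star_mul (T : G →L[ℂ] G) (η : G) :
    ((‖T η‖ ^ 2 : ℝ) : ℂ) = ⟪η, (star T * T) η⟫_ℂ := by
  rw [mul_apply_eq_comp, ContinuousLinearMap.star_eq_adjoint,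
    ContinuousLinearMap.adjoint_inner_right, inner_self_eq_norm_sq_to_K]
  simp

/-- Any bound for the orbit of `η` under the second coordinates in terms of the norms of the first
coordinates can be improved to the bound with constant `‖η‖`: if `C` is admissible then so is the
square root of `‖η‖ C`, because `‖T η‖² = ⟪η, T* T η⟫`. -/
theorem norm_apply_le_of_exists_bound {η : G} {C : ℝ} (h : ∀ X ∈ P, ‖X.2 η‖ ≤ C * ‖X.1‖)
    {X : D × (G →L[ℂ] G)} (hX : X ∈ P) : ‖X.2 η‖ ≤ ‖η‖ * ‖X.1‖ := by
  let S : Set ℝ := {C | 0 ≤ C ∧ ∀ X ∈ P, ‖X.2 η‖ ≤ C * ‖X.1‖}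
  have hne : S.Nonempty := ⟨|C|, abs_nonneg _, fun X hX => (h X hX).trans (by
    gcongr; exact le_abs_self C)⟩
  have hbdd : BddBelow S := ⟨0, fun C hC => hC.1⟩
  have hclosed : IsClosed S := by
    have hS : S = Set.Ici 0 ∩ ⋂ X ∈ P, {C | ‖X.2 η‖ ≤ C * ‖X.1‖} := by
      ext C
      simp only [Set.mem_inter_iff, Set.mem_iInter, Set.mem_Ici]
      rfl
    rw [hS]
    exact isClosed_Ici.inter (isClosed_biInter fun X _ =>
      isClosed_le continuous_const (by fun_prop))
  have hroot : ∀ C ∈ S, √(‖η‖ * C) ∈ S := by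
    rintro C ⟨hC, hCb⟩
    refine ⟨Real.sqrt_nonneg _, fun X hX => ?_⟩
    have h1 : ‖X.2 η‖ ^ 2 ≤ ‖η‖ * C * ‖X.1‖ ^ 2 := by
      have h2 := norm_sq_eq_inner_star_mul X.2 η
      have h3 : ‖X.2 η‖ ^ 2 = ‖⟪η, (star X.2 * X.2) η⟫_ℂ‖ := by
        rw [← h2, Complex.norm_real, Real.norm_of_nonneg (sq_nonneg _)]
      rw [h3]
      calc ‖⟪η, (star X.2 * X.2) η⟫_ℂ‖ ≤ ‖η‖ * ‖(star X.2 * X.2) η‖ := norm_inner_le_norm _ _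
        _ ≤ ‖η‖ * (C * ‖star X.1 * X.1‖) := by
          gcongr
          exact hCb (star X * X) (mul_mem (star_mem hX) hX)
        _ = ‖η‖ * C * ‖X.1‖ ^ 2 := by rw [CStarRing.norm_star_mul_self]; ring
    have h4 := Real.sqrt_le_sqrt h1
    rwa [Real.sqrt_sq (norm_nonneg _), Real.sqrt_mul (by positivity),
      Real.sqrt_sq (norm_nonneg _)] at h4
  obtain ⟨hc0, hc⟩ := hclosed.csInf_mem hne hbdd
  set c := sInf S
  have hcη : c ≤ ‖η‖ := by
    have h1 : c ≤ √(‖η‖ * c) := csInf_le hbdd (hroot c ⟨hc0, hc⟩)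
    have h2 : c ^ 2 ≤ ‖η‖ * c := by
      rw [← Real.sq_sqrt (show 0 ≤ ‖η‖ * c by positivity)]
      gcongr
    by_contra hlt
    have hlt := not_le.1 hlt
    nlinarith [norm_nonneg η]
  exact (hc X hX).trans (by gcongr)

/-- The vectors whose orbit under the second coordinates of `P` is controlled by the norms of the
first coordinates. -/
def dominated : Submodule ℂ G where
  carrier := {η | ∀ X ∈ P, ‖X.2 η‖ ≤ ‖η‖ * ‖X.1‖}
  zero_mem' X _ := by simp
  add_mem' {η ζ} hη hζ X hX := by
    refine norm_apply_le_of_exists_bound P (C := ‖η‖ + ‖ζ‖) (fun X hX => ?_) hX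
    rw [map_add, add_mul]
    exact (norm_add_le _ _).trans (add_le_add (hη X hX) (hζ X hX))
  smul_mem' c η hη X hX := by
    rw [map_smul, norm_smul, norm_smul, mul_assoc]
    exact mul_le_mul_of_nonneg_left (hη X hX) (norm_nonneg _)

variable {P}

theorem mem_dominated_of_bound {η : G} {C : ℝ} (h : ∀ X ∈ P, ‖X.2 η‖ ≤ C * ‖X.1‖) :
    η ∈ dominated P := fun _ hX => norm_apply_le_of_exists_bound P h hX

variable (P) in
theorem isClosed_dominated : IsClosed (dominated P : Set G) := by
  have : (dominated P : Set G) = ⋂ X ∈ P, {η | ‖X.2 η‖ ≤ ‖η‖ * ‖X.1‖} := by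
    ext η
    simp only [Set.mem_iInter, Set.mem_ofPred_eq]
    rfl
  rw [this]
  exact isClosed_biInter fun X _ => isClosed_le (by fun_prop) (by fun_prop)

theorem apply_mem_dominated {η : G} (hη : η ∈ dominated P) {Y : D × (G →L[ℂ] G)} (hY : Y ∈ P) :
    Y.2 η ∈ dominated P := by
  refine mem_dominated_of_bound (C := ‖η‖ * ‖Y.1‖) fun X hX => ?_
  calc ‖X.2 (Y.2 η)‖ ≤ ‖η‖ * ‖X.1 * Y.1‖ := hη (X * Y) (mul_mem hX hY)
    _ ≤ ‖η‖ * (‖X.1‖ * ‖Y.1‖) := by gcongr; exact norm_mul_le _ _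
    _ = ‖η‖ * ‖Y.1‖ * ‖X.1‖ := by ring

theorem norm_snd_le_of_dominated_eq_top (h : dominated P = ⊤) {X : D × (G →L[ℂ] G)}
    (hX : X ∈ P) : ‖X.2‖ ≤ ‖X.1‖ :=
  ContinuousLinearMap.opNorm_le_bound _ (norm_nonneg _) fun η => by
    rw [mul_comm]
    exact (h ▸ Submodule.mem_top : η ∈ dominated P) X hX

end Dominated

section RepTensor

variable {V : Type*} {Γ : SimpleGraph V} {A : V → Type*} [∀ v, CStarAlgebra (A v)]
  [∀ v, PartialOrder (A v)] [∀ v, StarOrderedRing (A v)] {φ : ∀ v, A v →ₚ[ℂ] ℂ}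
  {D D' : Type*} [Ring D] [StarRing D] [Algebra ℂ D] [Ring D'] [StarRing D'] [Algebra ℂ D']

theorem map_repTensor (F : D →⋆ₐ[ℂ] D') (j : ∀ v, A v →⋆ₐ[ℂ] D) (l : List (Σ v, A v)) :
    F (repTensor j l) = repTensor (fun v => F.comp (j v)) l := by
  rw [repTensor, map_list_prod, List.map_map]
  rfl

theorem exists_finsupp_of_mem_reducedSpan {j : ∀ v, A v →⋆ₐ[ℂ] D} {X : D}
    (hX : X ∈ reducedSpan Γ φ j) : ∃ f : List (Σ v, A v) →₀ ℂ,
      (∀ l ∈ f.support, IsReducedTensor Γ φ l) ∧ X = f.sum fun l r => r • repTensor j l := by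
  have h : {T | ∃ l, IsReducedTensor Γ φ l ∧ T = repTensor j l} =
      repTensor j '' {l | IsReducedTensor Γ φ l} := by
    ext T
    simp only [Set.mem_ofPred_eq, Set.mem_image, eq_comm]
  rw [reducedSpan, h, Finsupp.mem_span_image_iff_linearCombination] at hX
  obtain ⟨f, hf, rfl⟩ := hX
  exact ⟨f, fun l hl => hf hl, rfl⟩

end RepTensor

section Comparison

variable {V : Type*} (Γ : SimpleGraph V) {A : V → Type*} [∀ v, CStarAlgebra (A v)]
  [∀ v, PartialOrder (A v)] [∀ v, StarOrderedRing (A v)] {φ : ∀ v, A v →ₚ[ℂ] ℂ}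
  {H : V → Type*} [∀ v, NormedAddCommGroup (H v)] [∀ v, InnerProductSpace ℂ (H v)]
  [∀ v, CompleteSpace (H v)] {ξ : ∀ v, H v} (hξ : ∀ v, ‖ξ v‖ = 1)
  (ρ : ∀ v, A v →⋆ₐ[ℂ] (H v →L[ℂ] H v)) (hρ : ∀ v a, ⟪ξ v, ρ v a (ξ v)⟫_ℂ = φ v a)
  {E : V → Type*} [∀ v, NormedAddCommGroup (E v)] [∀ v, InnerProductSpace ℂ (E v)]
  [∀ v, CompleteSpace (E v)] {ζ : ∀ v, E v} (hζ : ∀ v, ‖ζ v‖ = 1)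
  (σ : ∀ v, A v →⋆ₐ[ℂ] (E v →L[ℂ] E v)) (hσ : ∀ v a, ⟪ζ v, σ v a (ζ v)⟫_ℂ = φ v a)

/-- The pair of the representations on two Fock spaces. -/
def pairRep (v : V) :
    A v →⋆ₐ[ℂ] (Fock Γ ξ →L[ℂ] Fock Γ ξ) × (Fock Γ ζ →L[ℂ] Fock Γ ζ) :=
  (fockRep Γ hξ ρ v).prod (fockRep Γ hζ σ v)

theorem fst_repTensor_pairRep (l : List (Σ v, A v)) :
    (repTensor (pairRep Γ hξ ρ hζ σ) l).1 = repTensor (fockRep Γ hξ ρ) l :=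
  map_repTensor (StarAlgHom.fst ℂ _ _) (pairRep Γ hξ ρ hζ σ) l

theorem snd_repTensor_pairRep (l : List (Σ v, A v)) :
    (repTensor (pairRep Γ hξ ρ hζ σ) l).2 = repTensor (fockRep Γ hζ σ) l :=
  map_repTensor (StarAlgHom.snd ℂ _ _) (pairRep Γ hξ ρ hζ σ) l

theorem pairRep_commute (u v : V) (h : Γ.Adj u v) (a : A u) (b : A v) :
    Commute (pairRep Γ hξ ρ hζ σ u a) (pairRep Γ hξ ρ hζ σ v b) :=
  Prod.ext (fockRep_commute hξ ρ u v h a b) (fockRep_commute hζ σ u v h a b)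

/-- The algebra spanned by the reduced words in the pair of representations. -/
def pairAlgebra (hφ : ∀ v, φ v 1 = 1) :
    StarSubalgebra ℂ ((Fock Γ ξ →L[ℂ] Fock Γ ξ) × (Fock Γ ζ →L[ℂ] Fock Γ ζ)) :=
  reducedAlgebra (φ := φ) Γ (pairRep Γ hξ ρ hζ σ) hφ (pairRep_commute Γ hξ ρ hζ σ)

variable {Γ ρ σ} (hφ : ∀ v, φ v 1 = 1)

theorem pairRep_mem (v : V) (a : A v) :
    pairRep Γ hξ ρ hζ σ v a ∈ pairAlgebra Γ hξ ρ hζ σ hφ := by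
  have h := mul_mem_reducedSpan (Γ := Γ) hφ (pairRep_commute Γ hξ ρ hζ σ) v a
    (one_mem (pairAlgebra Γ hξ ρ hζ σ hφ))
  rwa [mul_one] at h

include hρ hσ in
/-- Elementary tensors of split legs are dominated. Initial legs in the orbits are stripped one after
the other, since the dominated vectors are invariant under the algebra. Once all initial legs are
orthogonal to the cyclic subspaces, the vector functional is a clique functional, which is bounded
in the norm of the first representation. -/
theorem vec_mem_dominated (hiso : ∀ v a, ‖ρ v a‖ = ‖a‖) (z : List (Leg ζ))
    (hz : IsReduced Γ (word z)) (hsplit : ∀ p ∈ z, IsSplitLeg φ σ p) :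
    vec Γ z ∈ dominated (pairAlgebra Γ hξ ρ hζ σ hφ) := by
  by_cases horbit : ∃ v p m, extract Γ Sigma.fst v z = some (p, m) ∧
      ∃ a, φ p.1 a = 0 ∧ σ p.1 a (ζ p.1) = p.2
  · -- an initial leg in the orbit is created by an element of the algebra
    obtain ⟨v, ⟨u, η⟩, m, he, a, ha, hη⟩ := horbit
    have hs := shuffle_of_extract he
    have hr := hs.isReduced_word.1 hz
    have hlen : m.length < z.length := by
      have := hs.perm.length_eq
      rw [List.length_cons] at this
      omega
    have hm := vec_mem_dominated hiso m hr.of_cons fun p hp =>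
      hsplit p (hs.symm.perm.subset (List.mem_cons_of_mem _ hp))
    have h1 : vec Γ z = (pairRep Γ hξ ρ hζ σ u a).2 (vec Γ m) := by
      change _ = lamHom Γ hζ u (σ u a) (vec Γ m)
      rw [lamHom_vec hζ hr, hs.vec_eq]
      change σ u a (ζ u) = η at hη
      rw [hη, prefixVec_leg]
    rw [h1]
    exact apply_mem_dominated hm (pairRep_mem hξ hζ hφ u a)
  · -- otherwise the vector functional is a clique functional
    obtain ⟨c, e, K, hc, hcK⟩ := exists_inner_repTensor_vec_eq hζ hσ hz fun v p m he => by
      rcases hsplit p ((shuffle_of_extract he).symm.perm.subset (by simp)) with h | h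
      · exact absurd ⟨v, p, m, he, h⟩ horbit
      · exact h
    set B : ℝ := ‖K‖ * (c.map fun v => ‖e v‖ * ‖e v‖).prod with hB
    refine mem_dominated_of_bound (C := √B) fun X hX => ?_
    have hXX : star X * X ∈ pairAlgebra Γ hξ ρ hζ σ hφ := mul_mem (star_mem hX) hX
    obtain ⟨f, hf, hfX⟩ := exists_finsupp_of_mem_reducedSpan (Γ := Γ) (φ := φ)
      (j := pairRep Γ hξ ρ hζ σ) hXX
    have h1 : star X.1 * X.1 = f.sum fun l r => r • repTensor (fockRep Γ hξ ρ) l := by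
      have := congrArg Prod.fst hfX
      rw [Finsupp.sum, Prod.fst_sum] at this
      simp only [Prod.smul_fst, fst_repTensor_pairRep] at this
      exact this
    have h2 : star X.2 * X.2 = f.sum fun l r => r • repTensor (fockRep Γ hζ σ) l := by
      have := congrArg Prod.snd hfX
      rw [Finsupp.sum, Prod.snd_sum] at this
      simp only [Prod.smul_snd, snd_repTensor_pairRep] at this
      exact this
    have h3 : ⟪vec Γ z, (star X.2 * X.2) (vec Γ z)⟫_ℂ =
        K * f.sum fun l r => r * cliqueFunctional c
          (fun v => coeffFunctional (σ v) (e v) (e v)) l := by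
      rw [h2, Finsupp.sum, sum_apply, inner_sum, Finsupp.sum, Finset.mul_sum]
      refine Finset.sum_congr rfl fun l hl => ?_
      rw [smul_apply, inner_smul_right, hcK l (hf l hl)]
      ring
    have h4 : ‖X.2 (vec Γ z)‖ ^ 2 ≤ B * ‖X.1‖ ^ 2 := by
      have h5 : ‖X.2 (vec Γ z)‖ ^ 2 = ‖⟪vec Γ z, (star X.2 * X.2) (vec Γ z)⟫_ℂ‖ := by
        rw [← norm_sq_eq_inner_star_mul, Complex.norm_real, Real.norm_of_nonneg (sq_nonneg _)]
      rw [h5, h3, norm_mul, hB, mul_assoc]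
      gcongr
      rw [sq, ← CStarRing.norm_star_mul_self (x := X.1), h1]
      exact norm_sum_cliqueFunctional_le hξ hρ hiso hc f hf _ _ (fun v => by positivity)
        fun v a => norm_coeffFunctional_le (σ v) (e v) (e v) a
    have h6 := Real.sqrt_le_sqrt h4
    have hB0 : 0 ≤ B := mul_nonneg (norm_nonneg _) (List.prod_nonneg fun x hx => by
      obtain ⟨v, -, rfl⟩ := List.mem_map.1 hx
      positivity)
    rwa [Real.sqrt_sq (norm_nonneg _), Real.sqrt_mul hB0, Real.sqrt_sq (norm_nonneg _)] at h6
termination_by z.length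

include hρ hσ in
/-- The representation on the Fock space of the faithful representations `ρᵥ` dominates the
representation on the Fock space of any representations `σᵥ` with the same states. -/
theorem norm_snd_le_norm_fst (hiso : ∀ v a, ‖ρ v a‖ = ‖a‖)
    {X : (Fock Γ ξ →L[ℂ] Fock Γ ξ) × (Fock Γ ζ →L[ℂ] Fock Γ ζ)}
    (hX : X ∈ pairAlgebra Γ hξ ρ hζ σ hφ) : ‖X.2‖ ≤ ‖X.1‖ := by
  refine norm_snd_le_of_dominated_eq_top (top_le_iff.1 ?_) hX
  have hclosed := isClosed_dominated (pairAlgebra Γ hξ ρ hζ σ hφ)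
  rw [← vec_total (Γ := Γ) (ξ := ζ)]
  refine Submodule.topologicalClosure_minimal _ (Submodule.span_le.2 ?_) hclosed
  rintro _ ⟨x, rfl⟩
  by_cases hx : IsReduced Γ (word x)
  · refine Submodule.topologicalClosure_minimal _ (Submodule.span_le.2 ?_) hclosed
      (vec_mem_closure_span_isSplitLeg hζ hσ hx)
    rintro _ ⟨x', hw, hsplit, rfl⟩
    exact vec_mem_dominated hξ hρ hζ hσ hφ hiso x' (hw ▸ hx) hsplit
  · change vec Γ x ∈ dominated _
    rw [vec_of_not_isReduced hx]
    exact Submodule.zero_mem _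

end Comparison

/-! ### Representations of the reduced graph product -/

section Extension

variable {D D' : Type*} [CStarAlgebra D] [CStarAlgebra D']

/-- If the second coordinates of the elements of a star subalgebra of `D × D'` are dominated in
norm by the first coordinates, then the subalgebra is contained in the graph of a homomorphism
that is defined on the closure of the set of first coordinates. -/
theorem exists_starAlgHom_of_norm_snd_le (P : StarSubalgebra ℂ (D × D'))
    (hP : ∀ X ∈ P, ‖X.2‖ ≤ ‖X.1‖) (S : StarSubalgebra ℂ D)
    (hS : (S : Set D) ⊆ closure (Prod.fst '' (P : Set (D × D')))) :
    ∃ F : S →⋆ₐ[ℂ] D', ∀ X ∈ P, ∀ hX : X.1 ∈ S, F ⟨X.1, hX⟩ = X.2 := by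
  set Q := P.topologicalClosure with hQ
  have hPQ : P ≤ Q := P.le_topologicalClosure
  have hQn : ∀ X ∈ Q, ‖X.2‖ ≤ ‖X.1‖ := fun X hX =>
    closure_minimal (t := {X : D × D' | ‖X.2‖ ≤ ‖X.1‖}) hP
      (isClosed_le (by fun_prop) (by fun_prop)) hX
  have huniq : ∀ x y y', (x, y) ∈ Q → (x, y') ∈ Q → y = y' := by
    intro x y y' h h'
    have h1 := hQn _ (sub_mem h h')
    simpa [sub_eq_zero] using h1
  -- the first coordinate is isometric on the complete space `Q`, so its range is closed
  have hclosed : IsClosed (Prod.fst '' (Q : Set (D × D'))) := by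
    have hc : IsClosed (Q : Set (D × D')) := P.isClosed_topologicalClosure
    have : CompleteSpace Q := hc.completeSpace_coe
    have hiso : Isometry fun X : Q => (X : D × D').1 := by
      refine Isometry.of_dist_eq fun X Y => ?_
      have h1 := hQn _ (sub_mem X.2 Y.2)
      rw [Subtype.dist_eq, dist_eq_norm, dist_eq_norm, Prod.norm_def]
      exact (max_eq_left h1).symm
    have := hiso.isClosedEmbedding.isClosed_range
    rwa [show (Set.range fun X : Q => (X : D × D').1) = Prod.fst '' (Q : Set (D × D')) by
      ext x; simp] at this
  have hex : ∀ x : S, ∃ y, ((x : D), y) ∈ Q := by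
    intro x
    obtain ⟨X, hX, hx⟩ := closure_minimal (Set.image_mono hPQ) hclosed (hS x.2)
    exact ⟨X.2, by rw [← hx]; exact hX⟩
  choose F hF using hex
  refine ⟨{ toFun := F
            map_one' := huniq _ _ _ (hF 1) (one_mem Q)
            map_mul' := fun x y => huniq _ _ _ (hF (x * y)) (mul_mem (hF x) (hF y))
            map_zero' := huniq _ _ _ (hF 0) (zero_mem Q)
            map_add' := fun x y => huniq _ _ _ (hF (x + y)) (add_mem (hF x) (hF y))
            commutes' := fun c => huniq _ _ _ (hF (algebraMap ℂ S c)) (algebraMap_mem Q c)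
            map_star' := fun x => huniq _ _ _ (hF (star x)) (star_mem (hF x)) },
    fun X hX hXS => huniq _ _ _ (hF ⟨X.1, hXS⟩) (hPQ hX)⟩

end Extension

section GNS

variable {V : Type*} (Γ : SimpleGraph V) {A : V → Type*} [∀ v, CStarAlgebra (A v)]
  [∀ v, PartialOrder (A v)] [∀ v, StarOrderedRing (A v)] {φ : ∀ v, A v →ₚ[ℂ] ℂ}

theorem inner_gnsVector (v : V) (a : A v) :
    ⟪gnsVector φ v, (φ v).gnsStarAlgHom a (gnsVector φ v)⟫_ℂ = φ v a := by
  have h : (φ v).gnsStarAlgHom a (gnsVector φ v) = ((φ v).toPreGNS a : (φ v).GNS) := by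
    have h1 := (φ v).gnsNonUnitalStarAlgHom_apply_coe (a := a) (b := (φ v).toPreGNS 1)
    rw [PositiveLinearMap.leftMulMapPreGNS_apply, PositiveLinearMap.ofPreGNS_toPreGNS,
      mul_one] at h1
    exact h1
  rw [h, gnsVector, UniformSpace.Completion.inner_coe, PositiveLinearMap.preGNS_inner_def,
    PositiveLinearMap.ofPreGNS_toPreGNS, PositiveLinearMap.ofPreGNS_toPreGNS, star_one, one_mul]

variable (hφ : ∀ v, φ v 1 = 1) (hfaithful : ∀ v, GNSFaithful (φ v))
  {E : V → Type*} [∀ v, NormedAddCommGroup (E v)] [∀ v, InnerProductSpace ℂ (E v)]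
  [∀ v, CompleteSpace (E v)] {ζ : ∀ v, E v} (hζ : ∀ v, ‖ζ v‖ = 1)
  {σ : ∀ v, A v →⋆ₐ[ℂ] (E v →L[ℂ] E v)} (hσ : ∀ v a, ⟪ζ v, σ v a (ζ v)⟫_ℂ = φ v a)

include hfaithful hσ in
/-- The universal property of the reduced graph product: representations `σᵥ` with vectors that
induce the states `φᵥ` yield a representation of the reduced graph product on their Fock space. -/
theorem exists_fockRep :
    ∃ F : ReducedGraphProduct Γ hφ →⋆ₐ[ℂ] (Fock Γ ζ →L[ℂ] Fock Γ ζ),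
      ∀ l hl, F (tensorElem Γ hφ l hl) = repTensor (fockRep Γ hζ σ) l := by
  set hξ := norm_gnsVector φ hφ
  set ρ := fun v => (φ v).gnsStarAlgHom
  have hiso : ∀ v a, ‖ρ v a‖ = ‖a‖ := fun v a => NonUnitalStarAlgHom.norm_map _ (hfaithful v) a
  have hmem : ∀ l, IsReducedTensor Γ φ l →
      repTensor (pairRep Γ hξ ρ hζ σ) l ∈ pairAlgebra Γ hξ ρ hζ σ hφ := fun l hl =>
    repTensor_mem (φ := φ) (j := pairRep Γ hξ ρ hζ σ) hl
  obtain ⟨F, hF⟩ := exists_starAlgHom_of_norm_snd_le (pairAlgebra Γ hξ ρ hζ σ hφ)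
    (fun X hX => norm_snd_le_norm_fst hξ inner_gnsVector hζ hσ hφ hiso hX)
    (graphProductSubalgebra Γ hφ) (by
      rw [graphProductSubalgebra_eq_closure]
      refine closure_mono ?_
      have hle : algebraicGraphProduct Γ hφ ≤
          (reducedSpan Γ φ (pairRep Γ hξ ρ hζ σ)).map (LinearMap.fst ℂ _ _) := by
        refine Submodule.span_le.2 ?_
        rintro _ ⟨l, hl, rfl⟩
        exact ⟨_, hmem l hl, fst_repTensor_pairRep Γ hξ ρ hζ σ l⟩
      exact hle)
  refine ⟨F, fun l hl => ?_⟩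
  have h1 := fst_repTensor_pairRep Γ hξ ρ hζ σ l
  have h2 : (repTensor (pairRep Γ hξ ρ hζ σ) l).1 ∈ graphProductSubalgebra Γ hφ := by
    rw [h1]
    exact (tensorElem Γ hφ l hl).2
  rw [← snd_repTensor_pairRep Γ hξ ρ hζ σ l, ← hF _ (hmem l hl) h2]
  congr 1
  exact Subtype.ext h1.symm

end GNS

/-! ### Positive matrices over a C*-algebra -/

section Matrices

theorem exists_eq_star_mul_self {D : Type*} [NonUnitalCStarAlgebra D] [PartialOrder D]
    [StarOrderedRing D] {x : D} (h : 0 ≤ x) : ∃ s, x = star s * s :=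
  CStarAlgebra.nonneg_iff_eq_star_mul_self.1 h

/-- The hypothesis is applied to `star s * s = x⁻`, for which `x⁻ x x⁻ = -x⁻ x⁻ x⁻`. -/
theorem nonneg_of_negPart {D : Type*} [NonUnitalCStarAlgebra D] [PartialOrder D]
    [StarOrderedRing D] {x : D} (hx : IsSelfAdjoint x)
    (h : ∀ s, star s * s * x * (star s * s) = -(star s * s * (star s * s) * (star s * s)) →
      s = 0) : 0 ≤ x := by
  have h5 : x⁺ - x⁻ = x := CFC.posPart_sub_negPart x
  have h6 : x⁻ * x⁺ = 0 := CFC.negPart_mul_posPart x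
  obtain ⟨s, hs⟩ := exists_eq_star_mul_self (CFC.negPart_nonneg x)
  have h7 : x⁻ * x * x⁻ = -(x⁻ * x⁻ * x⁻) := by
    have : x⁻ * (x⁺ - x⁻) * x⁻ = -(x⁻ * x⁻ * x⁻) := by rw [mul_sub, h6, zero_sub, neg_mul]
    rwa [h5] at this
  rw [hs] at h7
  rw [h s h7, mul_zero] at hs
  rw [← h5, hs, sub_zero]
  exact CFC.posPart_nonneg x

variable {B : Type*} [CStarAlgebra B] [PartialOrder B] [StarOrderedRing B] {n : Type*} [Fintype n]

/-- A self-adjoint matrix over a C*-algebra is positive if its quadratic form is. -/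
theorem cstarMatrix_nonneg {M : CStarMatrix n n B} (hM : IsSelfAdjoint M)
    (h : ∀ w : n → B, 0 ≤ ∑ i, ∑ j, star (w i) * M i j * w j) : 0 ≤ M := by
  -- the columns of `Q = M⁻` are test vectors for the quadratic form of `M`, and force `Q ^ 3 = 0`
  refine nonneg_of_negPart hM fun s hs => ?_
  set Q := star s * s with hQ
  have hQs : star Q = Q := by rw [hQ, star_mul, star_star]
  have hT : s * Q = 0 := by
    have h1 : ∀ i, ∑ k, star ((s * Q) k i) * (s * Q) k i = 0 := by
      intro i
      have h2 : star (s * Q) * (s * Q) = -(Q * M * Q) := by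
        rw [hs, neg_neg, star_mul, hQs, hQ]
        simp only [mul_assoc]
      have h3 := congrFun (congrFun h2 i) i
      have h4 : (star (s * Q) * (s * Q)) i i = ∑ k, star ((s * Q) k i) * (s * Q) k i := by
        rw [CStarMatrix.mul_apply]
        rfl
      have h5 : (Q * M * Q) i i = ∑ k, ∑ l, star (Q k i) * M k l * Q l i := by
        have hQik : ∀ k, Q i k = star (Q k i) := fun k => by
          conv_lhs => rw [← hQs]
          rfl
        rw [CStarMatrix.mul_apply, Finset.sum_comm]
        refine Finset.sum_congr rfl fun l _ => ?_
        rw [CStarMatrix.mul_apply, Finset.sum_mul]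
        exact Finset.sum_congr rfl fun k _ => by rw [hQik]
      rw [← h4]
      refine le_antisymm ?_ ?_
      · rw [h3, CStarMatrix.neg_apply, h5]
        exact neg_nonpos.2 (h fun k => Q k i)
      · rw [h4]
        exact Finset.sum_nonneg fun k _ => star_mul_self_nonneg _
    ext k i
    have h2 := (Finset.sum_eq_zero_iff_of_nonneg fun k _ => star_mul_self_nonneg _).1 (h1 i) k
      (Finset.mem_univ k)
    exact CStarRing.star_mul_self_eq_zero_iff _ |>.1 h2
  have hQ2 : star Q * Q = 0 := by
    rw [hQs]
    nth_rewrite 1 [hQ]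
    rw [mul_assoc, hT, mul_zero]
  exact (CStarRing.star_mul_self_eq_zero_iff s).1 ((CStarRing.star_mul_self_eq_zero_iff Q).1 hQ2)

end Matrices

/-! ### Compressions of representations -/

section Compression

variable {D : Type*} [CStarAlgebra D] [PartialOrder D] [StarOrderedRing D]
  {F G : Type*} [NormedAddCommGroup F] [InnerProductSpace ℂ F] [CompleteSpace F]
  [NormedAddCommGroup G] [InnerProductSpace ℂ G] [CompleteSpace G]

open ContinuousLinearMap in
/-- The compression `x ↦ W* σ(x) W` of a representation is completely positive. -/
def compressionCP (σ : D →⋆ₐ[ℂ] (G →L[ℂ] G)) (W : F →L[ℂ] G)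
    (S : StarSubalgebra ℂ (F →L[ℂ] F)) [IsClosed (S : Set (F →L[ℂ] F))]
    (hS : ∀ x, adjoint W ∘L σ x ∘L W ∈ S) : D →CP S where
  toFun x := ⟨adjoint W ∘L σ x ∘L W, hS x⟩
  map_add' x y := Subtype.ext (by simp)
  map_smul' c x := Subtype.ext (by simp)
  map_cstarMatrix_nonneg' k M hM := by
    obtain ⟨N, rfl⟩ := exists_eq_star_mul_self hM
    set Θ : D → S := fun x => ⟨adjoint W ∘L σ x ∘L W, hS x⟩ with hΘ
    change 0 ≤ (star N * N).map Θ
    have hΘstar : ∀ x, star (Θ x) = Θ (star x) := fun x => Subtype.ext (by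
      change star (adjoint W ∘L σ x ∘L W) = adjoint W ∘L σ (star x) ∘L W
      rw [map_star, star_eq_adjoint, star_eq_adjoint, adjoint_comp, adjoint_comp, adjoint_adjoint,
        comp_assoc])
    refine cstarMatrix_nonneg (CStarMatrix.ext fun i j => ?_) fun w => ?_
    · change star (Θ ((star N * N) j i)) = Θ ((star N * N) i j)
      rw [hΘstar]
      congr 1
      have h : star (star N * N) = star N * N := by rw [star_mul, star_star]
      exact congrFun (congrFun h i) j
    · let T : Fin k → F →L[ℂ] G := fun k => ∑ i, σ (N k i) ∘L W ∘L (w i : F →L[ℂ] F)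
      have hadj : ∀ k i, adjoint (σ (N k i) ∘L W ∘L (w i : F →L[ℂ] F)) =
          adjoint (w i : F →L[ℂ] F) ∘L adjoint W ∘L σ (star (N k i)) := fun k i => by
        rw [map_star, star_eq_adjoint, adjoint_comp, adjoint_comp, comp_assoc]
      have hentry : ∀ i j, (star N * N) i j = ∑ k, star (N k i) * N k j := fun i j =>
        CStarMatrix.mul_apply
      have h : ((∑ i, ∑ j, star (w i) * ((star N * N).map Θ) i j * w j : S) : F →L[ℂ] F) =
          ∑ k, adjoint (T k) ∘L T k := by
        have h1 : ∀ i j, ((star (w i) * ((star N * N).map Θ) i j * w j : S) : F →L[ℂ] F) =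
            ∑ k, adjoint (σ (N k i) ∘L W ∘L (w i : F →L[ℂ] F)) ∘L
              (σ (N k j) ∘L W ∘L (w j : F →L[ℂ] F)) := by
          intro i j
          change adjoint (w i : F →L[ℂ] F) ∘L (adjoint W ∘L σ ((star N * N) i j) ∘L W) ∘L
            (w j : F →L[ℂ] F) = _
          rw [hentry, map_sum, finsetSum_comp, comp_finsetSum, finsetSum_comp, comp_finsetSum]
          refine Finset.sum_congr rfl fun k _ => ?_
          rw [hadj, map_mul]
          rfl
        rw [AddSubmonoidClass.coe_finsetSum]
        simp only [AddSubmonoidClass.coe_finsetSum, h1]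
        have h2 : ∀ k, adjoint (T k) ∘L T k = ∑ i, ∑ j,
            adjoint (σ (N k i) ∘L W ∘L (w i : F →L[ℂ] F)) ∘L
              (σ (N k j) ∘L W ∘L (w j : F →L[ℂ] F)) := fun k => by
          simp only [T]
          rw [map_sum, finsetSum_comp]
          exact Finset.sum_congr rfl fun i _ => comp_finsetSum _ _
        simp only [h2]
        exact (Finset.sum_congr rfl fun i _ => Finset.sum_comm).trans Finset.sum_comm
      change (0 : F →L[ℂ] F) ≤ ((∑ i, ∑ j, star (w i) * ((star N * N).map Θ) i j * w j : S) :
        F →L[ℂ] F)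
      rw [h]
      exact Finset.sum_nonneg fun k _ =>
        (nonneg_iff_isPositive _).2 (isPositive_adjoint_comp_self _)

end Compression

/-! ### Stinespring dilations -/

section Stinespring

variable {A B K : Type*} [CStarAlgebra A] [PartialOrder A] [StarOrderedRing A] [CStarAlgebra B]
  [PartialOrder B] [StarOrderedRing B] [NormedAddCommGroup K] [InnerProductSpace ℂ K]
  [CompleteSpace K] (π : B →⋆ₐ[ℂ] (K →L[ℂ] K)) (θ : A →CP B)

/-- The operator-valued kernel `(a, b) ↦ π(θ(a* b))` on `A`. -/
def stinespringKernel : Matrix A A (K →L[ℂ] K) := .of fun a b => π (θ (star a * b))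

theorem adjoint_stinespringKernel (a b : A) (h k : K) :
    ⟪π (θ (star a * b)) h, k⟫_ℂ = ⟪h, π (θ (star b * a)) k⟫_ℂ := by
  rw [← star_star (star b * a), star_mul, star_star, map_star θ, map_star π,
    ContinuousLinearMap.star_eq_adjoint, ContinuousLinearMap.adjoint_inner_right]

/-- The positive matrix with the entries `θ(a* b)` is of the form `S* S`. -/
theorem exists_factorization (s : Finset A) :
    ∃ S : CStarMatrix s s B, ∀ a b : s, θ (star (a : A) * b) = ∑ k, star (S k a) * S k b := by
  classical
  rcases isEmpty_or_nonempty s with h | ⟨⟨a₀⟩⟩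
  · exact ⟨0, fun a => h.elim a⟩
  -- a matrix with the elements of `s` as its only nonzero row
  let N : CStarMatrix s s A := CStarMatrix.ofMatrix (.of fun k a => if k = a₀ then (a : A) else 0)
  have hN : ∀ a b : s, (star N * N) a b = star (a : A) * b := by
    intro a b
    rw [CStarMatrix.mul_apply, Finset.sum_eq_single a₀]
    · change star (if a₀ = a₀ then (a : A) else 0) * (if a₀ = a₀ then (b : A) else 0) = _
      rw [if_pos rfl, if_pos rfl]
    · intro k _ hk
      change star (if k = a₀ then (a : A) else 0) * (if k = a₀ then (b : A) else 0) = _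
      rw [if_neg hk, if_neg hk, mul_zero]
    · simp
  obtain ⟨S, hS⟩ := exists_eq_star_mul_self
    (θ.map_cstarMatrix_nonneg (star N * N) (star_mul_self_nonneg N))
  refine ⟨S, fun a b => ?_⟩
  rw [← hN]
  have := congrFun (congrFun hS a) b
  rw [CStarMatrix.mul_apply] at this
  exact this

instance : Fact (stinespringKernel π θ).PosSemidef := by
  have hiff : (stinespringKernel π θ).PosSemidef ↔ (stinespringKernel π θ).IsHermitian ∧
      ∀ w : A →₀ K, 0 ≤ RCLike.re
        (w.sum fun a h => w.sum fun b k => ⟪stinespringKernel π θ b a h, k⟫_ℂ) :=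
    RKHS.posSemidef_tfae.out 0 2
  refine ⟨hiff.2 ⟨?_, fun w => ?_⟩⟩
  · refine Matrix.ext fun a b => ContinuousLinearMap.ext fun h : K =>
      ext_inner_right (E := K) ℂ fun k => ?_
    rw [Matrix.conjTranspose_apply, ContinuousLinearMap.star_eq_adjoint,
      ContinuousLinearMap.adjoint_inner_left]
    exact (adjoint_stinespringKernel π θ a b h k).symm
  · obtain ⟨S, hS⟩ := exists_factorization θ w.support
    have h : (w.sum fun a h => w.sum fun b k => ⟪stinespringKernel π θ b a h, k⟫_ℂ) =
        ∑ i, ⟪∑ a : w.support, π (S i a) (w a), ∑ a : w.support, π (S i a) (w a)⟫_ℂ := by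
      simp only [sum_inner]
      simp only [inner_sum]
      rw [Finsupp.sum, ← Finset.sum_coe_sort]
      conv_rhs => rw [Finset.sum_comm]
      refine Finset.sum_congr rfl fun a _ => ?_
      rw [Finsupp.sum, ← Finset.sum_coe_sort]
      conv_rhs => rw [Finset.sum_comm]
      refine Finset.sum_congr rfl fun b _ => ?_
      change ⟪π (θ (star (b : A) * a)) (w a), w b⟫_ℂ = _
      rw [hS, map_sum, sum_apply, sum_inner]
      refine Finset.sum_congr rfl fun i _ => ?_
      rw [map_mul, map_star, mul_apply_eq_comp, ContinuousLinearMap.star_eq_adjoint,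
        ContinuousLinearMap.adjoint_inner_left]
    rw [h, map_sum]
    exact Finset.sum_nonneg fun i _ => inner_self_nonneg

/-- The Hilbert space of the Stinespring dilation of `π ∘ θ`. -/
abbrev StinespringSpace : Type _ := RKHS.OfKernel (stinespringKernel π θ)

/-- The vector `a ⊗ h` of the Stinespring space. -/
def stinespringVec (a : A) : K →L[ℂ] StinespringSpace π θ := RKHS.kerFun (StinespringSpace π θ) a

theorem inner_stinespringVec (a b : A) (h k : K) :
    ⟪stinespringVec π θ a h, stinespringVec π θ b k⟫_ℂ = ⟪h, π (θ (star a * b)) k⟫_ℂ := by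
  rw [stinespringVec, stinespringVec, ← RKHS.kernel_inner, RKHS.OfKernel.kernel_ofKernel]
  exact adjoint_stinespringKernel π θ b a h k

theorem stinespringVec_total : (Submodule.span ℂ (Set.range fun i : A × K =>
    stinespringVec π θ i.1 i.2)).topologicalClosure = ⊤ := by
  rw [← RKHS.kerFun_dense (𝕜 := ℂ) (X := A) (V := K) (StinespringSpace π θ)]
  congr 2
  ext x
  simp [stinespringVec]

theorem stinespring_ext {G : Type*} [NormedAddCommGroup G] [NormedSpace ℂ G]
    {S T : StinespringSpace π θ →L[ℂ] G}
    (h : ∀ a k, S (stinespringVec π θ a k) = T (stinespringVec π θ a k)) : S = T := by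
  refine ContinuousLinearMap.ext_on
    (Submodule.dense_iff_topologicalClosure_eq_top.2 (stinespringVec_total π θ)) ?_
  rintro _ ⟨i, rfl⟩
  exact h i.1 i.2

/-- Left multiplication by `b` is bounded on the Stinespring space: if `‖b‖² - b* b = y* y`, then
`‖b a ⊗ h‖² + ‖y a ⊗ h‖² = ‖b‖² ‖a ⊗ h‖²`, and likewise for linear combinations. -/
theorem exists_stinespring_operator (b : A) :
    ∃ T : StinespringSpace π θ →L[ℂ] StinespringSpace π θ,
      ∀ a h, T (stinespringVec π θ a h) = stinespringVec π θ (b * a) h := by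
  -- left multiplication of the first factors on formal linear combinations
  let f : A → (A × K →₀ ℂ) →ₗ[ℂ] StinespringSpace π θ := fun t =>
    Finsupp.linearCombination ℂ fun i : A × K => stinespringVec π θ (t * i.1) i.2
  let form : A → (A × K →₀ ℂ) → ℂ := fun t c => c.sum fun i x => c.sum fun j y =>
    (starRingEnd ℂ) x * (y * ⟪i.2, π (θ (star i.1 * (t * j.1))) j.2⟫_ℂ)
  have hf : ∀ t c, ((‖f t c‖ ^ 2 : ℝ) : ℂ) = form (star t * t) c := by
    intro t c
    have h1 : ((‖f t c‖ ^ 2 : ℝ) : ℂ) = ⟪f t c, f t c⟫_ℂ := by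
      rw [inner_self_eq_norm_sq_to_K]
      exact Complex.ofReal_pow _ _
    rw [h1]
    simp only [f, form, Finsupp.linearCombination_apply, Finsupp.sum, sum_inner, inner_sum,
      inner_smul_left, inner_smul_right, inner_stinespringVec, star_mul, mul_assoc]
    rw [Finset.sum_comm]
    refine Finset.sum_congr rfl fun i _ => ?_
    rw [Finset.mul_sum]
    exact Finset.sum_congr rfl fun j _ => by ring
  have hbound : ∀ c, ‖f b c‖ ≤ ‖b‖ * ‖f 1 c‖ := by
    intro c
    obtain ⟨y, hy⟩ := exists_eq_star_mul_self
      (sub_nonneg.2 (CStarAlgebra.star_mul_le_algebraMap_norm_sq (a := b)))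
    have h1 : form (star y * y) c = ((‖b‖ ^ 2 : ℝ) : ℂ) * form (star 1 * 1) c -
        form (star b * b) c := by
      rw [← hy, star_one, mul_one, Algebra.algebraMap_eq_smul_one, ← Complex.coe_smul]
      simp only [form, Finsupp.sum, sub_mul, mul_sub, map_sub, sub_apply, inner_sub_right,
        Finset.sum_sub_distrib, smul_mul_assoc, mul_smul_comm, map_smul, smul_apply,
        inner_smul_right, Finset.mul_sum]
      congr 1
      exact Finset.sum_congr rfl fun i _ => Finset.sum_congr rfl fun j _ => by ring
    rw [← hf, ← hf, ← hf, ← Complex.ofReal_mul, ← Complex.ofReal_sub, Complex.ofReal_inj] at h1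
    have h2 : ‖f b c‖ ^ 2 ≤ (‖b‖ * ‖f 1 c‖) ^ 2 := by
      rw [mul_pow]
      linarith [sq_nonneg ‖f y c‖]
    exact le_of_sq_le_sq h2 (by positivity)
  have hdense : DenseRange (f 1) := by
    rw [DenseRange, ← LinearMap.coe_range, Finsupp.range_linearCombination]
    simp only [one_mul]
    exact Submodule.dense_iff_topologicalClosure_eq_top.2 (stinespringVec_total π θ)
  refine ⟨(f b).extendOfNorm (f 1), fun a h => ?_⟩
  have h1 := LinearMap.extendOfNorm_eq hdense ⟨_, hbound⟩ (Finsupp.single (a, h) 1)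
  simpa only [f, Finsupp.linearCombination_single, one_smul, one_mul] using h1

/-- Left multiplication of the first factors of the vectors `a ⊗ h` is a representation of `A` on
the Stinespring space. -/
theorem exists_stinespringRep :
    ∃ ρ : A →⋆ₐ[ℂ] (StinespringSpace π θ →L[ℂ] StinespringSpace π θ),
      ∀ b a h, ρ b (stinespringVec π θ a h) = stinespringVec π θ (b * a) h := by
  choose T hT using exists_stinespring_operator π θ
  have hadd : ∀ a b h, stinespringVec π θ (a + b) h =
      stinespringVec π θ a h + stinespringVec π θ b h := fun a b h => by
    refine RKHS.ext fun x => ext_inner_left ℂ fun k => ?_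
    rw [← RKHS.kerFun_inner, ← RKHS.kerFun_inner, inner_add_right]
    change ⟪stinespringVec π θ x k, _⟫_ℂ = ⟪stinespringVec π θ x k, _⟫_ℂ +
      ⟪stinespringVec π θ x k, _⟫_ℂ
    simp only [inner_stinespringVec, mul_add, map_add, add_apply, inner_add_right]
  have hsmul : ∀ (c : ℂ) a h, stinespringVec π θ (c • a) h = c • stinespringVec π θ a h :=
    fun c a h => by
    refine RKHS.ext fun x => ext_inner_left ℂ fun k => ?_
    rw [← RKHS.kerFun_inner, ← RKHS.kerFun_inner, inner_smul_right]
    change ⟪stinespringVec π θ x k, _⟫_ℂ = c * ⟪stinespringVec π θ x k, _⟫_ℂ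
    simp only [inner_stinespringVec, mul_smul_comm, map_smul, smul_apply, inner_smul_right]
  have h1 : T 1 = 1 := stinespring_ext π θ fun a h => by rw [hT, one_mul]; rfl
  have hTs : ∀ c : ℂ, ∀ b, T (c • b) = c • T b := fun c b => stinespring_ext π θ fun a h => by
    rw [hT, smul_mul_assoc, hsmul, smul_apply, hT]
  refine ⟨{ toFun := T
            map_one' := h1
            map_mul' := fun b b' => stinespring_ext π θ fun a h => by
              rw [hT, mul_apply_eq_comp, hT, hT, mul_assoc]
            map_zero' := by simpa using hTs 0 0
            map_add' := fun b b' => stinespring_ext π θ fun a h => by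
              rw [hT, add_mul, hadd, add_apply, hT, hT]
            commutes' := fun c => by
              rw [Algebra.algebraMap_eq_smul_one, hTs, h1, Algebra.algebraMap_eq_smul_one]
            map_star' := fun b => stinespring_ext π θ fun a h => by
              refine RKHS.ext fun x => ext_inner_left ℂ fun k => ?_
              rw [← RKHS.kerFun_inner, ← RKHS.kerFun_inner, hT,
                ContinuousLinearMap.star_eq_adjoint, ContinuousLinearMap.adjoint_inner_right]
              change ⟪stinespringVec π θ x k, _⟫_ℂ = ⟪T b (stinespringVec π θ x k), _⟫_ℂ
              rw [hT, inner_stinespringVec, inner_stinespringVec, star_mul, mul_assoc] }, hT⟩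

/-- The Stinespring dilation: a unital completely positive map is the compression of a
representation to a subspace. -/
theorem exists_stinespring (hθ : θ 1 = 1) :
    ∃ (ρ : A →⋆ₐ[ℂ] (StinespringSpace π θ →L[ℂ] StinespringSpace π θ))
      (W : K →ₗᵢ[ℂ] StinespringSpace π θ), ∀ a h k, ⟪W h, ρ a (W k)⟫_ℂ = ⟪h, π (θ a) k⟫_ℂ := by
  obtain ⟨ρ, hρ⟩ := exists_stinespringRep π θ
  refine ⟨ρ, (stinespringVec π θ 1).toLinearMap.isometryOfInner fun h k => ?_, fun a h k => ?_⟩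
  · change ⟪stinespringVec π θ 1 h, stinespringVec π θ 1 k⟫_ℂ = _
    rw [inner_stinespringVec, star_one, one_mul, hθ, map_one]
    rfl
  · change ⟪stinespringVec π θ 1 h, ρ a (stinespringVec π θ 1 k)⟫_ℂ = _
    rw [hρ, inner_stinespringVec, star_one, one_mul, mul_one]

end Stinespring

/-! ### Second quantization of isometries of pointed Hilbert spaces -/

section MapLegs

variable {V : Type*} {Γ : SimpleGraph V} {K E : V → Type*} [∀ v, NormedAddCommGroup (K v)]
  [∀ v, InnerProductSpace ℂ (K v)] [∀ v, NormedAddCommGroup (E v)]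
  [∀ v, InnerProductSpace ℂ (E v)] {η : ∀ v, K v} {ζ : ∀ v, E v}

/-- Maps between the orthogonal complements of the distinguished vectors, applied to each leg. -/
def mapLegs (f : ∀ v, ((ℂ ∙ η v)ᗮ : Submodule ℂ (K v)) → ((ℂ ∙ ζ v)ᗮ : Submodule ℂ (E v)))
    (x : List (Leg η)) : List (Leg ζ) := x.map fun p => ⟨p.1, f p.1 p.2⟩

variable (f : ∀ v, ((ℂ ∙ η v)ᗮ : Submodule ℂ (K v)) → ((ℂ ∙ ζ v)ᗮ : Submodule ℂ (E v)))
  (g : ∀ v, ((ℂ ∙ ζ v)ᗮ : Submodule ℂ (E v)) → ((ℂ ∙ η v)ᗮ : Submodule ℂ (K v)))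

theorem word_mapLegs (x : List (Leg η)) : word (mapLegs f x) = word x := by
  rw [word, mapLegs, List.map_map]
  rfl

theorem legs_mapLegs (v : V) (x : List (Leg η)) :
    legs ζ v (mapLegs f x) = (legs η v x).map (f v) := by
  induction x with
  | nil => rfl
  | cons p x ih =>
    obtain ⟨u, a⟩ := p
    change legs ζ v (⟨u, f u a⟩ :: mapLegs f x) = _
    by_cases h : u = v
    · subst h
      rw [legs_cons_same, legs_cons_same, List.map_cons, ih]
    · rw [legs_cons_ne h, legs_cons_ne h, ih]

theorem listInner_map {F G : Type*} [NormedAddCommGroup F] [InnerProductSpace ℂ F]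
    [NormedAddCommGroup G] [InnerProductSpace ℂ G] {f : F → G} {g : G → F}
    (h : ∀ a b, ⟪f a, b⟫_ℂ = ⟪a, g b⟫_ℂ) (l : List F) (m : List G) :
    listInner (l.map f) m = listInner l (m.map g) := by
  induction l generalizing m with
  | nil => cases m <;> rfl
  | cons a l ih =>
    cases m with
    | nil => rfl
    | cons b m => rw [List.map_cons, List.map_cons, listInner, listInner, h, ih]

variable {f g}

/-- Maps of legs that are adjoint to each other induce adjoint maps of elementary tensors. -/
theorem inner_vec_mapLegs (h : ∀ v a b, ⟪f v a, b⟫_ℂ = ⟪a, g v b⟫_ℂ) (x : List (Leg η))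
    (y : List (Leg ζ)) : ⟪vec Γ (mapLegs f x), vec Γ y⟫_ℂ = ⟪vec Γ x, vec Γ (mapLegs g y)⟫_ℂ := by
  by_cases hx : IsReduced Γ (word x)
  · by_cases hy : IsReduced Γ (word y)
    · have hx' := (word_mapLegs f x).symm ▸ hx
      have hy' := (word_mapLegs g y).symm ▸ hy
      rw [vec_of_isReduced hx, vec_of_isReduced hy, vec_of_isReduced hx', vec_of_isReduced hy',
        inner_tens, inner_tens]
      have h1 : WordEquiv Γ (word (mapLegs f x)) (word y) ↔
          WordEquiv Γ (word x) (word (mapLegs g y)) := by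
        rw [word_mapLegs, word_mapLegs]
      have h2 : (∏ᶠ v, listInner (legs ζ v (mapLegs f x)) (legs ζ v y)) =
          ∏ᶠ v, listInner (legs η v x) (legs η v (mapLegs g y)) :=
        finprod_congr fun v => by rw [legs_mapLegs, legs_mapLegs, listInner_map (h v)]
      by_cases h3 : WordEquiv Γ (word x) (word (mapLegs g y))
      · exact (if_pos (h1.2 h3)).trans (h2.trans (if_pos h3).symm)
      · exact (if_neg fun h4 => h3 (h1.1 h4)).trans (if_neg h3).symm
    · rw [vec_of_not_isReduced hy, vec_of_not_isReduced (x := mapLegs g y) (by rwa [word_mapLegs]),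
        inner_zero_right, inner_zero_right]
  · rw [vec_of_not_isReduced hx, vec_of_not_isReduced (x := mapLegs f x) (by rwa [word_mapLegs]),
      inner_zero_left, inner_zero_left]

end MapLegs

section Quantization

variable {V : Type*} (Γ : SimpleGraph V) {K E : V → Type*} [∀ v, NormedAddCommGroup (K v)]
  [∀ v, InnerProductSpace ℂ (K v)] [∀ v, CompleteSpace (K v)] [∀ v, NormedAddCommGroup (E v)]
  [∀ v, InnerProductSpace ℂ (E v)] [∀ v, CompleteSpace (E v)] {η : ∀ v, K v} {ζ : ∀ v, E v}
  (hη : ∀ v, ‖η v‖ = 1) (hζ : ∀ v, ‖ζ v‖ = 1) (W : ∀ v, K v →ₗᵢ[ℂ] E v)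
  (hW : ∀ v, W v (η v) = ζ v)

/-- The isometry `W v` on the complement of the distinguished vector. -/
def legUp (v : V) (a : ((ℂ ∙ η v)ᗮ : Submodule ℂ (K v))) : ((ℂ ∙ ζ v)ᗮ : Submodule ℂ (E v)) :=
  ⟨W v a, by
    rw [Submodule.mem_orthogonal_singleton_iff_inner_right, ← hW, LinearIsometry.inner_map_map]
    exact inner_leg v a⟩

/-- The coisometry `(W v)*`. -/
abbrev coiso (v : V) : E v →L[ℂ] K v :=
  ContinuousLinearMap.adjoint (W v).toContinuousLinearMap

theorem inner_coiso (v : V) (a : K v) (b : E v) : ⟪a, coiso W v b⟫_ℂ = ⟪W v a, b⟫_ℂ :=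
  ContinuousLinearMap.adjoint_inner_right _ _ _

theorem coiso_apply (v : V) (a : K v) : coiso W v (W v a) = a :=
  ext_inner_left ℂ fun b => by rw [inner_coiso, LinearIsometry.inner_map_map]

/-- The coisometry `(W v)*` on the complement of the distinguished vector. -/
def legDown (v : V) (b : ((ℂ ∙ ζ v)ᗮ : Submodule ℂ (E v))) : ((ℂ ∙ η v)ᗮ : Submodule ℂ (K v)) :=
  ⟨coiso W v b, by
    rw [Submodule.mem_orthogonal_singleton_iff_inner_right, inner_coiso, hW]
    exact inner_leg v b⟩

theorem inner_legUp (v : V) (a : ((ℂ ∙ η v)ᗮ : Submodule ℂ (K v)))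
    (b : ((ℂ ∙ ζ v)ᗮ : Submodule ℂ (E v))) :
    ⟪legUp W hW v a, b⟫_ℂ = ⟪a, legDown W hW v b⟫_ℂ := by
  rw [Submodule.coe_inner, Submodule.coe_inner]
  exact (inner_coiso W v _ _).symm

theorem mapLegs_legDown_legUp (x : List (Leg η)) :
    mapLegs (legDown W hW) (mapLegs (legUp W hW) x) = x := by
  rw [mapLegs, mapLegs, List.map_map]
  refine List.map_id'' (fun p => ?_) x
  exact congrArg (Sigma.mk p.1) (Subtype.ext (coiso_apply W p.1 _))

/-- The isometry of Fock spaces that applies `W v` to each leg. -/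
theorem exists_fockIsometry : ∃ T : Fock Γ η →ₗᵢ[ℂ] Fock Γ ζ,
    (∀ x, T (vec Γ x) = vec Γ (mapLegs (legUp W hW) x)) ∧
    ∀ y, ContinuousLinearMap.adjoint T.toContinuousLinearMap (vec Γ y) =
      vec Γ (mapLegs (legDown W hW) y) := by
  obtain ⟨T, hT, -⟩ := exists_isometry (fun x : List (Leg η) => vec Γ x)
    (fun x => vec Γ (mapLegs (legUp W hW) x)) vec_total fun x y => by
      rw [inner_vec_mapLegs (inner_legUp W hW), mapLegs_legDown_legUp]
  refine ⟨T, hT, fun y => ?_⟩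
  have h : innerSL ℂ (ContinuousLinearMap.adjoint T.toContinuousLinearMap (vec Γ y)) =
      innerSL ℂ (vec Γ (mapLegs (legDown W hW) y)) := clm_ext_vec fun x _ => by
    rw [innerSL_apply_apply, innerSL_apply_apply, ContinuousLinearMap.adjoint_inner_left,
      ← inner_conj_symm, ← inner_conj_symm (vec Γ (mapLegs (legDown W hW) y)),
      ← inner_vec_mapLegs (inner_legUp W hW), ← hT]
    rfl
  refine ext_inner_right ℂ fun z => ?_
  have := congrArg (fun S => S z) h
  simpa only [innerSL_apply_apply] using this

variable {Γ} {T : Fock Γ η →ₗᵢ[ℂ] Fock Γ ζ}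
  (hT : ∀ y, ContinuousLinearMap.adjoint T.toContinuousLinearMap (vec Γ y) =
    vec Γ (mapLegs (legDown W hW) y))

include hT in
theorem adjoint_prefixVec (v : V) (h : E v) (y : List (Leg ζ)) :
    ContinuousLinearMap.adjoint T.toContinuousLinearMap (prefixVec Γ hζ v h y) =
      prefixVec Γ hη v (coiso W v h) (mapLegs (legDown W hW) y) := by
  rw [prefixVec, prefixVec, map_add, map_smul, hT, hT, inner_coiso, hW]
  congr 2
  change (⟨v, legDown W hW v (centre (hζ v) h)⟩ : Leg η) :: mapLegs (legDown W hW) y = _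
  congr 2
  refine Subtype.ext ?_
  change coiso W v (h - ⟪ζ v, h⟫_ℂ • ζ v) = coiso W v h - ⟪η v, coiso W v h⟫_ℂ • η v
  rw [map_sub, map_smul, inner_coiso, hW]
  congr 2
  rw [← hW, coiso_apply]

include hT in
/-- The adjoint of the isometry intertwines `λᵥ(t)` and the compression `λᵥ(W* t W)` on elementary
tensors, provided that the leg on which `λᵥ(t)` acts is in the range of `W v`. -/
theorem adjoint_lamHom_vec {v : V} (t : E v →L[ℂ] E v) {y : List (Leg ζ)}
    (hy : IsReduced Γ (word y))
    (hrange : ∀ p m, extract Γ Sigma.fst v y = some (p, m) → W p.1 (coiso W p.1 p.2) = p.2) :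
    ContinuousLinearMap.adjoint T.toContinuousLinearMap (lamHom Γ hζ v t (vec Γ y)) =
      lamHom Γ hη v (coiso W v ∘L t ∘L (W v).toContinuousLinearMap)
        (ContinuousLinearMap.adjoint T.toContinuousLinearMap (vec Γ y)) := by
  cases he : extract Γ Sigma.fst v y with
  | none =>
    have hr : IsReduced Γ (v :: word y) := isReduced_cons_iff.2 ⟨hy, extract_map_eq_none.2 he⟩
    rw [lamHom_vec hζ hr, adjoint_prefixVec hη hζ W hW hT, hT, lamHom_vec hη (by rwa [word_mapLegs])]
    congr 1
    change _ = coiso W v (t (W v (η v)))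
    rw [hW]
  | some x =>
    obtain ⟨⟨u, a⟩, m⟩ := x
    obtain rfl : u = v := label_extract he
    have hs := shuffle_of_extract he
    have hr : IsReduced Γ (u :: word m) := hs.isReduced_word.1 hy
    have ha : W u (coiso W u a) = a := hrange _ _ he
    rw [hs.vec_eq, lamHom_vec_cons hζ hr, adjoint_prefixVec hη hζ W hW hT, hT]
    change _ = lamHom Γ hη u _ (vec Γ (⟨u, legDown W hW u a⟩ :: mapLegs (legDown W hW) m))
    rw [lamHom_vec_cons hη (by rwa [word_mapLegs])]
    congr 1
    change _ = coiso W u (t (W u (coiso W u a)))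
    rw [ha]

variable {A B : V → Type*} [∀ v, CStarAlgebra (A v)] [∀ v, PartialOrder (A v)]
  [∀ v, StarOrderedRing (A v)] [∀ v, CStarAlgebra (B v)] {φ : ∀ v, A v →ₚ[ℂ] ℂ}
  {σ : ∀ v, A v →⋆ₐ[ℂ] (E v →L[ℂ] E v)} (hσ : ∀ v a, ⟪ζ v, σ v a (ζ v)⟫_ℂ = φ v a)
  {π : ∀ v, B v →⋆ₐ[ℂ] (K v →L[ℂ] K v)} {θ : ∀ v, A v → B v}
  (hθ : ∀ v a h k, ⟪W v h, σ v a (W v k)⟫_ℂ = ⟪h, π v (θ v a) k⟫_ℂ)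

include hW hσ hT hθ in
/-- The compression of a reduced word of operators is the reduced word of the compressions. The
induction on the word works because a letter of a reduced word acts only on a leg that the letters
to its right left untouched, and these legs are in the ranges of the isometries `W v`. -/
theorem adjoint_repTensor_vec {l : List (Σ v, A v)} (hl : IsReducedTensor Γ φ l)
    {x : List (Leg η)} (hx : IsReduced Γ (word x)) :
    ContinuousLinearMap.adjoint T.toContinuousLinearMap
        (repTensor (fockRep Γ hζ σ) l (vec Γ (mapLegs (legUp W hW) x))) =
      repTensor (fockRep Γ hη π) (l.map fun p => ⟨p.1, θ p.1 p.2⟩) (vec Γ x) := by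
  have hz : IsReduced Γ (word (mapLegs (legUp W hW) x)) := by rwa [word_mapLegs]
  induction l with
  | nil =>
    change ContinuousLinearMap.adjoint T.toContinuousLinearMap
      (vec Γ (mapLegs (legUp W hW) x)) = vec Γ x
    rw [hT, mapLegs_legDown_legUp]
  | cons p l ih =>
    obtain ⟨v, a⟩ := p
    have hcomp : coiso W v ∘L σ v a ∘L (W v).toContinuousLinearMap = π v (θ v a) :=
      ContinuousLinearMap.ext fun k => ext_inner_left ℂ fun h =>
        (inner_coiso W v h _).trans (hθ v a h k)
    rw [repTensor_cons, mul_apply_eq_comp, List.map_cons, repTensor_cons, mul_apply_eq_comp,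
      ← ih hl.of_cons, fockRep_apply, fockRep_apply]
    change _ = lamHom Γ hη v (π v (θ v a)) _
    rw [← hcomp]
    have hmem := repTensor_vec_mem hζ hσ hl.of_cons hz
    generalize repTensor (fockRep Γ hζ σ) l (vec Γ (mapLegs (legUp W hW) x)) = y at hmem
    induction hmem using Submodule.span_induction with
    | zero => simp only [map_zero]
    | add y y' _ _ hy hy' => simp only [map_add] at hy hy' ⊢; rw [hy, hy']
    | smul c y _ hy => simp only [map_smul] at hy ⊢; rw [hy]
    | mem y hy =>
      obtain ⟨y₁, y₂, w, hr, hsub, -, hs, rfl⟩ := hy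
      refine adjoint_lamHom_vec hη hζ W hW hT _ hr fun q m he => ?_
      have hv : IsReduced Γ (v :: (word y₁ ++ w)) := (Shuffle.cons (f := id) v hs).isReduced hl.1
      have hv1 : extract Γ Sigma.fst v y₁ = none :=
        extract_eq_none_of_isReduced (IsReduced.of_append_left (l := v :: word y₁) hv)
      obtain ⟨-, m', hm', -⟩ := extract_append_eq_some hv1 he
      have hq : q ∈ mapLegs (legUp W hW) x :=
        hsub ((shuffle_of_extract hm').symm.perm.subset (by simp))
      obtain ⟨r, -, rfl⟩ := List.mem_map.1 hq
      exact congrArg (W r.1) (coiso_apply W r.1 (r.2 : K r.1))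

end Quantization

/-! ### The graph product of completely positive maps -/

section Final

variable {V : Type*} (Γ : SimpleGraph V) {A : V → Type*} [∀ v, CStarAlgebra (A v)]
  [∀ v, PartialOrder (A v)] [∀ v, StarOrderedRing (A v)] {φ : ∀ v, A v →ₚ[ℂ] ℂ}
  (hφ : ∀ v, φ v 1 = 1)

theorem dense_span_tensorElem : Dense (Submodule.span ℂ (Set.range
    fun l : {l // IsReducedTensor Γ φ l} => tensorElem Γ hφ l.1 l.2) :
      Set (ReducedGraphProduct Γ hφ)) := by
  rw [Subtype.dense_iff]
  intro x hx
  rw [graphProductSubalgebra_eq_closure] at hx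
  refine closure_mono ?_ hx
  have hle : algebraicGraphProduct Γ hφ ≤ (Submodule.span ℂ (Set.range
      fun l : {l // IsReducedTensor Γ φ l} => tensorElem Γ hφ l.1 l.2)).map
        (inclusion Γ hφ).toAlgHom.toLinearMap := by
    refine Submodule.span_le.2 ?_
    rintro _ ⟨l, hl, rfl⟩
    exact ⟨_, Submodule.subset_span ⟨⟨l, hl⟩, rfl⟩, rfl⟩
  intro y hy
  obtain ⟨z, hz, rfl⟩ := hle hy
  exact ⟨z, hz, rfl⟩

/-- A closed linear condition holds on the reduced graph product if it holds on reduced words. -/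
theorem reducedGraphProduct_induction {G : Type*} [NormedAddCommGroup G] [NormedSpace ℂ G]
    (L : ReducedGraphProduct Γ hφ →ₗ[ℂ] G) (hL : Continuous L) (Q : Submodule ℂ G)
    (hQ : IsClosed (Q : Set G)) (h : ∀ l hl, L (tensorElem Γ hφ l hl) ∈ Q)
    (x : ReducedGraphProduct Γ hφ) : L x ∈ Q := by
  refine (dense_span_tensorElem Γ hφ).induction (P := fun x => L x ∈ Q) ?_ (hQ.preimage hL) x
  intro y hy
  refine (Submodule.span_le (p := Q.comap L)).2 ?_ hy
  rintro _ ⟨l, rfl⟩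
  exact h l.1 l.2

theorem inner_vacuum_lamTensor {l : List (Σ v, A v)} (hl : IsReducedTensor Γ φ l) (hne : l ≠ []) :
    ⟪vacuum Γ (gnsVector φ), lamTensor Γ hφ l (vacuum Γ (gnsVector φ))⟫_ℂ = 0 := by
  have h := inner_cliqueOp_vacuum (norm_gnsVector φ hφ) (inner_gnsVector (φ := φ)) (Γ := Γ)
    List.Pairwise.nil hl 0 0
  rw [cliqueFunctional, if_neg] at h
  · exact h
  · obtain ⟨p, l, rfl⟩ := List.exists_cons_of_ne_nil hne
    exact fun h' => List.not_mem_nil (h' p List.mem_cons_self)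

theorem continuous_vacuumState : Continuous (vacuumState Γ hφ) := by
  have h : Continuous fun x : ReducedGraphProduct Γ hφ =>
      (x : Fock Γ (gnsVector φ) →L[ℂ] Fock Γ (gnsVector φ)) := continuous_subtype_val
  exact (innerSL ℂ (vacuum Γ (gnsVector φ))).continuous.comp
    ((ContinuousLinearMap.apply ℂ (Fock Γ (gnsVector φ))
      (vacuum Γ (gnsVector φ))).continuous.comp h)

end Final

end GraphProduct

end

open GraphProduct in
theorem mainTheorem5 {V : Type*} (Γ : SimpleGraph V) {A B : V → Type*}
    [∀ v, CStarAlgebra (A v)] [∀ v, PartialOrder (A v)] [∀ v, StarOrderedRing (A v)]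
    [∀ v, CStarAlgebra (B v)] [∀ v, PartialOrder (B v)] [∀ v, StarOrderedRing (B v)]
    {φ : ∀ v, A v →ₚ[ℂ] ℂ} {ψ : ∀ v, B v →ₚ[ℂ] ℂ}
    (hφ : ∀ v, φ v 1 = 1) (hψ : ∀ v, ψ v 1 = 1)
    (hφ_faithful : ∀ v, GNSFaithful (φ v)) (hψ_faithful : ∀ v, GNSFaithful (ψ v))
    (θ : ∀ v, A v →CP B v) (hθ_one : ∀ v, θ v 1 = 1)
    (hθ_state : ∀ v a, ψ v (θ v a) = φ v a) :
    (graphProductSubalgebra Γ hφ : Set (Fock Γ (gnsVector φ) →L[ℂ] Fock Γ (gnsVector φ))) =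
        closure (algebraicGraphProduct Γ hφ) ∧
    (graphProductSubalgebra Γ hψ : Set (Fock Γ (gnsVector ψ) →L[ℂ] Fock Γ (gnsVector ψ))) =
        closure (algebraicGraphProduct Γ hψ) ∧
    ∃ Θ : ReducedGraphProduct Γ hφ →CP ReducedGraphProduct Γ hψ,
      (∀ (l : List (Σ v, A v)) (hl : IsReducedTensor Γ φ l),
        inclusion Γ hψ (Θ (tensorElem Γ hφ l hl)) =
          lamTensor Γ hψ (l.map fun p => ⟨p.1, θ p.1 p.2⟩)) ∧
      Θ 1 = 1 ∧
      ∀ x, vacuumState Γ hψ (Θ x) = vacuumState Γ hφ x := by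
  -- the Stinespring dilations of the maps `θ v`, with the images of the cyclic vectors
  choose σ W hσ using fun v => exists_stinespring (ψ v).gnsStarAlgHom (θ v) (hθ_one v)
  have hη := norm_gnsVector ψ hψ
  obtain ⟨ζ, hW⟩ : ∃ ζ : ∀ v, StinespringSpace (ψ v).gnsStarAlgHom (θ v),
      ∀ v, W v (gnsVector ψ v) = ζ v := ⟨_, fun v => rfl⟩
  have hζ : ∀ v, ‖ζ v‖ = 1 := fun v => by rw [← hW, LinearIsometry.norm_map, hη]
  have hσζ : ∀ v a, ⟪ζ v, σ v a (ζ v)⟫_ℂ = φ v a := fun v a => by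
    rw [← hW, hσ, inner_gnsVector, hθ_state]
  obtain ⟨F, hF⟩ := exists_fockRep Γ hφ hφ_faithful hζ hσζ
  obtain ⟨T, hTup, hTdown⟩ := exists_fockIsometry Γ W hW
  have hFc : Continuous F := AddMonoidHomClass.continuous_of_bound F 1 fun x => by
    rw [one_mul]
    exact NonUnitalStarAlgHom.norm_apply_le F x
  -- the map `Θ`, with values in the bounded operators
  let W' := T.toContinuousLinearMap
  let L : ReducedGraphProduct Γ hφ →ₗ[ℂ]
      (Fock Γ (gnsVector ψ) →L[ℂ] Fock Γ (gnsVector ψ)) :=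
    { toFun := fun x => ContinuousLinearMap.adjoint W' ∘L F x ∘L W'
      map_add' := fun x y => by simp
      map_smul' := fun c x => by simp }
  have hLc : Continuous L :=
    continuous_const.clm_comp (hFc.clm_comp continuous_const)
  have hL : ∀ l hl, L (tensorElem Γ hφ l hl) =
      lamTensor Γ hψ (l.map fun p => ⟨p.1, θ p.1 p.2⟩) := fun l hl => clm_ext_vec fun x hx => by
    change ContinuousLinearMap.adjoint W' (F (tensorElem Γ hφ l hl) (T (vec Γ x))) = _
    rw [hF, hTup, lamTensor_eq]
    exact adjoint_repTensor_vec hη hζ W hW hTdown hσζ (θ := fun v => θ v) hσ hl hx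
  have hred : ∀ l, IsReducedTensor Γ φ l →
      IsReducedTensor Γ ψ (l.map fun p => ⟨p.1, θ p.1 p.2⟩) := by
    refine fun l hl => ⟨?_, fun p hp => ?_⟩
    · rw [List.map_map]
      exact hl.1
    · obtain ⟨q, hq, rfl⟩ := List.mem_map.1 hp
      exact (hθ_state _ _).trans (hl.2 q hq)
  have hmem : ∀ x, L x ∈ graphProductSubalgebra Γ hψ := by
    refine reducedGraphProduct_induction Γ hφ L hLc
      (graphProductSubalgebra Γ hψ).toSubalgebra.toSubmodule
      (StarSubalgebra.isClosed_topologicalClosure _) fun l hl => ?_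
    rw [hL]
    exact (tensorElem Γ hψ _ (hred l hl)).2
  refine ⟨graphProductSubalgebra_eq_closure Γ hφ, graphProductSubalgebra_eq_closure Γ hψ,
    compressionCP F W' (graphProductSubalgebra Γ hψ) hmem, hL, Subtype.ext ?_, fun x => ?_⟩
  · change ContinuousLinearMap.adjoint W' ∘L F 1 ∘L W' = 1
    rw [map_one]
    exact T.adjoint_comp_self
  · -- both states vanish on the nonempty reduced words
    let ω : ReducedGraphProduct Γ hφ →ₗ[ℂ] ℂ := vacuumState Γ hψ ∘ₗ
      (compressionCP F W' (graphProductSubalgebra Γ hψ) hmem).toLinearMap - vacuumState Γ hφ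
    have hω : Continuous ω := ((continuous_vacuumState Γ hψ).comp (hLc.subtype_mk hmem)).sub
      (continuous_vacuumState Γ hφ)
    have h := reducedGraphProduct_induction Γ hφ ω hω ⊥ isClosed_singleton (fun l hl => ?_) x
    · exact sub_eq_zero.1 ((Submodule.mem_bot ℂ).1 h)
    · refine (Submodule.mem_bot ℂ).2 (sub_eq_zero.2 ?_)
      change ⟪vacuum Γ (gnsVector ψ), L (tensorElem Γ hφ l hl) (vacuum Γ (gnsVector ψ))⟫_ℂ =
        ⟪vacuum Γ (gnsVector φ), lamTensor Γ hφ l (vacuum Γ (gnsVector φ))⟫_ℂ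
      rw [hL]
      rcases eq_or_ne l [] with rfl | hne
      · change ⟪vacuum Γ (gnsVector ψ), vacuum Γ (gnsVector ψ)⟫_ℂ =
          ⟪vacuum Γ (gnsVector φ), vacuum Γ (gnsVector φ)⟫_ℂ
        rw [inner_self_eq_norm_sq_to_K, inner_self_eq_norm_sq_to_K, norm_vacuum, norm_vacuum]
      · rw [inner_vacuum_lamTensor Γ hφ hl hne,
          inner_vacuum_lamTensor Γ hψ (hred l hl) (by simpa using hne)]
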